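/- Definitions. A classical linkage $\mathcal L$ in $\mathbb R^n$ consists of a finite graph $L$ (no loops or multiple edges), a positive length $\ell(e)$ for each edge $e$, a set $V$ of fixed vertices and a map $\mu\colon V\to\mathbb R^n$. Its configuration space $\mathcal C(\mathcal L)\subset(\mathbb R^n)^{\mathcal V(L)}$ is the set of all maps $\varphi$ from the vertices to $\mathbb R^n$ with $\varphi(v)=\mu(v)$ for $v\in V$ and $|\varphi(v)-\varphi(w)|=\ell(\overline{vw})$ for every edge $\overline{vw}$. $\mathcal L$ is connected if $L$ is. $\mathrm{Euc}(n)$ is the group of maps $z\mapsto Qz+z_0$ of $\mathbb R^n$ with $Q$ orthogonal; it acts diagonally on powers of $\mathbb R^n$, and via the entries of $Q$ and $z_0$ it is a subset of $\mathbb R^{n^2+n}$. For $1\le j\le n$, $O(j)\subset\mathrm{Euc}(n)$ is the subgroup fixing $0,e_1,\dots,e_{n-j}$, where the $e_i$ are the standard basis vectors, and $SO(j)$ is its subgroup of orientation preserving elements. An isomorphism between subsets of Euclidean spaces is a homeomorphism $f$ such that $f$ and $f^{-1}$ are restrictions of entire rational maps (quotients of polynomials with nowhere vanishing denominators); it is an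 analytic isomorphism if instead $f$ and $f^{-1}$ are restrictions of real analytic maps defined on neighbourhoods. Theorem. Let $n\ge 2$, let $Z\subset(\mathbb R^n)^k$ be a compact real algebraic set, and suppose that $Z$ is invariant under the diagonal action of a subgroup $G$ of $\mathrm{Euc}(n)$. Then there are a connected classical linkage $\mathcal L$ in $\mathbb R^n$ and a nonempty finite set $F$ such that $\mathcal C(\mathcal L)$ is analytically isomorphic to $Z\times F$ and such that: 1. If $G$ is conjugate to $O(1)$, then $\mathcal L$ has exactly $n$ fixed vertices, and these are fixed at points of the fixed subspace of $G$. 2. If $G$ is conjugate to $O(2)$ and there is an algebraic subset $Z'\subset Z$ such that $(z,g)\mapsto gz$ is an isomorphism from $Z'\times G^+$ to $Z$, where $G^+\subset G$ is the subgroup of orientation preserving elements, then $\mathcal L$ has exactly $n-1$ fixed vertices, and these are fixed at points of the fixed subspace of $G$. 3. Otherwise, $\mathcal L$ has exactly $n+1$ fixed vertices, and these are fixed at the points $0,e_1,\dots,e_n$. Moreover, for some $m$ the linkage $\mathcal L$ has $k+m$ vertices, which can be ordered so that there is an analytic map $\alpha\colon Z\times F\to(\mathbb R^n)^m$ with $\mathcal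 C(\mathcal L)=\{(x,\alpha(x,f))\mid x\in Z,\ f\in F\}$ and such that $(x,f)\mapsto(x,\alpha(x,f))$ is an analytic isomorphism from $Z\times F$ to $\mathcal C(\mathcal L)$. Conversely to part 2 when $n=2$: if $\mathcal L$ is a connected classical linkage in $\mathbb R^2$ with exactly one fixed vertex and at least one other vertex, then there are an algebraic subset $Z'\subset\mathcal C(\mathcal L)$ and a subgroup $G^+\subset\mathrm{Euc}(2)$ conjugate to $SO(2)$ such that $(z,g)\mapsto gz$ is an isomorphism from $Z'\times G^+$ to $\mathcal C(\mathcal L)$. -/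

import Mathlib

/-- Euclidean `n`-space `ℝⁿ` with its Euclidean norm. -/
abbrev Rn (n : ℕ) : Type := EuclideanSpace ℝ (Fin n)

/-- The group `Euc(n)` of Euclidean motions of `ℝⁿ`, i.e. maps `z ↦ Q z + z₀` with `Q` orthogonal. -/
abbrev Euc (n : ℕ) : Type := Rn n ≃ᵃⁱ[ℝ] Rn n

/-- The standard basis vector `e_i` of `ℝⁿ` (indices start at `0`). -/
noncomputable abbrev stdVec {n : ℕ} (i : Fin n) : Rn n := EuclideanSpace.single i (1 : ℝ)

/-- The subgroup `O(k)` of `Euc(n)`: the motions fixing `0` and the first `n - k` standard basis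
vectors. -/
def orthSubgroup (n k : ℕ) : Subgroup (Euc n) where
  carrier := {β | β 0 = 0 ∧ ∀ i : Fin n, (i : ℕ) + k < n → β (stdVec i) = stdVec i}
  one_mem' := ⟨rfl, fun _ _ => rfl⟩
  mul_mem' := by
    rintro a b ⟨ha, ha'⟩ ⟨hb, hb'⟩
    refine ⟨?_, fun i hi => ?_⟩
    · rw [AffineIsometryEquiv.coe_mul, Function.comp_apply, hb, ha]
    · rw [AffineIsometryEquiv.coe_mul, Function.comp_apply, hb' i hi, ha' i hi]
  inv_mem' := by
    rintro a ⟨ha, ha'⟩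
    have key : ∀ z : Rn n, a z = z → a⁻¹ z = z := fun z hz => by
      have h : a⁻¹ (a z) = z := a.symm_apply_apply z
      rwa [hz] at h
    exact ⟨key 0 ha, fun i hi => key _ (ha' i hi)⟩

/-- The subgroup `Euc(n)⁺` of orientation preserving Euclidean motions. -/
noncomputable def eucPlus (n : ℕ) : Subgroup (Euc n) where
  carrier := {β | 0 < LinearMap.det (β.linear : Rn n →ₗ[ℝ] Rn n)}
  one_mem' := by
    change 0 < LinearMap.det (LinearMap.id : Rn n →ₗ[ℝ] Rn n)
    simp
  mul_mem' := by
    intro a b ha hb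
    change 0 < LinearMap.det
      ((a.linear : Rn n →ₗ[ℝ] Rn n) ∘ₗ (b.linear : Rn n →ₗ[ℝ] Rn n))
    rw [LinearMap.det_comp]
    exact mul_pos ha hb
  inv_mem' := by
    intro a ha
    change 0 < LinearMap.det ((a.linear.symm : Rn n ≃ₗ[ℝ] Rn n) : Rn n →ₗ[ℝ] Rn n)
    rw [LinearEquiv.det_coe_symm]
    exact inv_pos.mpr ha

/-- The subgroup `H` is conjugate to the subgroup `K`. -/
def IsConjSubgroup {Γ : Type*} [Group Γ] (H K : Subgroup Γ) : Prop :=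
  ∃ β : Γ, H = K.map (MulAut.conj β).toMonoidHom

/-- The diagonal action of a Euclidean motion on `(ℝⁿ)^V`. -/
noncomputable def diagAct {n : ℕ} {V : Type*} (g : Euc n) (φ : V → Rn n) : V → Rn n := fun v => g (φ v)

/-- A classical linkage in `ℝⁿ` with vertex set `V` (to be taken finite): a graph, positive lengths
on its edges, a set of fixed vertices, and the points where these are fixed. -/
structure ClassicalLinkage (n : ℕ) (V : Type*) where
  graph : SimpleGraph V
  len : graph.edgeSet → ℝ
  len_pos : ∀ e, 0 < len e
  fixed : Set V
  pos : fixed → Rn n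

/-- The configuration space `𝒞(L)`. -/
def ClassicalLinkage.config {n : ℕ} {V : Type*} (L : ClassicalLinkage n V) : Set (V → Rn n) :=
  {φ | (∀ v : L.fixed, φ v = L.pos v) ∧
    ∀ (v w : V) (h : L.graph.Adj v w), ‖φ v - φ w‖ = L.len ⟨s(v, w), h⟩}

/-- The real coordinates of a point of `(ℝⁿ)^V`. -/
noncomputable def configCoord {n : ℕ} {V : Type*} (φ : V → Rn n) : V × Fin n → ℝ := fun p => φ p.1 p.2

/-- The real coordinates of the motion `z ↦ Q z + z₀`: the entries of `Q` and those of `z₀`. -/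
noncomputable def eucCoord {n : ℕ} (g : Euc n) : (Fin n × Fin n) ⊕ Fin n → ℝ :=
  Sum.elim (fun p => g.linear (stdVec p.2) p.1) (fun i => g 0 i)

/-- The real coordinates of a point of `(ℝⁿ)^V × Euc(n)`. -/
noncomputable def configEucCoord {n : ℕ} {V : Type*} (p : (V → Rn n) × Euc n) :
    (V × Fin n) ⊕ ((Fin n × Fin n) ⊕ Fin n) → ℝ :=
  Sum.elim (configCoord p.1) (eucCoord p.2)

/-- A real algebraic subset of `(ℝⁿ)^V`: the common zeros of a collection of polynomials. -/
def IsRealAlgebraic {n : ℕ} {V : Type*} (Z : Set (V → Rn n)) : Prop :=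
  ∃ S : Set (MvPolynomial (V × Fin n) ℝ),
    Z = {x | ∀ p ∈ S, MvPolynomial.eval (configCoord x) p = 0}

/-- An entire rational map `ℝ^σ → ℝ^τ`: each component is a quotient of two polynomials whose
denominator vanishes nowhere. -/
def IsEntireRational {σ τ : Type*} (f : (σ → ℝ) → (τ → ℝ)) : Prop :=
  ∀ t : τ, ∃ p q : MvPolynomial σ ℝ, ∀ y : σ → ℝ,
    MvPolynomial.eval y q ≠ 0 ∧ f y t = MvPolynomial.eval y p / MvPolynomial.eval y q

/-- With respect to coordinates `a : A → ℝ^σ` and `b : B → ℝ^τ`, the map `f` is an isomorphism from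
`X` to `Y`: a bijection such that, in coordinates, `f` and its inverse are restrictions of entire
rational maps. (Such maps are continuous, so `f` is then a homeomorphism.) -/
def IsRationalIso {A B σ τ : Type*} (a : A → σ → ℝ) (b : B → τ → ℝ) (f : A → B)
    (X : Set A) (Y : Set B) : Prop :=
  Set.BijOn f X Y ∧
    (∃ F : (σ → ℝ) → (τ → ℝ), IsEntireRational F ∧ ∀ x ∈ X, F (a x) = b (f x)) ∧
    ∃ H : (τ → ℝ) → (σ → ℝ), IsEntireRational H ∧ ∀ x ∈ X, H (b (f x)) = a x

/-- The map `(z, g) ↦ g z`, given by the diagonal action, is an isomorphism from `Z' × K` to `Z`. -/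
def ActionIsIso {n : ℕ} {V : Type*} (Z' : Set (V → Rn n)) (K : Subgroup (Euc n))
    (Z : Set (V → Rn n)) : Prop :=
  IsRationalIso configEucCoord configCoord
    (fun p : (V → Rn n) × Euc n => diagAct p.2 p.1) (Z' ×ˢ (K : Set (Euc n))) Z

/-- `f` is an analytic isomorphism from `X` to `Y`: a bijection such that `f` is analytic on a
neighbourhood of `X` and its inverse is the restriction of a map analytic on a neighbourhood
of `Y`. (Such a bijection is a homeomorphism.) -/
def IsAnalyticIso {A B : Type*} [NormedAddCommGroup A] [NormedSpace ℝ A]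
    [NormedAddCommGroup B] [NormedSpace ℝ B] (f : A → B) (X : Set A) (Y : Set B) : Prop :=
  Set.BijOn f X Y ∧ AnalyticOnNhd ℝ f X ∧
    ∃ g : B → A, AnalyticOnNhd ℝ g Y ∧ Set.LeftInvOn g f X

/-- The hypothesis of the rotational case: `G` is conjugate to `O(2)` and there is an algebraic
subset `Z'` of `Z` so that `(z, g) ↦ g z` is an isomorphism from `Z' × G⁺` to `Z`. -/
def RotationalSlice {n : ℕ} {V : Type*} (G : Subgroup (Euc n)) (Z : Set (V → Rn n)) : Prop :=
  IsConjSubgroup G (orthSubgroup n 2) ∧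
    ∃ Z' : Set (V → Rn n), Z' ⊆ Z ∧ IsRealAlgebraic Z' ∧ ActionIsIso Z' (G ⊓ eucPlus n) Z

/-- All fixed vertices of `L` are fixed at points of the fixed subspace of `G`. -/
def ClassicalLinkage.FixedWithin {n : ℕ} {V : Type*} (L : ClassicalLinkage n V)
    (G : Subgroup (Euc n)) : Prop :=
  ∀ v : L.fixed, ∀ g ∈ G, g (L.pos v) = L.pos v

/-! This is Kempe's universality theorem with control of the sheets. A linkage prescribes finitely
many distances, so `Z` has to be the projection of a system of distance equations whose auxiliary
vertices have finitely many positions, varying analytically and never colliding. No single gadget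
behaves well everywhere, and `Definable X X₀` therefore carries two sets: every solution of the
system has its visible vertices in `X`, while over `X₀`, usually a bounded region without degenerate
positions, the solutions form finitely many disjoint analytic sheets. Gadgets compose by
`exists_fam`, and sheets multiply. Once `X = X₀ = Z`, nothing is lost.

The gadgets live in `ℝⁿ`, with elbows confined to a plane by `planarRod`. Braced rhombi give
addition (`add_eq`). Peaucellier's cell, kept away from its degenerate position, gives straight
lines and inversion. The identity `1/(x-1) - 1/(x+1) = 2/(x²-1)` gives squares, polarization gives
products (`mul_eq`), and induction gives polynomials (`eval_eq`). By Hilbert's basis theorem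
finitely many polynomial equations define `Z`, and compactness bounds the ranges in which the
gadgets must work (`of_isRealAlgebraic`).

In `exists_linkage_of_definable` the constants of the system become vertices braced to a rigid frame
of `n + 1` points. If only the first `M` of these are fixed, the configurations are swept by the
motions fixing these `M` points. A fully fixed frame leaves only the identity. For `O(1)` there is
one further motion, a reflection preserving `Z`, which merely adds sheets. For `O(2)` the linkage is
built for the slice `Z'`: the rotations sweep `Z'` out to `Z`, and a reflection again doubles the
sheets (`realizes_of_index_two`).

For the converse, a neighbour of the single fixed vertex `p` moves on a circle about `p`. Fixing its
direction gives the slice, and its position determines the rotation polynomially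
(`actionIsIso_rotation`). -/

namespace LinkageUniversality

open scoped RealInnerProductSpace

/-! ### Systems of distance constraints and definability. -/

/-- A finite system of distance constraints between variable points, indexed by `V`, and constant
points of `ℝⁿ`. -/
structure DistSystem (n : ℕ) (V : Type) where
  K : Type
  finite : Finite K
  src : K → V ⊕ Rn n
  dst : K → V ⊕ Rn n
  len : K → ℝ
  len_pos : ∀ k, 0 < len k

namespace DistSystem

variable {n : ℕ} {V V' : Type}

/-- The assignments satisfying all constraints. -/
def Sat (S : DistSystem n V) (φ : V → Rn n) : Prop :=
  ∀ k, ‖Sum.elim φ id (S.src k) - Sum.elim φ id (S.dst k)‖ = S.len k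

/-- Renaming of variables. -/
def rename (f : V → V') (S : DistSystem n V) : DistSystem n V' where
  K := S.K
  finite := S.finite
  src k := Sum.map f id (S.src k)
  dst k := Sum.map f id (S.dst k)
  len := S.len
  len_pos := S.len_pos

lemma sat_rename (f : V → V') (S : DistSystem n V) (φ : V' → Rn n) :
    (S.rename f).Sat φ ↔ S.Sat (φ ∘ f) := by
  simp [Sat, rename, Sum.elim_map]

/-- The conjunction of a finite family of systems. -/
def all {ι : Type} [Finite ι] (S : ι → DistSystem n V) : DistSystem n V where
  K := Σ i, (S i).K
  finite := by
    have := fun i => (S i).finite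
    infer_instance
  src k := (S k.1).src k.2
  dst k := (S k.1).dst k.2
  len k := (S k.1).len k.2
  len_pos k := (S k.1).len_pos k.2

lemma sat_all {ι : Type} [Finite ι] (S : ι → DistSystem n V) (φ : V → Rn n) :
    (all S).Sat φ ↔ ∀ i, (S i).Sat φ := by
  simp [Sat, all, Sigma.forall]

end DistSystem

/-- `Definable X X₀` says that some system of distance constraints with auxiliary variables
implies membership in `X`, and that over each point of `X₀` the auxiliary variables have
finitely many solutions, given by pointwise distinct analytic functions near `X₀`. -/
def Definable {n : ℕ} {V : Type} [Fintype V] (X X₀ : Set (V → Rn n)) : Prop :=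
  ∃ (W : Type) (_ : Fintype W) (S : DistSystem n (V ⊕ W)) (Φ : Type) (_ : Finite Φ)
    (_ : Nonempty Φ) (w : Φ → (V → Rn n) → W → Rn n),
    (∀ φ ψ, S.Sat (Sum.elim φ ψ) → φ ∈ X) ∧
    (∀ φ ∈ X₀, ∀ ψ, S.Sat (Sum.elim φ ψ) ↔ ∃ f, ψ = w f φ) ∧
    (∀ f a, AnalyticOnNhd ℝ (fun φ => w f φ a) X₀) ∧
    ∀ φ ∈ X₀, Function.Injective fun f => w f φ

namespace Definable

variable {n : ℕ} {V : Type} [Fintype V]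

lemma mono {X Y X₀ Y₀ : Set (V → Rn n)} (h : Definable X X₀) (hX : X ⊆ Y) (h0 : Y₀ ⊆ X₀) :
    Definable Y Y₀ := by
  obtain ⟨W, i, S, Φ, i1, i2, w, h1, h2, h3, h4⟩ := h
  exact ⟨W, i, S, Φ, i1, i2, w, fun φ ψ h => hX (h1 φ ψ h), fun φ hφ => h2 φ (h0 hφ),
    fun f a => (h3 f a).mono h0, fun φ hφ => h4 φ (h0 hφ)⟩

lemma of_sat (S : DistSystem n V) : Definable {φ | S.Sat φ} {φ | S.Sat φ} := by
  refine ⟨Empty, inferInstance, S.rename Sum.inl, Unit, inferInstance, inferInstance,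
    fun _ _ a => a.elim, ?_, ?_, fun _ a => a.elim, fun _ _ _ _ _ => rfl⟩
  · intro φ ψ h
    rwa [DistSystem.sat_rename, Sum.elim_comp_inl] at h
  · intro φ hφ ψ
    rw [DistSystem.sat_rename, Sum.elim_comp_inl]
    exact ⟨fun _ => ⟨(), funext fun a => a.elim⟩, fun _ => hφ⟩

/-- Each system keeps its own auxiliary variables, so their solutions are chosen independently and
the sheets are indexed by a product. -/
lemma all {ι : Type} [Fintype ι] {X X₀ : ι → Set (V → Rn n)} (h : ∀ i, Definable (X i) (X₀ i)) :
    Definable {φ | ∀ i, φ ∈ X i} {φ | ∀ i, φ ∈ X₀ i} := by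
  choose W iW S Φ iΦ nΦ w h1 h2 h3 h4 using h
  let r : ∀ i, V ⊕ W i → V ⊕ Σ i, W i := fun i => Sum.map id (Sigma.mk i)
  have key : ∀ (φ : V → Rn n) (ψ : (Σ i, W i) → Rn n),
      (DistSystem.all fun i => (S i).rename (r i)).Sat (Sum.elim φ ψ) ↔
        ∀ i, (S i).Sat (Sum.elim φ fun a => ψ ⟨i, a⟩) := by
    intro φ ψ
    rw [DistSystem.sat_all]
    refine forall_congr' fun i => ?_
    rw [DistSystem.sat_rename, Sum.elim_comp_map]
    rfl
  refine ⟨Σ i, W i, inferInstance, DistSystem.all fun i => (S i).rename (r i), ∀ i, Φ i,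
    inferInstance, inferInstance, fun f φ a => w a.1 (f a.1) φ a.2, ?_, ?_, ?_, ?_⟩
  · intro φ ψ h i
    exact h1 i _ _ ((key φ ψ).1 h i)
  · intro φ hφ ψ
    rw [key]
    constructor
    · intro h
      choose f hf using fun i => (h2 i φ (hφ i) _).1 (h i)
      exact ⟨f, funext fun a => congrFun (hf a.1) a.2⟩
    · rintro ⟨f, rfl⟩ i
      exact (h2 i φ (hφ i) _).2 ⟨f i, rfl⟩
  · intro f a φ hφ
    exact h3 a.1 (f a.1) a.2 φ (hφ a.1)
  · intro φ hφ f g hfg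
    refine funext fun i => h4 i φ (hφ i) (funext fun a => ?_)
    exact congrFun hfg ⟨i, a⟩

lemma and {X Y X₀ Y₀ : Set (V → Rn n)} (h : Definable X X₀) (h' : Definable Y Y₀) :
    Definable (X ∩ Y) (X₀ ∩ Y₀) := by
  have := all (ι := Bool) (X := fun b => cond b X Y) (X₀ := fun b => cond b X₀ Y₀)
    (by rintro (_ | _) <;> assumption)
  refine this.mono (fun φ h => ⟨h true, h false⟩) ?_
  rintro φ ⟨h, h'⟩ (_ | _) <;> assumption

/-- The elimination principle by which gadgets are composed: the vertices `u`, visible to the inner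
system, become auxiliary. Uniqueness is tested on the weak set `X`, which is all that the
constraints guarantee, whereas the sections `y` must land in the good set `X₀`. A sheet is now a
section together with a sheet of the inner system over it. -/
lemma exists_fam {U : Type} [Fintype U] {Ψ : Type} [Finite Ψ] [Nonempty Ψ]
    {X X₀ : Set (V ⊕ U → Rn n)} {X₁ : Set (V → Rn n)} (y : Ψ → (V → Rn n) → U → Rn n)
    (h : Definable X X₀) (hmem : ∀ φ ∈ X₁, ∀ f, Sum.elim φ (y f φ) ∈ X₀)
    (huniq : ∀ φ ∈ X₁, ∀ u, Sum.elim φ u ∈ X → ∃ f, u = y f φ)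
    (han : ∀ f a, AnalyticOnNhd ℝ (fun φ => y f φ a) X₁)
    (hinj : ∀ φ ∈ X₁, Function.Injective fun f => y f φ) :
    Definable {φ | ∃ u, Sum.elim φ u ∈ X} X₁ := by
  obtain ⟨W, iW, S, Φ, iΦ, nΦ, w, h1, h2, h3, h4⟩ := h
  have key : ∀ (φ : V → Rn n) (ψ : U ⊕ W → Rn n),
      (S.rename (Equiv.sumAssoc V U W)).Sat (Sum.elim φ ψ) ↔
        S.Sat (Sum.elim (Sum.elim φ (ψ ∘ Sum.inl)) (ψ ∘ Sum.inr)) := by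
    intro φ ψ
    rw [DistSystem.sat_rename]
    congr! 1
    ext ((a | a) | a) : 1 <;> rfl
  refine ⟨U ⊕ W, inferInstance, S.rename (Equiv.sumAssoc V U W), Ψ × Φ, inferInstance,
    inferInstance, fun f φ => Sum.elim (y f.1 φ) (w f.2 (Sum.elim φ (y f.1 φ))), ?_, ?_, ?_, ?_⟩
  · intro φ ψ h
    exact ⟨_, h1 _ _ ((key _ _).1 h)⟩
  · intro φ hφ ψ
    rw [key]
    constructor
    · intro h
      obtain ⟨f, hf⟩ := huniq φ hφ _ (h1 _ _ h)
      rw [hf] at h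
      obtain ⟨g, hg⟩ := (h2 _ (hmem φ hφ f) _).1 h
      refine ⟨(f, g), ?_⟩
      rw [← hf] at hg
      simp only [← hf, ← hg]
      rw [Sum.elim_comp_inl_inr]
    · rintro ⟨f, rfl⟩
      rw [Sum.elim_comp_inl, Sum.elim_comp_inr]
      exact (h2 _ (hmem φ hφ f.1) _).2 ⟨f.2, rfl⟩
  · rintro f (a | a) φ hφ
    · exact han f.1 a φ hφ
    · have hc : AnalyticAt ℝ (fun φ : V → Rn n => (Sum.elim φ (y f.1 φ) : V ⊕ U → Rn n)) φ := by
        refine AnalyticAt.pi ?_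
        rintro (v | u)
        · exact (ContinuousLinearMap.proj (R := ℝ) (φ := fun _ : V => Rn n) v).analyticAt φ
        · exact han f.1 u φ hφ
      exact AnalyticAt.fun_comp (g := fun χ => w f.2 χ a)
        (f := fun φ : V → Rn n => (Sum.elim φ (y f.1 φ) : V ⊕ U → Rn n))
        (h3 f.2 a _ (hmem φ hφ f.1)) hc
  · intro φ hφ f g hfg
    have e1 : f.1 = g.1 := hinj φ hφ (by
      funext a
      exact congrFun hfg (Sum.inl a))
    have e2 : f.2 = g.2 := h4 _ (hmem φ hφ f.1) (by
      funext a
      have := congrFun hfg (Sum.inr a)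
      simpa [e1] using this)
    exact Prod.ext e1 e2

lemma exists_fun {U : Type} [Fintype U]
    {X X₀ : Set (V ⊕ U → Rn n)} {X₁ : Set (V → Rn n)} (y : (V → Rn n) → U → Rn n)
    (h : Definable X X₀) (hmem : ∀ φ ∈ X₁, Sum.elim φ (y φ) ∈ X₀)
    (huniq : ∀ φ ∈ X₁, ∀ u, Sum.elim φ u ∈ X → u = y φ)
    (han : ∀ a, AnalyticOnNhd ℝ (fun φ => y φ a) X₁) :
    Definable {φ | ∃ u, Sum.elim φ u ∈ X} X₁ :=
  exists_fam (Ψ := Unit) (fun _ => y) h (fun φ hφ _ => hmem φ hφ)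
    (fun φ hφ u hu => ⟨(), huniq φ hφ u hu⟩) (fun _ => han) fun _ _ _ _ _ => rfl

lemma dist_eq (a b : V) {l : ℝ} (hl : 0 < l) :
    Definable {φ : V → Rn n | ‖φ a - φ b‖ = l} {φ | ‖φ a - φ b‖ = l} :=
  (of_sat (n := n) (V := V) ⟨Unit, inferInstance, fun _ => .inl a, fun _ => .inl b, fun _ => l,
    fun _ => hl⟩).mono (fun _ h => h ()) fun _ h _ => h

lemma distConst_eq (a : V) (c : Rn n) {l : ℝ} (hl : 0 < l) :
    Definable {φ : V → Rn n | ‖φ a - c‖ = l} {φ | ‖φ a - c‖ = l} :=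
  (of_sat (n := n) (V := V) ⟨Unit, inferInstance, fun _ => .inl a, fun _ => .inr c, fun _ => l,
    fun _ => hl⟩).mono (fun _ h => h ()) fun _ h _ => h

end Definable

/-! ### Intersecting a circle in a plane with a sphere. -/

lemma norm_eq_iff_inner {n : ℕ} (v : Rn n) {r : ℝ} (hr : 0 ≤ r) : ‖v‖ = r ↔ ⟪v, v⟫ = r ^ 2 := by
  rw [real_inner_self_eq_norm_sq]
  exact (sq_eq_sq₀ (norm_nonneg v) hr).symm

lemma inner_stdVec {n : ℕ} (v : Rn n) (i : Fin n) : ⟪v, stdVec i⟫ = v i := by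
  rw [EuclideanSpace.inner_single_right]; simp

/-- An orthonormal pair of vectors of `ℝⁿ`. -/
structure OrthoPair (n : ℕ) where
  e : Rn n
  f : Rn n
  e_unit : ⟪e, e⟫ = 1
  f_unit : ⟪f, f⟫ = 1
  orth : ⟪e, f⟫ = 0

namespace OrthoPair

variable {n : ℕ} (p : OrthoPair n)

lemma orth' : ⟪p.f, p.e⟫ = 0 := by rw [real_inner_comm, p.orth]

/-- The orthogonal projection to the plane spanned by the pair. -/
noncomputable def proj (v : Rn n) : Rn n := ⟪p.e, v⟫ • p.e + ⟪p.f, v⟫ • p.f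

/-- Membership in the plane spanned by the pair. -/
def InPlane (v : Rn n) : Prop := v = p.proj v

/-- The vector with given coordinates in the plane. -/
noncomputable def pt (a b : ℝ) : Rn n := a • p.e + b • p.f

lemma inner_e_pt (a b : ℝ) : ⟪p.e, p.pt a b⟫ = a := by
  rw [pt, inner_add_right, inner_smul_right, inner_smul_right, p.e_unit, p.orth]; ring

lemma inner_f_pt (a b : ℝ) : ⟪p.f, p.pt a b⟫ = b := by
  rw [pt, inner_add_right, inner_smul_right, inner_smul_right, p.f_unit, p.orth']; ring

lemma inPlane_pt (a b : ℝ) : p.InPlane (p.pt a b) := by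
  rw [InPlane, proj, inner_e_pt, inner_f_pt, pt]

lemma inPlane_iff (v : Rn n) : p.InPlane v ↔ v = p.pt ⟪p.e, v⟫ ⟪p.f, v⟫ := Iff.rfl

lemma inner_pt (a b : ℝ) (v : Rn n) : ⟪p.pt a b, v⟫ = a * ⟪p.e, v⟫ + b * ⟪p.f, v⟫ := by
  simp [pt, inner_add_left, inner_smul_left]

lemma inner_pt_pt (a b c d : ℝ) : ⟪p.pt a b, p.pt c d⟫ = a * c + b * d := by
  rw [inner_pt, inner_e_pt, inner_f_pt]

lemma pt_add (a b c d : ℝ) : p.pt a b + p.pt c d = p.pt (a + c) (b + d) := by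
  simp only [pt]; module

lemma pt_sub (a b c d : ℝ) : p.pt a b - p.pt c d = p.pt (a - c) (b - d) := by
  simp only [pt]; module

lemma inPlane_add {u v : Rn n} (hu : p.InPlane u) (hv : p.InPlane v) : p.InPlane (u + v) := by
  rw [inPlane_iff] at hu hv
  rw [hu, hv, pt_add]
  exact p.inPlane_pt _ _

lemma inPlane_sub {u v : Rn n} (hu : p.InPlane u) (hv : p.InPlane v) : p.InPlane (u - v) := by
  rw [inPlane_iff] at hu hv
  rw [hu, hv, pt_sub]
  exact p.inPlane_pt _ _

/-- One of the two points of the plane (according to the sign `s`) at distance `R` from `0` and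
`r` from `P`. -/
noncomputable def circ (s R r : ℝ) (P : Rn n) : Rn n :=
  p.pt (((R ^ 2 - r ^ 2 + ⟪P, P⟫) / 2 * ⟪p.e, P⟫ - s * √(R ^ 2 * (⟪p.e, P⟫ ^ 2 + ⟪p.f, P⟫ ^ 2) -
      ((R ^ 2 - r ^ 2 + ⟪P, P⟫) / 2) ^ 2) * ⟪p.f, P⟫) / (⟪p.e, P⟫ ^ 2 + ⟪p.f, P⟫ ^ 2))
    (((R ^ 2 - r ^ 2 + ⟪P, P⟫) / 2 * ⟪p.f, P⟫ + s * √(R ^ 2 * (⟪p.e, P⟫ ^ 2 + ⟪p.f, P⟫ ^ 2) -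
      ((R ^ 2 - r ^ 2 + ⟪P, P⟫) / 2) ^ 2) * ⟪p.e, P⟫) / (⟪p.e, P⟫ ^ 2 + ⟪p.f, P⟫ ^ 2))

/-- Transversality of the circle of radius `R` about `0` in the plane and the sphere of
radius `r` about `P`. -/
def Transverse (R r : ℝ) (P : Rn n) : Prop :=
  ((R ^ 2 - r ^ 2 + ⟪P, P⟫) / 2) ^ 2 < R ^ 2 * (⟪p.e, P⟫ ^ 2 + ⟪p.f, P⟫ ^ 2)

lemma Transverse.pos {p : OrthoPair n} {R r : ℝ} {P : Rn n} (h : p.Transverse R r P) :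
    0 < ⟪p.e, P⟫ ^ 2 + ⟪p.f, P⟫ ^ 2 := by
  unfold Transverse at h
  by_contra hN
  have : R ^ 2 * (⟪p.e, P⟫ ^ 2 + ⟪p.f, P⟫ ^ 2) ≤ 0 :=
    mul_nonpos_of_nonneg_of_nonpos (sq_nonneg R) (not_lt.1 hN)
  linarith [sq_nonneg ((R ^ 2 - r ^ 2 + ⟪P, P⟫) / 2)]

/-- In plane coordinates the conditions read `a² + b² = R²` and `a x + b y = c`. Lagrange's identity
then determines `b x - a y` up to sign, and the two signs are the two points. `P` need not lie in
the plane: only its projection `(x, y)` and its norm enter. -/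
lemma circ_iff {R r : ℝ} (hR : 0 < R) (hr : 0 < r) {P : Rn n} (h : p.Transverse R r P) (u : Rn n) :
    (p.InPlane u ∧ ‖u‖ = R ∧ ‖u - P‖ = r) ↔ ∃ b : Bool, u = p.circ (cond b 1 (-1)) R r P := by
  have hN := h.pos
  unfold Transverse at h
  set x := ⟪p.e, P⟫ with hx
  set y := ⟪p.f, P⟫ with hy
  set c := (R ^ 2 - r ^ 2 + ⟪P, P⟫) / 2 with hc
  set s := √(R ^ 2 * (x ^ 2 + y ^ 2) - c ^ 2) with hs
  have hs2 : s ^ 2 = R ^ 2 * (x ^ 2 + y ^ 2) - c ^ 2 := Real.sq_sqrt (by linarith)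
  have key : ∀ a b : ℝ, (‖p.pt a b‖ = R ∧ ‖p.pt a b - P‖ = r) ↔
      a ^ 2 + b ^ 2 = R ^ 2 ∧ a * x + b * y = c := by
    intro a b
    rw [norm_eq_iff_inner _ hR.le, norm_eq_iff_inner _ hr.le, inner_sub_left, inner_sub_right,
      inner_sub_right, real_inner_comm (p.pt a b) P, inner_pt_pt, inner_pt, ← hx, ← hy, hc]
    constructor
    · rintro ⟨h1, h2⟩
      constructor <;> linarith
    · rintro ⟨h1, h2⟩
      constructor <;> linarith
  constructor
  · rintro ⟨h1, h2⟩
    rw [inPlane_iff] at h1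
    rw [h1, key] at h2
    obtain ⟨h2, h3⟩ := h2
    set a := ⟪p.e, u⟫
    set b := ⟪p.f, u⟫
    have hd : (b * x - a * y) ^ 2 = s ^ 2 := by
      rw [hs2, ← h2, ← h3]; ring
    rcases sq_eq_sq_iff_eq_or_eq_neg.1 hd with hd | hd
    · refine ⟨true, ?_⟩
      rw [h1, circ, ← hx, ← hy, ← hc, ← hs, ← h3, ← hd]
      congr 1 <;> rw [eq_div_iff hN.ne'] <;> simp only [cond] <;> ring
    · refine ⟨false, ?_⟩
      have hd : s = -(b * x - a * y) := by linarith
      rw [h1, circ, ← hx, ← hy, ← hc, ← hs, ← h3, hd]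
      congr 1 <;> rw [eq_div_iff hN.ne'] <;> simp only [cond] <;> ring
  · rintro ⟨b, rfl⟩
    refine ⟨p.inPlane_pt _ _, (key _ _).2 ?_⟩
    rw [← hx, ← hy, ← hc, ← hs]
    have hb : (cond b 1 (-1) : ℝ) ^ 2 = 1 := by cases b <;> norm_num
    set t := (cond b 1 (-1) : ℝ)
    have e1 : (c * x - t * s * y) ^ 2 + (c * y + t * s * x) ^ 2 = R ^ 2 * (x ^ 2 + y ^ 2) ^ 2 := by
      have : (c * x - t * s * y) ^ 2 + (c * y + t * s * x) ^ 2 =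
        (c ^ 2 + t ^ 2 * s ^ 2) * (x ^ 2 + y ^ 2) := by ring
      rw [this, hb, hs2]; ring
    constructor
    · rw [div_pow, div_pow, ← add_div, e1]
      field_simp
    · field_simp
      ring

lemma circ_ne {R r : ℝ} {P : Rn n} (h : p.Transverse R r P) :
    Function.Injective fun b : Bool => p.circ (cond b 1 (-1)) R r P := by
  have hN := h.pos
  have hs : 0 < √(R ^ 2 * (⟪p.e, P⟫ ^ 2 + ⟪p.f, P⟫ ^ 2) - ((R ^ 2 - r ^ 2 + ⟪P, P⟫) / 2) ^ 2) :=
    Real.sqrt_pos.2 (sub_pos.2 h)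
  have key : p.circ 1 R r P ≠ p.circ (-1) R r P := by
    intro he
    have h1 := congrArg (fun v => ⟪p.e, v⟫) he
    have h2 := congrArg (fun v => ⟪p.f, v⟫) he
    simp only [circ, inner_e_pt, inner_f_pt] at h1 h2
    rw [div_left_inj' hN.ne'] at h1 h2
    have h3 : ⟪p.f, P⟫ = 0 := by
      have := mul_eq_zero.1 (show √(R ^ 2 * (⟪p.e, P⟫ ^ 2 + ⟪p.f, P⟫ ^ 2) -
        ((R ^ 2 - r ^ 2 + ⟪P, P⟫) / 2) ^ 2) * ⟪p.f, P⟫ = 0 by linarith)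
      exact this.resolve_left hs.ne'
    have h4 : ⟪p.e, P⟫ = 0 := by
      have := mul_eq_zero.1 (show √(R ^ 2 * (⟪p.e, P⟫ ^ 2 + ⟪p.f, P⟫ ^ 2) -
        ((R ^ 2 - r ^ 2 + ⟪P, P⟫) / 2) ^ 2) * ⟪p.e, P⟫ = 0 by linarith)
      exact this.resolve_left hs.ne'
    rw [h3, h4] at hN
    norm_num at hN
  rintro (_ | _) (_ | _) h
  · rfl
  · exact absurd h.symm key
  · exact absurd h key
  · rfl

end OrthoPair

lemma analyticAt_inner_const {n : ℕ} {E : Type*} [NormedAddCommGroup E] [NormedSpace ℝ E]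
    (e : Rn n) {g : E → Rn n} {x : E} (hg : AnalyticAt ℝ g x) :
    AnalyticAt ℝ (fun y => ⟪e, g y⟫) x :=
  ((innerSL ℝ e).analyticAt (g x)).fun_comp hg

lemma analyticAt_inner_self {n : ℕ} {E : Type*} [NormedAddCommGroup E] [NormedSpace ℝ E]
    {g : E → Rn n} {x : E} (hg : AnalyticAt ℝ g x) :
    AnalyticAt ℝ (fun y => ⟪g y, g y⟫) x := by
  have : (fun y => ⟪g y, g y⟫) = fun y => ∑ i, ⟪stdVec i, g y⟫ * ⟪stdVec i, g y⟫ := by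
    ext y
    rw [PiLp.inner_apply]
    refine Finset.sum_congr rfl fun i _ => ?_
    rw [real_inner_comm (g y), inner_stdVec]
    rfl
  rw [this]
  exact Finset.analyticAt_fun_sum _ fun i _ =>
    (analyticAt_inner_const _ hg).fun_mul (analyticAt_inner_const _ hg)

lemma analyticAt_sqrt {E : Type*} [NormedAddCommGroup E] [NormedSpace ℝ E]
    {g : E → ℝ} {x : E} (hg : AnalyticAt ℝ g x) (h : 0 < g x) :
    AnalyticAt ℝ (fun y => √(g y)) x :=
  ((Real.contDiffAt_sqrt (n := ⊤) h.ne').analyticAt).fun_comp hg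

namespace OrthoPair

variable {n : ℕ} (p : OrthoPair n)

/-- Transversality makes the radicand and the denominator in `circ` positive. -/
lemma analyticAt_circ {E : Type*} [NormedAddCommGroup E] [NormedSpace ℝ E] {g : E → Rn n} {x : E}
    (hg : AnalyticAt ℝ g x) (s : ℝ) {R r : ℝ} (h : p.Transverse R r (g x)) :
    AnalyticAt ℝ (fun y => p.circ s R r (g y)) x := by
  have h1 := analyticAt_inner_const p.e hg
  have h2 := analyticAt_inner_const p.f hg
  have h3 : AnalyticAt ℝ (fun y => (R ^ 2 - r ^ 2 + ⟪g y, g y⟫) / 2) x :=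
    (analyticAt_const.fun_add (analyticAt_inner_self hg)).fun_div analyticAt_const two_ne_zero
  have h4 : AnalyticAt ℝ (fun y => ⟪p.e, g y⟫ ^ 2 + ⟪p.f, g y⟫ ^ 2) x :=
    (h1.fun_pow 2).fun_add (h2.fun_pow 2)
  have h5 : AnalyticAt ℝ (fun y => √(R ^ 2 * (⟪p.e, g y⟫ ^ 2 + ⟪p.f, g y⟫ ^ 2) -
      ((R ^ 2 - r ^ 2 + ⟪g y, g y⟫) / 2) ^ 2)) x :=
    analyticAt_sqrt ((analyticAt_const.fun_mul h4).fun_sub (h3.fun_pow 2)) (sub_pos.2 h)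
  have h6 := h.pos.ne'
  unfold circ pt
  refine AnalyticAt.fun_add (AnalyticAt.fun_smul ?_ analyticAt_const)
    (AnalyticAt.fun_smul ?_ analyticAt_const)
  · exact ((h3.fun_mul h1).fun_sub ((analyticAt_const.fun_mul h5).fun_mul h2)).fun_div h4 h6
  · exact ((h3.fun_mul h2).fun_add ((analyticAt_const.fun_mul h5).fun_mul h1)).fun_div h4 h6

end OrthoPair

/-! ### Rods in a plane, constant points and parallelograms. -/

namespace Definable

variable {n : ℕ} {V : Type} [Fintype V]

/-- On the sphere of radius `r`, orthogonality to `w` is a distance condition, `‖v - w‖² = r² +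
‖w‖²`. It is imposed for vectors `w i` spanning the orthogonal complement of the plane. -/
lemma planarRod (p : OrthoPair n) (u : V) (O : Rn n) {r : ℝ} (hr : 0 < r) :
    Definable {φ : V → Rn n | p.InPlane (φ u - O) ∧ ‖φ u - O‖ = r}
      {φ : V → Rn n | p.InPlane (φ u - O) ∧ ‖φ u - O‖ = r} := by
  let w : Fin n → Rn n := fun i => stdVec i - p.proj (stdVec i)
  -- The projection is self-adjoint, so pairing with `w i` reads off the `i`-th coordinate of the
  -- component of `v` orthogonal to the plane.
  have hw : ∀ i (v : Rn n), ⟪v, w i⟫ = (v - p.proj v) i := by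
    intro i v
    have : (v - p.proj v) i = ⟪v - p.proj v, stdVec i⟫ := (inner_stdVec _ _).symm
    rw [this]
    simp only [w, OrthoPair.proj, inner_sub_left, inner_sub_right, inner_add_left, inner_add_right,
      inner_smul_left, inner_smul_right, real_inner_comm v p.e, real_inner_comm v p.f]
    simp
    ring
  have key : ∀ v : Rn n, ‖v‖ = r → (p.InPlane v ↔ ∀ i, ‖v - w i‖ = √(r ^ 2 + ‖w i‖ ^ 2)) := by
    intro v hv
    have : ∀ i, ‖v - w i‖ = √(r ^ 2 + ‖w i‖ ^ 2) ↔ (v - p.proj v) i = 0 := by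
      intro i
      rw [← hw i v, eq_comm, Real.sqrt_eq_iff_mul_self_eq (by positivity) (norm_nonneg _),
        ← sq, norm_sub_sq_real v, hv]
      constructor <;> intro h <;> linarith
    simp only [this]
    rw [OrthoPair.InPlane, ← sub_eq_zero]
    exact ⟨fun h i => by rw [h]; rfl, fun h => by ext i; exact h i⟩
  have h := (distConst_eq (n := n) u O hr).and
    (all fun i : Fin n => distConst_eq (n := n) u (O + w i)
      (Real.sqrt_pos.2 (show 0 < r ^ 2 + ‖w i‖ ^ 2 by positivity)))
  refine h.mono ?_ ?_
  · rintro φ ⟨h1, h2⟩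
    exact ⟨(key _ h1).2 fun i => by rw [sub_sub]; exact h2 i, h1⟩
  · rintro φ ⟨h1, h2⟩
    refine ⟨h2, fun i => ?_⟩
    have := (key _ h2).1 h1 i
    rwa [sub_sub] at this

/-- Lengths are positive, so a vertex cannot be joined to `c` itself. Equal distances to `c + e_i`
and `c - e_i` put it on the hyperplane through `c` orthogonal to `e_i`, and these hyperplanes meet
in `c`. -/
lemma eq_const (u : V) (c : Rn n) :
    Definable {φ : V → Rn n | φ u = c} {φ | φ u = c} := by
  have h := (all fun i : Fin n => (distConst_eq (n := n) u (c + stdVec i) one_pos).and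
    (distConst_eq (n := n) u (c - stdVec i) one_pos))
  refine h.mono ?_ ?_
  · intro φ h
    change φ u = c
    rw [← sub_eq_zero]
    ext i
    obtain ⟨h1, h2⟩ := h i
    have h1 : ‖(φ u - c) - stdVec i‖ = 1 := by rw [sub_sub]; exact h1
    have h2 : ‖(φ u - c) + stdVec i‖ = 1 := by
      rw [← h2]; congr 1; abel
    have h3 : ⟪φ u - c, stdVec i⟫ = 0 := by
      have e1 := norm_sub_sq_real (φ u - c) (stdVec i)
      have e2 := norm_add_sq_real (φ u - c) (stdVec i)
      rw [h1] at e1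
      rw [h2] at e2
      linarith
    rwa [inner_stdVec] at h3
  · intro φ h i
    change φ u = c at h
    constructor
    · change ‖φ u - (c + stdVec i)‖ = 1
      rw [h]; simp [stdVec]
    · change ‖φ u - (c - stdVec i)‖ = 1
      rw [h]; simp [stdVec]

end Definable

/-- Two equal edges, joined at both ends and at their midpoints by segments of equal length,
are parallel. -/
lemma braced_parallelogram {n : ℕ} {a b c d m m' : Rn n} {β γ : ℝ}
    (h1 : ‖b - a‖ = β) (h2 : ‖m - a‖ = β / 2) (h3 : ‖m - b‖ = β / 2)
    (h4 : ‖d - c‖ = β) (h5 : ‖m' - c‖ = β / 2) (h6 : ‖m' - d‖ = β / 2)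
    (h7 : ‖c - a‖ = γ) (h8 : ‖d - b‖ = γ) (h9 : ‖m' - m‖ = γ) :
    m = (1 / 2 : ℝ) • (a + b) ∧ m' = (1 / 2 : ℝ) • (c + d) ∧ d = b + c - a := by
  -- The parallelogram law turns the equality case of the triangle inequality into the vanishing of
  -- a vector. The same device, applied below to `c - a` and `d - b`, whose sum has norm `2 * γ`,
  -- excludes the antiparallelogram.
  have mid : ∀ {x y z : Rn n}, ‖y - x‖ = β → ‖z - x‖ = β / 2 → ‖z - y‖ = β / 2 →
      z = (1 / 2 : ℝ) • (x + y) := by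
    intro x y z hy hz hzy
    have e1 := parallelogram_law_with_norm ℝ (z - x) (z - y)
    have e2 : z - x - (z - y) = y - x := by abel
    rw [e2, hz, hzy, hy] at e1
    have e3 : ‖z - x + (z - y)‖ = 0 := by nlinarith [norm_nonneg (z - x + (z - y))]
    have e4 := norm_eq_zero.1 e3
    have : z = (1 / 2 : ℝ) • (z - x + (z - y)) + (1 / 2 : ℝ) • (x + y) := by module
    rw [e4] at this
    simpa using this
  have hm := mid h1 h2 h3
  have hm' := mid h4 h5 h6
  refine ⟨hm, hm', ?_⟩
  have e0 : m' - m = (1 / 2 : ℝ) • ((c - a) + (d - b)) := by rw [hm, hm']; module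
  have e1 := parallelogram_law_with_norm ℝ (c - a) (d - b)
  rw [e0, norm_smul] at h9
  have e2 : ‖(c - a) + (d - b)‖ = 2 * γ := by
    norm_num at h9; linarith
  rw [e2, h7, h8] at e1
  have e3 : ‖c - a - (d - b)‖ = 0 := by nlinarith [norm_nonneg (c - a - (d - b))]
  have e4 := norm_eq_zero.1 e3
  have : d = b + c - a - (c - a - (d - b)) := by abel
  rw [e4] at this
  simpa using this

namespace Definable

variable {n : ℕ} {V : Type} [Fintype V]

/-- A bare four-bar linkage also has antiparallelogram positions; the bar joining the midpoints of
two opposite sides removes them. The auxiliary vertices are these midpoints, so there is one sheet.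
-/
lemma parallelogram (a b c d : V) {β γ : ℝ} (hβ : 0 < β) (hγ : 0 < γ) :
    Definable {φ : V → Rn n | φ d = φ b + φ c - φ a}
      {φ | ‖φ b - φ a‖ = β ∧ ‖φ c - φ a‖ = γ ∧ φ d = φ b + φ c - φ a} := by
  have hβ2 : 0 < β / 2 := by positivity
  let A : V ⊕ Fin 2 := .inl a
  let B : V ⊕ Fin 2 := .inl b
  let C : V ⊕ Fin 2 := .inl c
  let D : V ⊕ Fin 2 := .inl d
  let M : V ⊕ Fin 2 := .inr 0
  let M' : V ⊕ Fin 2 := .inr 1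
  have h := exists_fun (n := n) (fun φ => ![(1 / 2 : ℝ) • (φ a + φ b), (1 / 2 : ℝ) • (φ c + φ d)])
    (X₁ := {φ | ‖φ b - φ a‖ = β ∧ ‖φ c - φ a‖ = γ ∧ φ d = φ b + φ c - φ a})
    ((dist_eq (n := n) B A hβ).and <| (dist_eq M A hβ2).and <| (dist_eq M B hβ2).and <|
      (dist_eq D C hβ).and <| (dist_eq M' C hβ2).and <| (dist_eq M' D hβ2).and <|
      (dist_eq C A hγ).and <| (dist_eq D B hγ).and <| dist_eq M' M hγ) ?_ ?_ ?_
  · refine h.mono ?_ subset_rfl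
    rintro φ ⟨u, h1, h2, h3, h4, h5, h6, h7, h8, h9⟩
    exact (braced_parallelogram h1 h2 h3 h4 h5 h6 h7 h8 h9).2.2
  · rintro φ ⟨h1, h2, h3⟩
    have half : ∀ v : Rn n, ∀ t, ‖v‖ = t → ‖(1 / 2 : ℝ) • v‖ = t / 2 := by
      intro v t h
      rw [norm_smul, h]; norm_num; ring
    refine ⟨h1, ?_, ?_, ?_, ?_, ?_, h2, ?_, ?_⟩
    · change ‖(1 / 2 : ℝ) • (φ a + φ b) - φ a‖ = β / 2
      rw [← half _ _ h1]; congr 1; module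
    · change ‖(1 / 2 : ℝ) • (φ a + φ b) - φ b‖ = β / 2
      rw [← half _ _ h1, ← norm_neg]; congr 1; module
    · change ‖φ d - φ c‖ = β
      rw [← h1, h3]; congr 1; abel
    · change ‖(1 / 2 : ℝ) • (φ c + φ d) - φ c‖ = β / 2
      rw [← half _ _ h1, h3]; congr 1; module
    · change ‖(1 / 2 : ℝ) • (φ c + φ d) - φ d‖ = β / 2
      rw [← half _ _ h1, ← norm_neg, h3]; congr 1; module
    · change ‖φ d - φ b‖ = γ
      rw [← h2, h3]; congr 1; abel
    · change ‖(1 / 2 : ℝ) • (φ c + φ d) - (1 / 2 : ℝ) • (φ a + φ b)‖ = γ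
      rw [← h2, h3]; congr 1; module
  · rintro φ - u ⟨h1, h2, h3, h4, h5, h6, h7, h8, h9⟩
    obtain ⟨e1, e2, -⟩ := braced_parallelogram h1 h2 h3 h4 h5 h6 h7 h8 h9
    funext i
    fin_cases i
    · exact e1
    · exact e2
  · intro i φ _
    have pr : ∀ v, AnalyticAt ℝ (fun φ : V → Rn n => φ v) φ := fun v =>
      (ContinuousLinearMap.proj (R := ℝ) (φ := fun _ : V => Rn n) v).analyticAt φ
    fin_cases i
    · exact analyticAt_const.fun_smul ((pr a).fun_add (pr b))
    · exact analyticAt_const.fun_smul ((pr c).fun_add (pr d))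

end Definable

lemma analyticAt_eval {n : ℕ} {V : Type} [Fintype V] (v : V) (φ : V → Rn n) :
    AnalyticAt ℝ (fun φ : V → Rn n => φ v) φ :=
  (ContinuousLinearMap.proj (R := ℝ) (φ := fun _ : V => Rn n) v).analyticAt φ

/-! ### Vector addition by rhombi. -/

namespace OrthoPair

variable {n : ℕ} (p : OrthoPair n)

lemma circ_iff_sub {R r : ℝ} (hR : 0 < R) (hr : 0 < r) {O P : Rn n}
    (h : p.Transverse R r (P - O)) (u : Rn n) :
    ((p.InPlane (u - O) ∧ ‖u - O‖ = R) ∧ ‖P - u‖ = r) ↔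
      ∃ b : Bool, u = O + p.circ (cond b 1 (-1)) R r (P - O) := by
  have := p.circ_iff hR hr h (u - O)
  rw [sub_sub_sub_cancel_right, norm_sub_rev u P] at this
  rw [and_assoc, this]
  simp only [sub_eq_iff_eq_add']

/-- The square roots occur with opposite signs and cancel in the sum. This is the inversion
performed by Peaucellier's cell. -/
lemma circ_add_circ (R r : ℝ) (P : Rn n) (hP : p.InPlane P) (h : p.Transverse R r P) :
    p.circ 1 R r P + p.circ (-1) R r P - P = ((R ^ 2 - r ^ 2) / ‖P‖ ^ 2) • P := by
  have hN := h.pos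
  rw [inPlane_iff] at hP
  have e1 : ⟪P, P⟫ = ⟪p.e, P⟫ ^ 2 + ⟪p.f, P⟫ ^ 2 := by
    conv_lhs => rw [hP, inner_pt_pt]
    ring
  rw [← real_inner_self_eq_norm_sq, circ, circ, pt_add, e1]
  set x := ⟪p.e, P⟫
  set y := ⟪p.f, P⟫
  have e2 : ∀ t : ℝ, t • p.pt x y = p.pt (t * x) (t * y) := fun t => by simp only [pt]; module
  rw [hP, pt_sub, e2]
  congr 1 <;> field_simp <;> ring

/-- As in Heron's formula, four times the discriminant factors as `(N² - (R - r)²) ((R + r)² - N²)`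
with `N = ‖P‖`. -/
lemma transverse_of_inPlane {R r : ℝ} (hr : 0 < r) (hR : r < R) {P : Rn n} (hP : p.InPlane P)
    (h1 : R - r < ‖P‖) (h2 : ‖P‖ < R + r) : p.Transverse R r P := by
  have e1 : ⟪P, P⟫ = ⟪p.e, P⟫ ^ 2 + ⟪p.f, P⟫ ^ 2 := by
    rw [inPlane_iff] at hP
    conv_lhs => rw [hP, inner_pt_pt]
    ring
  rw [Transverse, ← e1, real_inner_self_eq_norm_sq]
  set N := ‖P‖
  have a1 : 0 < N ^ 2 - (R - r) ^ 2 := by nlinarith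
  have a2 : 0 < (R + r) ^ 2 - N ^ 2 := by nlinarith
  nlinarith [mul_pos a1 a2]

/-- For equal radii, `‖P‖⁴ / 4`, which is below `64 D⁴`, is compared with `(20 D)²` times the
squared length of the projection, which is above `100 D⁴`. -/
lemma transverse_of_far {D : ℝ} (hD : 0 < D) {P : Rn n} (h1 : D / 2 < |⟪p.e, P⟫|)
    (h2 : ‖P‖ < 4 * D) : p.Transverse (20 * D) (20 * D) P := by
  rw [Transverse, real_inner_self_eq_norm_sq]
  have a1 : (D / 2) ^ 2 < ⟪p.e, P⟫ ^ 2 := by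
    rw [← sq_abs ⟪p.e, P⟫]
    exact pow_lt_pow_left₀ h1 (by positivity) two_ne_zero
  have a2 : ‖P‖ ^ 2 < (4 * D) ^ 2 := pow_lt_pow_left₀ h2 (norm_nonneg _) two_ne_zero
  have a3 : (‖P‖ ^ 2) ^ 2 < ((4 * D) ^ 2) ^ 2 := pow_lt_pow_left₀ a2 (sq_nonneg _) two_ne_zero
  nlinarith [mul_lt_mul_of_pos_left a1 (show 0 < (20 * D) ^ 2 by positivity),
    mul_nonneg (sq_nonneg (20 * D)) (sq_nonneg ⟪p.f, P⟫), pow_pos hD 4]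

end OrthoPair

namespace Definable

variable {n : ℕ} {V : Type} [Fintype V]

/-- Parallelograms need sides of constant length, so the vectors from `O` to `a` and `b` are broken
at the elbows `ua` and `ub` into rods of length `r`. Four rhombi of side `r` then lead to `φ a + φ b
- O`. -/
lemma add_rods (a b c ua ub : V) (O : Rn n) {r : ℝ} (hr : 0 < r) :
    Definable {φ : V → Rn n | φ c = φ a + φ b - O}
      {φ | ‖φ ua - O‖ = r ∧ ‖φ ub - O‖ = r ∧ ‖φ a - φ ua‖ = r ∧ ‖φ b - φ ub‖ = r ∧
        φ c = φ a + φ b - O} := by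
  have h := exists_fun (n := n) (V := V) (U := Fin 4)
    (X₁ := {φ | ‖φ ua - O‖ = r ∧ ‖φ ub - O‖ = r ∧ ‖φ a - φ ua‖ = r ∧ ‖φ b - φ ub‖ = r ∧
        φ c = φ a + φ b - O})
    (fun φ => ![O, φ ua + φ ub - O, φ a + φ ub - O, φ b + φ ua - O])
    ((eq_const (.inr 0) O).and <|
      (parallelogram (.inr 0) (.inl ua) (.inl ub) (.inr 1) hr hr).and <|
      (parallelogram (.inl ua) (.inl a) (.inr 1) (.inr 2) hr hr).and <|
      (parallelogram (.inl ub) (.inl b) (.inr 1) (.inr 3) hr hr).and <|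
      (parallelogram (.inr 1) (.inr 2) (.inr 3) (.inl c) hr hr)) ?_ ?_ ?_
  · refine h.mono ?_ subset_rfl
    rintro φ ⟨u, h1, h2, h3, h4, h5⟩
    simp only [Set.mem_ofPred_eq, Sum.elim_inl, Sum.elim_inr] at h1 h2 h3 h4 h5 ⊢
    rw [h5, h4, h3, h2, h1]; abel
  · rintro φ ⟨h1, h2, h3, h4, h5⟩
    refine ⟨rfl, ⟨h1, h2, rfl⟩, ⟨h3, ?_, ?_⟩, ⟨h4, ?_, ?_⟩, ?_, ?_, ?_⟩
    · rw [← h2]; simp only [Sum.elim_inl, Sum.elim_inr, Matrix.cons_val]; congr 1; abel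
    · simp only [Sum.elim_inl, Sum.elim_inr, Matrix.cons_val]; abel
    · rw [← h1]; simp only [Sum.elim_inl, Sum.elim_inr, Matrix.cons_val]; congr 1; abel
    · simp only [Sum.elim_inl, Sum.elim_inr, Matrix.cons_val]; abel
    · rw [← h3]; simp only [Sum.elim_inr, Matrix.cons_val]; congr 1; abel
    · rw [← h4]; simp only [Sum.elim_inr, Matrix.cons_val]; congr 1; abel
    · simp only [Sum.elim_inl, Sum.elim_inr, Matrix.cons_val, h5]; abel
  · rintro φ - u ⟨h1, h2, h3, h4, h5⟩
    simp only [Set.mem_ofPred_eq, Sum.elim_inl, Sum.elim_inr] at h1 h2 h3 h4 h5 ⊢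
    funext i
    fin_cases i
    · exact h1
    · simp [h2, h1]
    · change u 2 = φ a + φ ub - O
      rw [h3, h2, h1]; abel
    · change u 3 = φ b + φ ua - O
      rw [h4, h2, h1]; abel
  · intro i φ _
    have pr := fun v => analyticAt_eval v φ
    fin_cases i
    · exact analyticAt_const
    · exact ((pr _).fun_add (pr _)).fun_sub analyticAt_const
    · exact ((pr _).fun_add (pr _)).fun_sub analyticAt_const
    · exact ((pr _).fun_add (pr _)).fun_sub analyticAt_const

/-- Each of the two elbows has the two positions given by `circ`; this accounts for `Bool × Bool`.
-/
lemma add_sub_const (p : OrthoPair n) (a b c : V) (O : Rn n) {r : ℝ} (hr : 0 < r) :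
    Definable {φ : V → Rn n | φ c = φ a + φ b - O}
      {φ | p.Transverse r r (φ a - O) ∧ p.Transverse r r (φ b - O) ∧ φ c = φ a + φ b - O} := by
  have h := exists_fam (n := n) (V := V) (U := Fin 2) (Ψ := Bool × Bool)
    (X₁ := {φ | p.Transverse r r (φ a - O) ∧ p.Transverse r r (φ b - O) ∧ φ c = φ a + φ b - O})
    (fun s φ => ![O + p.circ (cond s.1 1 (-1)) r r (φ a - O),
      O + p.circ (cond s.2 1 (-1)) r r (φ b - O)])
    (((planarRod p (.inr 0) O hr).and (dist_eq (.inl a) (.inr 0) hr)).and <|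
      ((planarRod p (.inr 1) O hr).and (dist_eq (.inl b) (.inr 1) hr)).and <|
      add_rods (.inl a) (.inl b) (.inl c) (.inr 0) (.inr 1) O hr) ?_ ?_ ?_ ?_
  · refine h.mono ?_ subset_rfl
    rintro φ ⟨u, -, -, h3⟩
    exact h3
  · rintro φ ⟨h1, h2, h3⟩ s
    have k1 := (p.circ_iff_sub hr hr h1 _).2 ⟨s.1, rfl⟩
    have k2 := (p.circ_iff_sub hr hr h2 _).2 ⟨s.2, rfl⟩
    exact ⟨k1, k2, k1.1.2, k2.1.2, k1.2, k2.2, h3⟩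
  · rintro φ ⟨h1, h2, -⟩ u ⟨k1, k2, -⟩
    obtain ⟨s, hs⟩ := (p.circ_iff_sub hr hr h1 _).1 k1
    obtain ⟨t, ht⟩ := (p.circ_iff_sub hr hr h2 _).1 k2
    refine ⟨(s, t), funext fun i => ?_⟩
    fin_cases i
    · exact hs
    · exact ht
  · rintro s i φ ⟨h1, h2, -⟩
    have pr := fun v => analyticAt_eval v φ
    fin_cases i
    · exact analyticAt_const.fun_add (p.analyticAt_circ ((pr a).fun_sub analyticAt_const) _ h1)
    · exact analyticAt_const.fun_add (p.analyticAt_circ ((pr b).fun_sub analyticAt_const) _ h2)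
  · rintro φ ⟨h1, h2, -⟩ s t hst
    refine Prod.ext (p.circ_ne h1 ?_) (p.circ_ne h2 ?_)
    · exact add_left_cancel (congrFun hst 0)
    · exact add_left_cancel (congrFun hst 1)

/-- The elbows of `add_sub_const` degenerate when a summand is at the base point `O`. So `O` is
placed far away, and a second addition corrects the offset: `(a + b - O) + 2 O - O = a + b`. -/
lemma add_eq (p : OrthoPair n) (a b c : V) {R : ℝ} (hR : 0 < R) :
    Definable {φ : V → Rn n | φ c = φ a + φ b}
      {φ | ‖φ a‖ < R ∧ ‖φ b‖ < R ∧ φ c = φ a + φ b} := by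
  set D := 4 * R with hD
  have hD0 : 0 < D := by positivity
  set O : Rn n := (-D) • p.e with hO
  have hr : 0 < 20 * D := by positivity
  have he : ‖p.e‖ = 1 := (norm_eq_iff_inner _ zero_le_one).2 (by rw [p.e_unit]; norm_num)
  -- Seen from `O`, the summands are bounded vectors shifted by `k * D` along `p.e`: `k = 1` for `a`
  -- and `b`, `k = 2` for `a + b - O`, and `k = -1` for `2 O`.
  have far : ∀ (v : Rn n) (k : ℝ), ‖v‖ < 2 * R → |k| ≤ 2 → 1 ≤ |k| →
      p.Transverse (20 * D) (20 * D) (v + (k * D) • p.e) := by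
    intro v k hv h2 h1
    refine p.transverse_of_far hD0 ?_ ?_
    · rw [inner_add_right, inner_smul_right, p.e_unit, mul_one]
      have e1 : |⟪p.e, v⟫| ≤ ‖v‖ := by
        simpa [he] using abs_real_inner_le_norm p.e v
      have e2 : D ≤ |k * D| := by
        rw [abs_mul, abs_of_pos hD0]; nlinarith
      have e3 := abs_sub_abs_le_abs_sub (k * D) (-⟪p.e, v⟫)
      rw [abs_neg, sub_neg_eq_add, add_comm (k * D)] at e3
      linarith
    · have e1 := norm_add_le v ((k * D) • p.e)
      rw [norm_smul, he, Real.norm_eq_abs, abs_mul, abs_of_pos hD0, mul_one] at e1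
      nlinarith
  have h := exists_fun (n := n) (V := V) (U := Fin 2)
    (X₁ := {φ | ‖φ a‖ < R ∧ ‖φ b‖ < R ∧ φ c = φ a + φ b})
    (fun φ => ![φ a + φ b - O, (2 : ℝ) • O])
    ((add_sub_const p (.inl a) (.inl b) (.inr 0) O hr).and <|
      (eq_const (.inr 1) ((2 : ℝ) • O)).and <|
      add_sub_const p (.inr 0) (.inr 1) (.inl c) O hr) ?_ ?_ ?_
  · refine h.mono ?_ subset_rfl
    rintro φ ⟨u, h1, h2, h3⟩
    simp only [Set.mem_ofPred_eq, Sum.elim_inl, Sum.elim_inr] at h1 h2 h3 ⊢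
    rw [h3, h1, h2]; module
  · rintro φ ⟨h1, h2, h3⟩
    refine ⟨⟨?_, ?_, rfl⟩, rfl, ?_, ?_, ?_⟩
    · have := far (φ a) 1 (by linarith) (by norm_num) (by norm_num)
      rwa [show φ a + (1 * D) • p.e = φ a - O by rw [hO]; module] at this
    · have := far (φ b) 1 (by linarith) (by norm_num) (by norm_num)
      rwa [show φ b + (1 * D) • p.e = φ b - O by rw [hO]; module] at this
    · have := far (φ a + φ b) 2 (by linarith [norm_add_le (φ a) (φ b)]) (by norm_num) (by norm_num)
      rwa [show φ a + φ b + (2 * D) • p.e = φ a + φ b - O - O by rw [hO]; module] at this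
    · have := far 0 (-1) (by rw [norm_zero]; linarith) (by norm_num) (by norm_num)
      rwa [show (0 : Rn n) + (-1 * D) • p.e = (2 : ℝ) • O - O by rw [hO]; module] at this
    · simp only [Sum.elim_inl, Sum.elim_inr, Matrix.cons_val, h3]; module
  · rintro φ - u ⟨h1, h2, -⟩
    funext i
    fin_cases i
    · exact h1
    · exact h2
  · intro i φ _
    have pr := fun v => analyticAt_eval v φ
    fin_cases i
    · exact ((pr _).fun_add (pr _)).fun_sub analyticAt_const
    · exact analyticAt_const

end Definable

/-! ### Peaucellier's cell: straight lines and inversion. -/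

/-- The product of the distances from the pole in Peaucellier's linkage. -/
lemma peaucellier_inner {n : ℕ} {A B P : Rn n} {R r : ℝ} (hA : ‖A‖ = R) (hPA : ‖P - A‖ = r)
    (hB : ‖B‖ = R) (hPB : ‖P - B‖ = r) : ⟪P, A + B - P⟫ = R ^ 2 - r ^ 2 := by
  have e1 := norm_sub_sq_real P A
  have e2 := norm_sub_sq_real P B
  rw [hPA, hA] at e1
  rw [hPB, hB] at e2
  rw [inner_sub_right, inner_add_right, real_inner_self_eq_norm_sq]
  linarith

namespace OrthoPair

variable {n : ℕ} (p : OrthoPair n)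

/-- Collinearity in Peaucellier's linkage, away from its degenerate position. -/
lemma peaucellier_collinear {A B P : Rn n} {R r : ℝ} (pA : p.InPlane A) (pB : p.InPlane B)
    (pP : p.InPlane P) (hA : ‖A‖ = R) (hPA : ‖P - A‖ = r)
    (hB : ‖B‖ = R) (hPB : ‖P - B‖ = r)
    (hs : ‖P‖ ^ 2 + ‖A + B - P‖ ^ 2 < 2 * (R ^ 2 + r ^ 2)) :
    ⟪p.e, P⟫ * ⟪p.f, A + B - P⟫ = ⟪p.f, P⟫ * ⟪p.e, A + B - P⟫ := by
  have e1 := norm_sub_sq_real P A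
  have e2 := norm_sub_sq_real P B
  rw [hPA, hA] at e1
  rw [hPB, hB] at e2
  rw [← real_inner_self_eq_norm_sq] at e1 e2
  rw [← real_inner_self_eq_norm_sq, ← real_inner_self_eq_norm_sq] at hs
  have hA2 : ⟪A, A⟫ = R ^ 2 := by rw [real_inner_self_eq_norm_sq, hA]
  have hB2 : ⟪B, B⟫ = R ^ 2 := by rw [real_inner_self_eq_norm_sq, hB]
  rw [inPlane_iff] at pA pB pP
  set a := ⟪p.e, A⟫
  set a' := ⟪p.f, A⟫
  set b := ⟪p.e, B⟫
  set b' := ⟪p.f, B⟫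
  set x := ⟪p.e, P⟫
  set y := ⟪p.f, P⟫
  rw [pA, pB, pP] at hs
  rw [pA, pB, pP, pt_add, pt_sub, inner_e_pt, inner_f_pt]
  rw [pA] at e1 hA2
  rw [pB] at e2 hB2
  rw [pP] at e1 e2
  simp only [pt_add, pt_sub, inner_pt_pt] at *
  have hd : (x * a' - y * a) ^ 2 = (x * b' - y * b) ^ 2 := by
    have l1 : (x * a' - y * a) ^ 2 = (x * x + y * y) * (a * a + a' * a') - (x * a + y * a') ^ 2 := by
      ring
    have l2 : (x * b' - y * b) ^ 2 = (x * x + y * y) * (b * b + b' * b') - (x * b + y * b') ^ 2 := by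
      ring
    rw [l1, l2, hA2, hB2, show x * a + y * a' = x * b + y * b' by linarith]
  -- If the signed areas agree and `P ≠ 0`, then `A = B`, and the parallelogram law makes the left
  -- side of `hs` equal to `2 * (R ^ 2 + r ^ 2)`, a contradiction. If they are opposite, their sum
  -- is the claim.
  rcases sq_eq_sq_iff_eq_or_eq_neg.1 hd with hd | hd
  · by_cases hN : x * x + y * y = 0
    · have hx : x = 0 := by nlinarith
      have hy : y = 0 := by nlinarith
      rw [hx, hy]; ring
    · exfalso
      have hab : a = b := by
        have : (x * x + y * y) * (a - b) = 0 := by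
          have : (x * x + y * y) * (a - b) = x * (x * a + y * a' - (x * b + y * b')) -
            y * (x * a' - y * a - (x * b' - y * b)) := by ring
          rw [this, hd, show x * a + y * a' = x * b + y * b' by linarith]; ring
        linarith [(mul_eq_zero.1 this).resolve_left hN]
      have hab' : a' = b' := by
        have : (x * x + y * y) * (a' - b') = 0 := by
          have : (x * x + y * y) * (a' - b') = y * (x * a + y * a' - (x * b + y * b')) +
            x * (x * a' - y * a - (x * b' - y * b)) := by ring
          rw [this, hd, show x * a + y * a' = x * b + y * b' by linarith]; ring
        linarith [(mul_eq_zero.1 this).resolve_left hN]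
      rw [← hab, ← hab'] at hs
      nlinarith
  · linarith

end OrthoPair

namespace Definable

variable {n : ℕ} {V : Type} [Fintype V]

/-- In stray solutions the elbows `A` and `B` may coincide, so the guaranteed set only records what
the bars impose, and each application draws its own conclusion. Over the good annulus the Boolean
decides which intersection point is `A`. -/
lemma peaucellier (p : OrthoPair n) (P Q : V) (O : Rn n) {R r : ℝ} (hr : 0 < r) (hR : r < R) :
    Definable {φ : V → Rn n | ∃ A B : Rn n, p.InPlane A ∧ ‖A‖ = R ∧ ‖φ P - O - A‖ = r ∧
        p.InPlane B ∧ ‖B‖ = R ∧ ‖φ P - O - B‖ = r ∧ φ Q - O = A + B - (φ P - O)}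
      {φ | p.InPlane (φ P - O) ∧ R - r < ‖φ P - O‖ ∧ ‖φ P - O‖ < R + r ∧
        φ Q - O = ((R ^ 2 - r ^ 2) / ‖φ P - O‖ ^ 2) • (φ P - O)} := by
  have hR0 := hr.trans hR
  have h := exists_fam (n := n) (V := V) (U := Fin 2) (Ψ := Bool)
    (X₁ := {φ | p.InPlane (φ P - O) ∧ R - r < ‖φ P - O‖ ∧ ‖φ P - O‖ < R + r ∧
        φ Q - O = ((R ^ 2 - r ^ 2) / ‖φ P - O‖ ^ 2) • (φ P - O)})
    (fun s φ => ![O + p.circ (cond s 1 (-1)) R r (φ P - O),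
      O + p.circ (cond (!s) 1 (-1)) R r (φ P - O)])
    (((planarRod p (.inr 0) O hR0).and (dist_eq (.inl P) (.inr 0) hr)).and <|
      ((planarRod p (.inr 1) O hR0).and (dist_eq (.inl P) (.inr 1) hr)).and <|
      parallelogram (.inl P) (.inr 0) (.inr 1) (.inl Q) hr hr) ?_ ?_ ?_ ?_
  · refine h.mono ?_ subset_rfl
    rintro φ ⟨u, ⟨⟨h1, h2⟩, h3⟩, ⟨⟨h4, h5⟩, h6⟩, h7⟩
    simp only [Set.mem_ofPred_eq, Sum.elim_inl, Sum.elim_inr] at *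
    refine ⟨_, _, h1, h2, ?_, h4, h5, ?_, ?_⟩
    · rwa [sub_sub_sub_cancel_right]
    · rwa [sub_sub_sub_cancel_right]
    · rw [h7]; abel
  · rintro φ ⟨h1, h2, h3, h4⟩ s
    have ht := p.transverse_of_inPlane hr hR h1 h2 h3
    have k1 := (p.circ_iff_sub hR0 hr ht _).2 ⟨s, rfl⟩
    have k2 := (p.circ_iff_sub hR0 hr ht _).2 ⟨!s, rfl⟩
    refine ⟨k1, k2, ?_, ?_, ?_⟩
    · exact (norm_sub_rev _ _).trans k1.2
    · exact (norm_sub_rev _ _).trans k2.2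
    · have e := p.circ_add_circ R r (φ P - O) h1 ht
      rw [← h4, sub_eq_iff_eq_add] at e
      simp only [Sum.elim_inl, Sum.elim_inr, Matrix.cons_val]
      have e' : p.circ (cond s 1 (-1)) R r (φ P - O) + p.circ (cond (!s) 1 (-1)) R r (φ P - O) =
          φ Q - O + (φ P - O) := by
        cases s
        · rw [add_comm]; exact e
        · exact e
      have : O + p.circ (cond s 1 (-1)) R r (φ P - O) + (O + p.circ (cond (!s) 1 (-1)) R r (φ P - O))
          - φ P = p.circ (cond s 1 (-1)) R r (φ P - O) + p.circ (cond (!s) 1 (-1)) R r (φ P - O)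
          + O + O - φ P := by abel
      rw [this, e']; abel
  · rintro φ ⟨h1, h2, h3, h4⟩ u ⟨k1, k2, k3⟩
    have ht := p.transverse_of_inPlane hr hR h1 h2 h3
    obtain ⟨s, hs⟩ := (p.circ_iff_sub hR0 hr ht _).1 k1
    obtain ⟨t, hu⟩ := (p.circ_iff_sub hR0 hr ht _).1 k2
    -- Equal elbows would give `Q = 2 A - P`; since `Q` is prescribed as the sum of the two
    -- different intersection points minus `P`, these would coincide.
    have hst : t = !s := by
      by_contra hne
      have hst : t = s := by cases s <;> cases t <;> simp_all
      rw [hst] at hu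
      have e := p.circ_add_circ R r (φ P - O) h1 ht
      rw [← h4] at e
      simp only [Set.mem_ofPred_eq, Sum.elim_inl, Sum.elim_inr] at k3 hs hu
      rw [k3, hs, hu] at e
      have e' : p.circ 1 R r (φ P - O) + p.circ (-1) R r (φ P - O) =
          p.circ (cond s 1 (-1)) R r (φ P - O) + p.circ (cond s 1 (-1)) R r (φ P - O) := by
        rw [sub_eq_iff_eq_add] at e
        rw [e]; abel
      have hcc : p.circ (cond true 1 (-1)) R r (φ P - O) ≠ p.circ (cond false 1 (-1)) R r (φ P - O) :=
        fun h => Bool.noConfusion (p.circ_ne ht h)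
      cases s
      · exact hcc (add_right_cancel e')
      · exact hcc (add_left_cancel e').symm
    refine ⟨s, funext fun i => ?_⟩
    fin_cases i
    · exact hs
    · rw [hst] at hu; exact hu
  · rintro s i φ ⟨h1, h2, h3, h4⟩
    have ht := p.transverse_of_inPlane hr hR h1 h2 h3
    have pr := fun v => analyticAt_eval v φ
    fin_cases i
    · exact analyticAt_const.fun_add (p.analyticAt_circ ((pr P).fun_sub analyticAt_const) _ ht)
    · exact analyticAt_const.fun_add (p.analyticAt_circ ((pr P).fun_sub analyticAt_const) _ ht)
  · rintro φ ⟨h1, h2, h3, h4⟩ s t hst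
    have ht := p.transverse_of_inPlane hr hR h1 h2 h3
    exact p.circ_ne ht (add_left_cancel (congrFun hst 0))

end Definable

namespace OrthoPair

variable {n : ℕ} (p : OrthoPair n)

lemma norm_pt_sq (a b : ℝ) : ‖p.pt a b‖ ^ 2 = a ^ 2 + b ^ 2 := by
  rw [← real_inner_self_eq_norm_sq, inner_pt_pt]; ring

/-- The Peaucellier linkage with one point on a circle through the pole: the other point is on
a line. -/
lemma peaucellier_line {A B P : Rn n} {s : ℝ} (hs : 0 < s) (pA : p.InPlane A) (pB : p.InPlane B)
    (hA : ‖A‖ = 2 * s) (hPA : ‖P - A‖ = s) (hB : ‖B‖ = 2 * s) (hPB : ‖P - B‖ = s)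
    (hQ : p.InPlane (A + B - P - p.pt (3 * s / 4) 0))
    (hQ' : ‖A + B - P - p.pt (3 * s / 4) 0‖ = 3 * s / 4) (hP : ‖P‖ ≤ 5 * s / 2) :
    p.InPlane P ∧ ⟪p.e, P⟫ = 2 * s := by
  have pQ : p.InPlane (A + B - P) := by
    have := p.inPlane_add hQ (p.inPlane_pt (3 * s / 4) 0)
    rwa [sub_add_cancel] at this
  have pP : p.InPlane P := by
    have := p.inPlane_sub (p.inPlane_add pA pB) pQ
    rwa [sub_sub_cancel] at this
  refine ⟨pP, ?_⟩
  have hin := peaucellier_inner hA hPA hB hPB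
  have hcol := p.peaucellier_collinear pA pB pP hA hPA hB hPB
  set Q := A + B - P
  rw [inPlane_iff] at pQ pP
  set q := ⟪p.e, Q⟫
  set q' := ⟪p.f, Q⟫
  set x := ⟪p.e, P⟫
  set y := ⟪p.f, P⟫
  have hq : q ^ 2 + q' ^ 2 = 2 * (3 * s / 4) * q := by
    have e1 : ‖Q - p.pt (3 * s / 4) 0‖ ^ 2 = (3 * s / 4) ^ 2 := by rw [hQ']
    rw [pQ, pt_sub, norm_pt_sq] at e1
    linarith
  have hQn : ‖Q‖ ^ 2 = q ^ 2 + q' ^ 2 := by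
    conv_lhs => rw [pQ, norm_pt_sq]
  have hqle : q ≤ 3 * s / 2 := by
    by_contra hlt
    nlinarith [sq_nonneg q']
  have hPn : ‖P‖ ^ 2 ≤ (5 * s / 2) ^ 2 := pow_le_pow_left₀ (norm_nonneg _) hP 2
  -- In units of `s ^ 2` this is `25/4 + 9/4 < 10`, which excludes the degenerate position.
  have hc := hcol (by rw [hQn, hq]; nlinarith)
  have hin' : x * q + y * q' = 3 * s ^ 2 := by
    rw [pP, pQ, inner_pt_pt] at hin
    linarith
  have hq0 : q ≠ 0 := by
    intro h0
    have h1 : q' = 0 := by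
      rw [h0] at hq
      have : q' ^ 2 = 0 := by linarith
      exact pow_eq_zero_iff two_ne_zero |>.1 this
    rw [h0, h1] at hin'
    nlinarith
  have h1 : q * (x * (3 * s / 2)) = q * (3 * s ^ 2) := by
    calc q * (x * (3 * s / 2)) = x * (q ^ 2 + q' ^ 2) := by rw [hq]; ring
      _ = q * (x * q) + q' * (x * q') := by ring
      _ = q * (x * q + y * q') := by rw [hc]; ring
      _ = q * (3 * s ^ 2) := by rw [hin']
  have h2 := mul_left_cancel₀ hq0 h1
  have h3 : s * (x - 2 * s) = 0 := by linarith
  linarith [(mul_eq_zero.1 h3).resolve_left hs.ne']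

end OrthoPair

namespace Definable

variable {n : ℕ} {V : Type} [Fintype V]

/-- Radii `2 s` and `s` give inversion of power `3 s²`, and the second vertex is held on a circle
through the pole of diameter `3 s / 2`; its inverse is the line at distance `2 s`. A two-bar chain
from `O` of total length `5 s / 2` keeps `P` where the cell cannot degenerate, and the elbow of this
chain is the choice in `Bool`. -/
lemma line_shifted (p : OrthoPair n) (P : V) (O : Rn n) {s : ℝ} (hs : 0 < s) :
    Definable {φ : V → Rn n | p.InPlane (φ P - O) ∧ ⟪p.e, φ P - O⟫ = 2 * s}
      {φ | ∃ t, |t| < s ∧ φ P - O = p.pt (2 * s) t} := by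
  have hb : 0 < 5 * s / 4 := by positivity
  have hρ : 0 < 3 * s / 4 := by positivity
  have good : ∀ t, |t| < s → 2 * s ≤ ‖p.pt (2 * s) t‖ ∧ ‖p.pt (2 * s) t‖ < 5 * s / 2 := by
    intro t ht
    have h1 := p.norm_pt_sq (2 * s) t
    have h2 : t ^ 2 < s ^ 2 := sq_lt_sq.2 (by rwa [abs_of_pos hs])
    constructor
    · exact le_of_sq_le_sq (by rw [h1]; nlinarith) (norm_nonneg _)
    · exact lt_of_pow_lt_pow_left₀ 2 (by positivity) (by rw [h1]; nlinarith)
  have trans : ∀ t, |t| < s → p.Transverse (5 * s / 4) (5 * s / 4) (p.pt (2 * s) t) := by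
    intro t ht
    have h1 := p.norm_pt_sq (2 * s) t
    obtain ⟨h2, h3⟩ := good t ht
    rw [OrthoPair.Transverse, real_inner_self_eq_norm_sq, p.inner_e_pt, p.inner_f_pt, ← h1]
    set N := ‖p.pt (2 * s) t‖
    have h4 : 0 < N := by linarith
    have h5 : N ^ 2 < (5 * s / 2) ^ 2 := pow_lt_pow_left₀ h3 h4.le two_ne_zero
    have h6 := mul_lt_mul_of_pos_left h5 (pow_pos h4 2)
    nlinarith
  have h := exists_fam (n := n) (V := V) (U := Fin 2) (Ψ := Bool)
    (X₁ := {φ | ∃ t, |t| < s ∧ φ P - O = p.pt (2 * s) t})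
    (fun b φ => ![O + (((2 * s) ^ 2 - s ^ 2) / ⟪φ P - O, φ P - O⟫) • (φ P - O),
      O + p.circ (cond b 1 (-1)) (5 * s / 4) (5 * s / 4) (φ P - O)])
    ((peaucellier p (.inl P) (.inr 0) O hs (show s < 2 * s by linarith)).and <|
      (planarRod p (.inr 0) (O + p.pt (3 * s / 4) 0) hρ).and <|
      ((planarRod p (.inr 1) O hb).and (dist_eq (.inl P) (.inr 1) hb))) ?_ ?_ ?_ ?_
  · refine h.mono ?_ subset_rfl
    rintro φ ⟨u, ⟨A, B, h1, h2, h3, h4, h5, h6, h7⟩, ⟨k1, k2⟩, ⟨-, k3⟩, k4⟩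
    simp only [Set.mem_ofPred_eq, Sum.elim_inl, Sum.elim_inr] at *
    rw [← sub_sub, h7] at k1 k2
    refine p.peaucellier_line hs h1 h4 h2 h3 h5 h6 k1 k2 ?_
    calc ‖φ P - O‖ = ‖(φ P - u 1) + (u 1 - O)‖ := by congr 1; abel
      _ ≤ ‖φ P - u 1‖ + ‖u 1 - O‖ := norm_add_le _ _
      _ = 5 * s / 2 := by rw [k3, k4]; ring
  · rintro φ ⟨t, ht, h1⟩ b
    obtain ⟨g1, g2⟩ := good t ht
    refine ⟨⟨?_, ?_, ?_, ?_⟩, ⟨?_, ?_⟩, ?_⟩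
    · rw [Sum.elim_inl, h1]; exact p.inPlane_pt _ _
    · rw [Sum.elim_inl, h1]; linarith
    · rw [Sum.elim_inl, h1]; linarith
    · rw [Sum.elim_inl, ← real_inner_self_eq_norm_sq]
      exact add_sub_cancel_left _ _
    · simp only [Sum.elim_inr, Matrix.cons_val]
      rw [add_sub_add_left_eq_sub, h1]
      refine p.inPlane_sub ?_ (p.inPlane_pt _ _)
      rw [show ∀ c : ℝ, c • p.pt (2 * s) t = p.pt (c * (2 * s)) (c * t) from fun c => by
        simp only [OrthoPair.pt]; module]
      exact p.inPlane_pt _ _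
    · simp only [Sum.elim_inr, Matrix.cons_val]
      have e : ∀ c : ℝ, c • p.pt (2 * s) t = p.pt (c * (2 * s)) (c * t) := fun c => by
        simp only [OrthoPair.pt]; module
      rw [add_sub_add_left_eq_sub, h1, p.inner_pt_pt, e, p.pt_sub, norm_eq_iff_inner _ hρ.le,
        p.inner_pt_pt]
      have : 0 < 2 * s * (2 * s) + t * t :=
        add_pos_of_pos_of_nonneg (by positivity) (mul_self_nonneg t)
      field_simp
      ring
    · exact (p.circ_iff_sub hb hb (by rw [Sum.elim_inl, h1]; exact trans t ht) _).2 ⟨b, rfl⟩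
  · rintro φ ⟨t, ht, h1⟩ u ⟨⟨A, B, a1, a2, a3, a4, a5, a6, a7⟩, ⟨k1, k2⟩, k3⟩
    obtain ⟨b, hb⟩ := (p.circ_iff_sub hb hb (by rw [Sum.elim_inl, h1]; exact trans t ht) _).1 k3
    refine ⟨b, funext fun i => ?_⟩
    fin_cases i
    · change u 0 = _
      simp only [Sum.elim_inl, Sum.elim_inr] at *
      have hin := peaucellier_inner a2 a3 a5 a6
      obtain ⟨g1, g2⟩ := good t ht
      rw [← sub_sub, a7] at k1 k2
      rw [h1] at a3 a6 a7 k1 k2 hin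
      have pQ : p.InPlane (A + B - p.pt (2 * s) t) :=
        p.inPlane_sub (p.inPlane_add a1 a4) (p.inPlane_pt _ _)
      have hq' : ‖A + B - p.pt (2 * s) t‖ ^ 2 ≤ (3 * s / 2) ^ 2 := by
        refine pow_le_pow_left₀ (norm_nonneg _) ?_ 2
        have e1 := norm_add_le (A + B - p.pt (2 * s) t - p.pt (3 * s / 4) 0) (p.pt (3 * s / 4) 0)
        have e2 : ‖p.pt (3 * s / 4) 0‖ = 3 * s / 4 := by
          rw [norm_eq_iff_inner _ hρ.le, p.inner_pt_pt]; ring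
        rw [sub_add_cancel, k2, e2] at e1
        linarith
      -- Uniqueness of `u 0` again requires excluding the degenerate position. Collinearity and the
      -- inner product `hin` then identify the vertex as the inverse of `P`.
      have hcol := p.peaucellier_collinear a1 a4 (p.inPlane_pt (2 * s) t) a2 a3 a5 a6 (by
        have : ‖p.pt (2 * s) t‖ ^ 2 < (5 * s / 2) ^ 2 :=
          pow_lt_pow_left₀ g2 (norm_nonneg _) two_ne_zero
        nlinarith)
      have hQ : u 0 = O + (A + B - p.pt (2 * s) t) := by rw [← a7]; abel
      simp only [h1]
      change u 0 = O + _
      rw [hQ, p.inner_pt_pt]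
      congr 1
      set Q := A + B - p.pt (2 * s) t
      rw [OrthoPair.inPlane_iff] at pQ
      rw [p.inner_e_pt, p.inner_f_pt] at hcol
      rw [p.inner_pt] at hin
      set q := ⟪p.e, Q⟫
      set q' := ⟪p.f, Q⟫
      have e : ∀ c : ℝ, c • p.pt (2 * s) t = p.pt (c * (2 * s)) (c * t) := fun c => by
        simp only [OrthoPair.pt]; module
      have hpos : 0 < 2 * s * (2 * s) + t * t :=
        add_pos_of_pos_of_nonneg (by positivity) (mul_self_nonneg t)
      rw [pQ, e, ← hin]
      congr 1
      · field_simp; linear_combination (-t) * hcol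
      · field_simp; linear_combination (2 * s) * hcol
    · exact hb
  · rintro b i φ ⟨t, ht, h1⟩
    have pr := (analyticAt_eval P φ).fun_sub (analyticAt_const (v := O))
    fin_cases i
    · refine analyticAt_const.fun_add (AnalyticAt.fun_smul
        (analyticAt_const.fun_div (analyticAt_inner_self pr) ?_) pr)
      rw [h1, p.inner_pt_pt]
      exact (add_pos_of_pos_of_nonneg (by positivity) (mul_self_nonneg t)).ne'
    · exact analyticAt_const.fun_add (p.analyticAt_circ pr _ (by rw [h1]; exact trans t ht))
  · rintro φ ⟨t, ht, h1⟩ b b' hbb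
    exact p.circ_ne (by rw [h1]; exact trans t ht) (add_left_cancel (congrFun hbb 1))

/-- Being on the line spanned by the second vector of the pair. -/
lemma line (p : OrthoPair n) (P : V) {s : ℝ} (hs : 0 < s) :
    Definable {φ : V → Rn n | ∃ t : ℝ, φ P = t • p.f} {φ | ∃ t : ℝ, |t| < s ∧ φ P = t • p.f} := by
  -- With the pole at `-2 s e` the line passes through the origin.
  refine (line_shifted p P (-((2 * s) • p.e)) hs).mono ?_ ?_
  · rintro φ ⟨h1, h2⟩
    rw [OrthoPair.inPlane_iff, h2] at h1
    refine ⟨⟪p.f, φ P - -((2 * s) • p.e)⟫, ?_⟩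
    rw [OrthoPair.pt, sub_eq_iff_eq_add] at h1
    rw [← add_neg_cancel_right (φ P) ((2 * s) • p.e)]
    nth_rw 1 [h1]
    simp only [sub_neg_eq_add]
    abel_nf
  · rintro φ ⟨t, ht, h⟩
    refine ⟨t, ht, ?_⟩
    rw [h, OrthoPair.pt]; abel

/-- Inversion on the line spanned by the second vector of the pair. -/
lemma inversion (p : OrthoPair n) (P Q : V) {σ τ : ℝ} (hσ : 0 < σ) (hτ : σ < τ) :
    Definable {φ : V → Rn n | ∀ x y : ℝ, φ P = x • p.f → φ Q = y • p.f → x * y = σ * τ}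
      {φ | ∃ x : ℝ, σ < x ∧ x < τ ∧ φ P = x • p.f ∧ φ Q = (σ * τ / x) • p.f} := by
  -- The radii are chosen with `R - r = σ` and `R + r = τ`, so the power is `R² - r² = σ τ`.
  have hr : 0 < (τ - σ) / 2 := by linarith
  have hR : (τ - σ) / 2 < (σ + τ) / 2 := by linarith
  refine (peaucellier p P Q 0 hr hR).mono ?_ ?_
  · rintro φ ⟨A, B, -, h2, h3, -, h5, h6, h7⟩ x y hx hy
    rw [sub_zero] at h3 h6 h7
    rw [sub_zero] at h7
    have := peaucellier_inner h2 h3 h5 h6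
    rw [← h7, hx, hy, inner_smul_left, inner_smul_right, p.f_unit] at this
    simp only [conj_trivial, mul_one] at this
    rw [this]; ring
  · rintro φ ⟨x, h1, h2, h3, h4⟩
    have hx : 0 < x := hσ.trans h1
    have hn : ‖x • p.f‖ = x := by
      rw [norm_eq_iff_inner _ hx.le, inner_smul_left, inner_smul_right, p.f_unit]
      simp [sq]
    change p.InPlane (φ P - 0) ∧ _ < ‖φ P - 0‖ ∧ ‖φ P - 0‖ < _ ∧
      φ Q - 0 = (_ / ‖φ P - 0‖ ^ 2) • (φ P - 0)
    rw [sub_zero, sub_zero, h3, h4, hn]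
    refine ⟨?_, by linarith, by linarith, ?_⟩
    · have : x • p.f = p.pt 0 x := by rw [OrthoPair.pt]; simp
      rw [this]; exact p.inPlane_pt _ _
    · rw [smul_smul]
      congr 1
      field_simp
      ring

end Definable

/-! ### Arithmetic on a line. -/

namespace OrthoPair

variable {n : ℕ} (p : OrthoPair n)

lemma norm_f : ‖p.f‖ = 1 := (norm_eq_iff_inner _ zero_le_one).2 (by rw [p.f_unit]; norm_num)

lemma norm_smul_f (x : ℝ) : ‖x • p.f‖ = |x| := by
  rw [norm_smul, p.norm_f, mul_one, Real.norm_eq_abs]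

lemma f_ne_zero : p.f ≠ 0 := fun h => by
  have := p.norm_f
  rw [h, norm_zero] at this
  exact zero_ne_one this

lemma smul_f_inj {x y : ℝ} : x • p.f = y • p.f ↔ x = y :=
  (smul_left_injective ℝ p.f_ne_zero).eq_iff

lemma inner_smul_f (x : ℝ) : ⟪p.f, x • p.f⟫ = x := by
  rw [inner_smul_right, p.f_unit, mul_one]

end OrthoPair

lemma analyticAt_coord {n : ℕ} {V : Type} [Fintype V] (e : Rn n) (v : V) (φ : V → Rn n) :
    AnalyticAt ℝ (fun φ : V → Rn n => ⟪e, φ v⟫) φ :=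
  analyticAt_inner_const e (analyticAt_eval v φ)

namespace Definable

variable {n : ℕ} {V : Type} [Fintype V]

/-- `inversion` is silent about points off the line; here both points are put on it. The nonzero
product then shows that neither coordinate vanishes, which justifies later divisions. -/
lemma inversion_pair (p : OrthoPair n) (P Q : V) {σ τ : ℝ} (hσ : 0 < σ) (hτ : σ < τ) :
    Definable {φ : V → Rn n | ∃ x y : ℝ, φ P = x • p.f ∧ φ Q = y • p.f ∧ x * y = σ * τ}
      {φ | ∃ x : ℝ, σ < x ∧ x < τ ∧ φ P = x • p.f ∧ φ Q = (σ * τ / x) • p.f} := by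
  have hτ0 := hσ.trans hτ
  refine ((line p P hτ0).and ((line p Q hτ0).and (inversion p P Q hσ hτ))).mono ?_ ?_
  · rintro φ ⟨⟨x, hx⟩, ⟨y, hy⟩, h⟩
    exact ⟨x, y, hx, hy, h x y hx hy⟩
  · rintro φ ⟨x, h1, h2, h3, h4⟩
    have hx := hσ.trans h1
    refine ⟨⟨x, by rwa [abs_of_pos hx], h3⟩, ⟨σ * τ / x, ?_, h4⟩, x, h1, h2, h3, h4⟩
    rw [abs_of_pos (by positivity), div_lt_iff₀ hx]
    nlinarith

/-- The relation `z = x² - 1`, from the identity `1/(x-1) - 1/(x+1) = 2/(x²-1)`. -/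
lemma sq_sub_one (p : OrthoPair n) (a z : V) {K : ℝ} (hK : 3 < K) :
    Definable {φ : V → Rn n | ∀ x : ℝ, φ a = x • p.f → φ z = (x ^ 2 - 1) • p.f}
      {φ | ∃ x : ℝ, 3 < x ∧ x < K ∧ φ a = x • p.f ∧ φ z = (x ^ 2 - 1) • p.f} := by
  -- With this `τ`, both `x - 1` and `x + 1` lie in the range `(1, τ)` of an inversion of power `τ`.
  obtain ⟨τ, hτ⟩ : ∃ τ, τ = K + 2 := ⟨_, rfl⟩
  have hτ1 : 1 < τ := by linarith
  have hτ0 : 0 < τ := by linarith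
  have hσ' : 0 < 2 / τ := by positivity
  -- The last inversion needs power `2 * τ`; writing it as `2 / τ * τ ^ 2` makes its range contain
  -- `2 * τ / (x ^ 2 - 1)`.
  have hτ' : 2 / τ < τ ^ 2 := by
    rw [div_lt_iff₀ hτ0]; nlinarith
  let y : ℝ → Fin 6 → Rn n := fun x => ![p.f, (x - 1) • p.f, (x + 1) • p.f, (τ / (x - 1)) • p.f,
    (τ / (x + 1)) • p.f, (2 * τ / (x ^ 2 - 1)) • p.f]
  let sys : Set (V ⊕ Fin 6 → Rn n) := {φ | φ (.inr 0) = p.f} ∩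
    ({φ | φ (.inl a) = φ (.inr 1) + φ (.inr 0)} ∩ ({φ | φ (.inr 2) = φ (.inl a) + φ (.inr 0)} ∩
    ({φ | ∃ x y : ℝ, φ (.inr 1) = x • p.f ∧ φ (.inr 3) = y • p.f ∧ x * y = 1 * τ} ∩
    ({φ | ∃ x y : ℝ, φ (.inr 2) = x • p.f ∧ φ (.inr 4) = y • p.f ∧ x * y = 1 * τ} ∩
    ({φ | φ (.inr 3) = φ (.inr 5) + φ (.inr 4)} ∩
    {φ | ∃ x y : ℝ, φ (.inr 5) = x • p.f ∧ φ (.inl z) = y • p.f ∧ x * y = 2 / τ * τ ^ 2})))))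
  have key : ∀ (φ : V → Rn n) (u : Fin 6 → Rn n), Sum.elim φ u ∈ sys → ∀ x : ℝ, φ a = x • p.f →
      u = y x ∧ φ z = (x ^ 2 - 1) • p.f := by
    rintro φ u ⟨h0, h1, h2, ⟨x1, x3, h3, h4, h5⟩, ⟨x2, x4, h6, h7, h8⟩, h9, ⟨x5, x6, h10, h11, h12⟩⟩ x hx
    simp only [Set.mem_ofPred_eq, Sum.elim_inl, Sum.elim_inr, hx] at h0 h1 h2 h3 h4 h6 h7 h9 h10 h11
    have e1 : x1 = x - 1 := by
      rw [h0, h3] at h1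
      have : x • p.f = (x1 + 1) • p.f := by rw [h1]; module
      rw [p.smul_f_inj] at this
      linarith
    have e2 : x2 = x + 1 := by
      rw [h0, h6] at h2
      have : x2 • p.f = (x + 1) • p.f := by rw [h2]; module
      rwa [p.smul_f_inj] at this
    have e5 : x3 = x5 + x4 := by
      rw [h4, h7, h10, ← add_smul] at h9
      rwa [p.smul_f_inj] at h9
    have hx1 : x - 1 ≠ 0 := by
      rintro h
      rw [e1, h] at h5
      linarith
    have hx2 : x + 1 ≠ 0 := by
      rintro h
      rw [e2, h] at h8
      linarith
    have hx3 : x ^ 2 - 1 ≠ 0 := by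
      rw [show x ^ 2 - 1 = (x - 1) * (x + 1) by ring]
      exact mul_ne_zero hx1 hx2
    have e3 : x3 = τ / (x - 1) := by
      rw [eq_div_iff hx1, ← e1]; linarith
    have e4 : x4 = τ / (x + 1) := by
      rw [eq_div_iff hx2, ← e2]; linarith
    have e5' : x5 = 2 * τ / (x ^ 2 - 1) := by
      have : x5 = τ / (x - 1) - τ / (x + 1) := by linarith
      rw [this, div_sub_div _ _ hx1 hx2, show (x - 1) * (x + 1) = x ^ 2 - 1 by ring]
      congr 1; ring
    have e6 : x6 = x ^ 2 - 1 := by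
      rw [e5'] at h12
      field_simp at h12
      linarith
    refine ⟨funext fun i => ?_, by rw [h11, e6]⟩
    fin_cases i
    · exact h0
    · exact h3.trans (by rw [e1]; rfl)
    · exact h6.trans (by rw [e2]; rfl)
    · exact h4.trans (by rw [e3]; rfl)
    · exact h7.trans (by rw [e4]; rfl)
    · exact h10.trans (by rw [e5']; rfl)
  have hR : 0 < 2 * τ := by positivity
  have h := exists_fun (n := n) (V := V) (U := Fin 6)
    (X₁ := {φ | ∃ x : ℝ, 3 < x ∧ x < K ∧ φ a = x • p.f ∧ φ z = (x ^ 2 - 1) • p.f})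
    (fun φ => y ⟪p.f, φ a⟫)
    (((eq_const (.inr 0) p.f).and <| (add_eq p (.inr 1) (.inr 0) (.inl a) hR).and <|
      (add_eq p (.inl a) (.inr 0) (.inr 2) hR).and <|
      (inversion_pair p (.inr 1) (.inr 3) one_pos hτ1).and <|
      (inversion_pair p (.inr 2) (.inr 4) one_pos hτ1).and <|
      (add_eq p (.inr 5) (.inr 4) (.inr 3) hR).and <|
      inversion_pair p (.inr 5) (.inl z) hσ' hτ').mono
      (show _ ⊆ sys from subset_rfl) subset_rfl) ?_ ?_ ?_
  · refine h.mono ?_ subset_rfl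
    rintro φ ⟨u, hu⟩ x hx
    exact (key φ u hu x hx).2
  · rintro φ ⟨x, hx3, hxK, hx, hz⟩
    have a1 : 0 < x - 1 := by linarith
    have a2 : 0 < x + 1 := by linarith
    have a3 : 0 < x ^ 2 - 1 := by nlinarith
    have b3 : τ / (x + 1) < τ := by
      rw [div_lt_iff₀ a2]; nlinarith
    have b4 : 2 * τ / (x ^ 2 - 1) < τ := by
      have a4 : 2 < x ^ 2 - 1 := by nlinarith
      rw [div_lt_iff₀ a3]; linarith [mul_lt_mul_of_pos_left a4 hτ0]
    have nf := p.norm_f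
    rw [hx, p.inner_smul_f]
    refine ⟨rfl, ⟨?_, ?_, ?_⟩, ⟨?_, ?_, ?_⟩, ⟨x - 1, ?_, ?_, rfl, ?_⟩, ⟨x + 1, ?_, ?_, rfl, ?_⟩,
      ⟨?_, ?_, ?_⟩, ⟨2 * τ / (x ^ 2 - 1), ?_, ?_, rfl, ?_⟩⟩
    · change ‖(x - 1) • p.f‖ < _
      rw [p.norm_smul_f, abs_of_pos a1]; linarith
    · change ‖p.f‖ < _
      rw [nf]; linarith
    · change φ a = (x - 1) • p.f + p.f
      rw [hx]; module
    · change ‖φ a‖ < _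
      rw [hx, p.norm_smul_f, abs_of_pos (by linarith)]; linarith
    · change ‖p.f‖ < _
      rw [nf]; linarith
    · change (x + 1) • p.f = φ a + p.f
      rw [hx]; module
    · linarith
    · linarith
    · change (τ / (x - 1)) • p.f = _
      rw [one_mul]
    · linarith
    · linarith
    · change (τ / (x + 1)) • p.f = _
      rw [one_mul]
    · change ‖(2 * τ / (x ^ 2 - 1)) • p.f‖ < _
      rw [p.norm_smul_f, abs_of_pos (by positivity)]; linarith
    · change ‖(τ / (x + 1)) • p.f‖ < _
      rw [p.norm_smul_f, abs_of_pos (by positivity)]; linarith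
    · change (τ / (x - 1)) • p.f = (2 * τ / (x ^ 2 - 1)) • p.f + (τ / (x + 1)) • p.f
      rw [← add_smul]
      congr 1
      rw [show x ^ 2 - 1 = (x - 1) * (x + 1) by ring]
      field_simp
      ring
    · rw [div_lt_div_iff₀ hτ0 a3]; nlinarith
    · have : τ < τ ^ 2 := by nlinarith
      linarith
    · change φ z = _
      rw [hz]
      congr 1
      field_simp
  · rintro φ ⟨x, -, -, hx, -⟩ u hu
    rw [(key φ u hu x hx).1, hx, p.inner_smul_f]
  · rintro i φ ⟨x, hx3, -, hx, -⟩
    have pr := analyticAt_coord p.f a φ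
    have hv : ⟪p.f, φ a⟫ = x := by rw [hx, p.inner_smul_f]
    have a1 : x - 1 ≠ 0 := by linarith
    have a2 : x + 1 ≠ 0 := by linarith
    have a3 : x ^ 2 - 1 ≠ 0 := by nlinarith
    have c := fun t : ℝ => analyticAt_const (𝕜 := ℝ) (v := t) (x := φ)
    have cf := analyticAt_const (𝕜 := ℝ) (v := p.f) (x := φ)
    fin_cases i
    · exact cf
    · exact (pr.fun_sub (c 1)).fun_smul cf
    · exact (pr.fun_add (c 1)).fun_smul cf
    · exact ((c τ).fun_div (pr.fun_sub (c 1)) (by rwa [hv])).fun_smul cf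
    · exact ((c τ).fun_div (pr.fun_add (c 1)) (by rwa [hv])).fun_smul cf
    · exact ((c (2 * τ)).fun_div ((pr.fun_pow 2).fun_sub (c 1)) (by rwa [hv])).fun_smul cf

/-- The relation `z = 2 x² + c` for a constant `c`. -/
lemma two_mul_sq (p : OrthoPair n) (a z : V) {R : ℝ} (hR : 0 < R) :
    Definable {φ : V → Rn n | ∀ x : ℝ, φ a = x • p.f → φ z = (2 * x ^ 2 + 2 * (R + 3) ^ 2 - 2) • p.f}
      {φ | ∃ x : ℝ, |x| < R ∧ φ a = x • p.f ∧ φ z = (2 * x ^ 2 + 2 * (R + 3) ^ 2 - 2) • p.f} := by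
  -- This shift puts `D + x` and `D - x` between `3` and `2 * R + 3`, where `sq_sub_one` works. In
  -- the sum of their squares the linear terms cancel.
  obtain ⟨D, hD⟩ : ∃ D, D = R + 3 := ⟨_, rfl⟩
  obtain ⟨M, hM⟩ : ∃ M, M = (2 * R + 3) ^ 2 := ⟨_, rfl⟩
  have hM0 : 0 < M := by rw [hM]; positivity
  rw [← hD]
  let y : ℝ → Fin 5 → Rn n := fun x => ![D • p.f, (D + x) • p.f, (D - x) • p.f,
    ((D + x) ^ 2 - 1) • p.f, ((D - x) ^ 2 - 1) • p.f]
  let sys : Set (V ⊕ Fin 5 → Rn n) := {φ | φ (.inr 0) = D • p.f} ∩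
    ({φ | φ (.inr 1) = φ (.inr 0) + φ (.inl a)} ∩ ({φ | φ (.inr 0) = φ (.inr 2) + φ (.inl a)} ∩
    ({φ | ∀ x : ℝ, φ (.inr 1) = x • p.f → φ (.inr 3) = (x ^ 2 - 1) • p.f} ∩
    ({φ | ∀ x : ℝ, φ (.inr 2) = x • p.f → φ (.inr 4) = (x ^ 2 - 1) • p.f} ∩
    {φ | φ (.inl z) = φ (.inr 3) + φ (.inr 4)}))))
  have key : ∀ (φ : V → Rn n) (u : Fin 5 → Rn n), Sum.elim φ u ∈ sys → ∀ x : ℝ, φ a = x • p.f →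
      u = y x ∧ φ z = (2 * x ^ 2 + 2 * D ^ 2 - 2) • p.f := by
    rintro φ u ⟨h0, h1, h2, h3, h4, h5⟩ x hx
    simp only [Set.mem_ofPred_eq, Sum.elim_inl, Sum.elim_inr, hx] at h0 h1 h2 h3 h4 h5
    have e1 : u 1 = (D + x) • p.f := by rw [h1, h0]; module
    have e2 : u 2 = (D - x) • p.f := by
      rw [h0] at h2
      rw [eq_sub_of_add_eq h2.symm]; module
    have e3 := h3 _ e1
    have e4 := h4 _ e2
    refine ⟨funext fun i => ?_, by rw [h5, e3, e4, ← add_smul]; congr 1; ring⟩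
    fin_cases i
    · exact h0
    · exact e1
    · exact e2
    · exact e3
    · exact e4
  have h := exists_fun (n := n) (V := V) (U := Fin 5)
    (X₁ := {φ | ∃ x : ℝ, |x| < R ∧ φ a = x • p.f ∧ φ z = (2 * x ^ 2 + 2 * D ^ 2 - 2) • p.f})
    (fun φ => y ⟪p.f, φ a⟫)
    (((eq_const (.inr 0) (D • p.f)).and <| (add_eq p (.inr 0) (.inl a) (.inr 1) hM0).and <|
      (add_eq p (.inr 2) (.inl a) (.inr 0) hM0).and <|
      (sq_sub_one p (.inr 1) (.inr 3) (show 3 < 2 * R + 3 by linarith)).and <|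
      (sq_sub_one p (.inr 2) (.inr 4) (show 3 < 2 * R + 3 by linarith)).and <|
      add_eq p (.inr 3) (.inr 4) (.inl z) hM0).mono
      (show _ ⊆ sys from subset_rfl) subset_rfl) ?_ ?_ ?_
  · refine h.mono ?_ subset_rfl
    rintro φ ⟨u, hu⟩ x hx
    exact (key φ u hu x hx).2
  · rintro φ ⟨x, hxR, hx, hz⟩
    obtain ⟨x1, x2⟩ := abs_lt.1 hxR
    have hax : ‖φ a‖ < M := by
      rw [hx, p.norm_smul_f]; nlinarith
    rw [hx, p.inner_smul_f]
    refine ⟨rfl, ⟨?_, hax, ?_⟩, ⟨?_, hax, ?_⟩, ⟨D + x, ?_, ?_, rfl, rfl⟩, ⟨D - x, ?_, ?_, rfl, rfl⟩,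
      ⟨?_, ?_, ?_⟩⟩
    · change ‖D • p.f‖ < _
      rw [p.norm_smul_f, abs_of_pos (by linarith)]; nlinarith
    · change (D + x) • p.f = D • p.f + φ a
      rw [hx]; module
    · change ‖(D - x) • p.f‖ < _
      rw [p.norm_smul_f, abs_of_pos (by linarith)]; nlinarith
    · change D • p.f = (D - x) • p.f + φ a
      rw [hx]; module
    · linarith
    · linarith
    · linarith
    · linarith
    · change ‖((D + x) ^ 2 - 1) • p.f‖ < _
      rw [p.norm_smul_f, abs_of_pos (by nlinarith)]; nlinarith
    · change ‖((D - x) ^ 2 - 1) • p.f‖ < _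
      rw [p.norm_smul_f, abs_of_pos (by nlinarith)]; nlinarith
    · change φ z = ((D + x) ^ 2 - 1) • p.f + ((D - x) ^ 2 - 1) • p.f
      rw [hz, ← add_smul]
      congr 1; ring
  · rintro φ ⟨x, -, hx, -⟩ u hu
    rw [(key φ u hu x hx).1, hx, p.inner_smul_f]
  · rintro i φ -
    have pr := analyticAt_coord p.f a φ
    have c := fun t : ℝ => analyticAt_const (𝕜 := ℝ) (v := t) (x := φ)
    have cf := analyticAt_const (𝕜 := ℝ) (v := p.f) (x := φ)
    fin_cases i
    · exact (c D).fun_smul cf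
    · exact ((c D).fun_add pr).fun_smul cf
    · exact ((c D).fun_sub pr).fun_smul cf
    · exact ((((c D).fun_add pr).fun_pow 2).fun_sub (c 1)).fun_smul cf
    · exact ((((c D).fun_sub pr).fun_pow 2).fun_sub (c 1)).fun_smul cf

/-- Multiplication, from `2 (x + y)² - 2 (x - y)² = 8 x y`. -/
lemma mul_eq (p : OrthoPair n) (a b c : V) {R : ℝ} (hR : 0 < R) :
    Definable {φ : V → Rn n | ∀ x y : ℝ, φ a = x • p.f → φ b = y • p.f → φ c = (x * y) • p.f}
      {φ | ∃ x y : ℝ, |x| < R ∧ |y| < R ∧ φ a = x • p.f ∧ φ b = y • p.f ∧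
        φ c = (x * y) • p.f} := by
  -- The constant that `two_mul_sq` adds for the bound `2 * R`; it cancels between `x + y` and `x -
  -- y`.
  obtain ⟨C, hC⟩ : ∃ C, C = 2 * (2 * R + 3) ^ 2 - 2 := ⟨_, rfl⟩
  obtain ⟨M, hM⟩ : ∃ M, M = 8 * R ^ 2 + C + R := ⟨_, rfl⟩
  have hC0 : 0 < C := by rw [hC]; nlinarith
  have hM0 : 0 < M := by rw [hM]; positivity
  let w : ℝ → ℝ → Fin 6 → Rn n := fun x y => ![(x + y) • p.f, (x - y) • p.f,
    (2 * (x + y) ^ 2 + 2 * (2 * R + 3) ^ 2 - 2) • p.f,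
    (2 * (x - y) ^ 2 + 2 * (2 * R + 3) ^ 2 - 2) • p.f, (2 * (x * y)) • p.f, (4 * (x * y)) • p.f]
  -- Division by `8` is avoided: `c` is doubled three times, and the result is compared with `8 * (x
  -- * y)`.
  let sys : Set (V ⊕ Fin 6 ⊕ Unit → Rn n) := {φ | φ (.inr (.inl 0)) = φ (.inl a) + φ (.inl b)} ∩
    ({φ | φ (.inl a) = φ (.inr (.inl 1)) + φ (.inl b)} ∩
    ({φ | ∀ x : ℝ, φ (.inr (.inl 0)) = x • p.f →
      φ (.inr (.inl 2)) = (2 * x ^ 2 + 2 * (2 * R + 3) ^ 2 - 2) • p.f} ∩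
    ({φ | ∀ x : ℝ, φ (.inr (.inl 1)) = x • p.f →
      φ (.inr (.inl 3)) = (2 * x ^ 2 + 2 * (2 * R + 3) ^ 2 - 2) • p.f} ∩
    ({φ | φ (.inr (.inl 4)) = φ (.inl c) + φ (.inl c)} ∩
    ({φ | φ (.inr (.inl 5)) = φ (.inr (.inl 4)) + φ (.inr (.inl 4))} ∩
    ({φ | φ (.inr (.inr ())) = φ (.inr (.inl 5)) + φ (.inr (.inl 5))} ∩
    {φ | φ (.inr (.inl 2)) = φ (.inr (.inl 3)) + φ (.inr (.inr ()))}))))))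
  have key : ∀ (φ : V → Rn n) (u : Fin 6 ⊕ Unit → Rn n), Sum.elim φ u ∈ sys → ∀ x y : ℝ,
      φ a = x • p.f → φ b = y • p.f →
      u = Sum.elim (w x y) (fun _ => (8 * (x * y)) • p.f) ∧ φ c = (x * y) • p.f := by
    rintro φ u ⟨h0, h1, h2, h3, h4, h5, h6, h7⟩ x y hx hy
    simp only [Set.mem_ofPred_eq, Sum.elim_inl, Sum.elim_inr, hx, hy] at h0 h1 h2 h3 h4 h5 h6 h7
    have e0 : u (.inl 0) = (x + y) • p.f := by rw [h0]; module
    have e1 : u (.inl 1) = (x - y) • p.f := by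
      rw [eq_sub_of_add_eq h1.symm]; module
    have e2 := h2 _ e0
    have e3 := h3 _ e1
    have e6 : u (.inr ()) = (8 * (x * y)) • p.f := by
      rw [e2, e3] at h7
      rw [eq_sub_of_add_eq' h7.symm]; module
    have e8 : (8 : ℝ) • φ c = (8 : ℝ) • (x * y) • p.f := by
      rw [smul_smul, ← e6, h6, h5, h4]; module
    have ec : φ c = (x * y) • p.f := smul_right_injective _ (by norm_num : (8 : ℝ) ≠ 0) e8
    refine ⟨funext fun i => ?_, ec⟩
    rcases i with i | i
    · fin_cases i
      · exact e0
      · exact e1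
      · exact e2
      · exact e3
      · change u (.inl 4) = (2 * (x * y)) • p.f
        rw [h4, ec]; module
      · change u (.inl 5) = (4 * (x * y)) • p.f
        rw [h5, h4, ec]; module
    · exact e6
  have hR2 : 0 < 2 * R := by positivity
  have h := exists_fun (n := n) (V := V) (U := Fin 6 ⊕ Unit)
    (X₁ := {φ | ∃ x y : ℝ, |x| < R ∧ |y| < R ∧ φ a = x • p.f ∧ φ b = y • p.f ∧
        φ c = (x * y) • p.f})
    (fun φ => Sum.elim (w ⟪p.f, φ a⟫ ⟪p.f, φ b⟫) (fun _ => (8 * (⟪p.f, φ a⟫ * ⟪p.f, φ b⟫)) • p.f))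
    (((add_eq p (.inl a) (.inl b) (.inr (.inl 0)) hM0).and <|
      (add_eq p (.inr (.inl 1)) (.inl b) (.inl a) hM0).and <|
      (two_mul_sq p (.inr (.inl 0)) (.inr (.inl 2)) hR2).and <|
      (two_mul_sq p (.inr (.inl 1)) (.inr (.inl 3)) hR2).and <|
      (add_eq p (.inl c) (.inl c) (.inr (.inl 4)) hM0).and <|
      (add_eq p (.inr (.inl 4)) (.inr (.inl 4)) (.inr (.inl 5)) hM0).and <|
      (add_eq p (.inr (.inl 5)) (.inr (.inl 5)) (.inr (.inr ())) hM0).and <|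
      add_eq p (.inr (.inl 3)) (.inr (.inr ())) (.inr (.inl 2))
        (show 0 < 2 * M by positivity)).mono
      (show _ ⊆ sys from subset_rfl) subset_rfl) ?_ ?_ ?_
  · refine h.mono ?_ subset_rfl
    rintro φ ⟨u, hu⟩ x y hx hy
    exact (key φ u hu x y hx hy).2
  · rintro φ ⟨x, y, hxR, hyR, hx, hy, hc⟩
    have hxy : |x * y| < R ^ 2 := by
      rw [abs_mul, sq]
      exact mul_lt_mul'' hxR hyR (abs_nonneg _) (abs_nonneg _)
    have hadd : |x + y| < 2 * R := by linarith [abs_add_le x y]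
    have hsub : |x - y| < 2 * R := by linarith [abs_sub x y]
    have hsub2 : (x - y) ^ 2 < (2 * R) ^ 2 := sq_lt_sq.2 (by rwa [abs_of_pos hR2])
    have habs : ∀ k : ℝ, 0 < k → |k * (x * y)| < k * R ^ 2 := fun k hk => by
      rw [abs_mul, abs_of_pos hk]
      exact mul_lt_mul_of_pos_left hxy hk
    have hR2' : 0 < R ^ 2 := by positivity
    have na : ‖φ a‖ < M := by rw [hx, p.norm_smul_f]; linarith
    have nb : ‖φ b‖ < M := by rw [hy, p.norm_smul_f]; linarith
    have nc : ‖φ c‖ < M := by rw [hc, p.norm_smul_f]; linarith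
    have n2 : ‖(2 * (x * y)) • p.f‖ < M := by
      rw [p.norm_smul_f]; linarith [habs 2 two_pos]
    have n4 : ‖(4 * (x * y)) • p.f‖ < M := by
      rw [p.norm_smul_f]; linarith [habs 4 four_pos]
    have n8 : ‖(8 * (x * y)) • p.f‖ < 2 * M := by
      rw [p.norm_smul_f]; linarith [habs 8 (by norm_num)]
    simp only [hx, hy, p.inner_smul_f]
    refine ⟨⟨na, nb, ?_⟩, ⟨?_, nb, ?_⟩, ⟨x + y, hadd, rfl, rfl⟩, ⟨x - y, hsub, rfl, rfl⟩,
      ⟨nc, nc, ?_⟩, ⟨n2, n2, ?_⟩, ⟨n4, n4, ?_⟩, ⟨?_, n8, ?_⟩⟩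
    · change (x + y) • p.f = φ a + φ b
      rw [hx, hy]; module
    · change ‖(x - y) • p.f‖ < M
      rw [p.norm_smul_f]; nlinarith
    · change φ a = (x - y) • p.f + φ b
      rw [hx, hy]; module
    · change (2 * (x * y)) • p.f = φ c + φ c
      rw [hc]; module
    · change (4 * (x * y)) • p.f = (2 * (x * y)) • p.f + (2 * (x * y)) • p.f
      module
    · change (8 * (x * y)) • p.f = (4 * (x * y)) • p.f + (4 * (x * y)) • p.f
      module
    · change ‖(2 * (x - y) ^ 2 + 2 * (2 * R + 3) ^ 2 - 2) • p.f‖ < _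
      rw [p.norm_smul_f, add_sub_assoc, ← hC, abs_of_pos (by positivity)]; nlinarith
    · change (2 * (x + y) ^ 2 + 2 * (2 * R + 3) ^ 2 - 2) • p.f =
        (2 * (x - y) ^ 2 + 2 * (2 * R + 3) ^ 2 - 2) • p.f + (8 * (x * y)) • p.f
      module
  · rintro φ ⟨x, y, -, -, hx, hy, -⟩ u hu
    rw [(key φ u hu x y hx hy).1, hx, hy, p.inner_smul_f, p.inner_smul_f]
  · rintro i φ -
    have pa := analyticAt_coord p.f a φ
    have pb := analyticAt_coord p.f b φ
    have cc := fun t : ℝ => analyticAt_const (𝕜 := ℝ) (v := t) (x := φ)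
    have cf := analyticAt_const (𝕜 := ℝ) (v := p.f) (x := φ)
    rcases i with i | i
    · fin_cases i
      · exact (pa.fun_add pb).fun_smul cf
      · exact (pa.fun_sub pb).fun_smul cf
      · exact ((((cc 2).fun_mul ((pa.fun_add pb).fun_pow 2)).fun_add (cc _)).fun_sub
          (cc 2)).fun_smul cf
      · exact ((((cc 2).fun_mul ((pa.fun_sub pb).fun_pow 2)).fun_add (cc _)).fun_sub
          (cc 2)).fun_smul cf
      · exact ((cc 2).fun_mul (pa.fun_mul pb)).fun_smul cf
      · exact ((cc 4).fun_mul (pa.fun_mul pb)).fun_smul cf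
    · exact ((cc 8).fun_mul (pa.fun_mul pb)).fun_smul cf

end Definable

/-! ### Polynomials and compact algebraic sets. -/

/-- Gadgets work in bounded ranges; compactness of a cube supplies the bound on a polynomial value
that enters the next gadget. -/
lemma exists_bound_eval {σ : Type} [Fintype σ] (q : MvPolynomial σ ℝ) (R : ℝ) :
    ∃ M, 0 < M ∧ ∀ t : σ → ℝ, (∀ i, |t i| < R) → |MvPolynomial.eval t q| < M := by
  have hK : IsCompact (Set.univ.pi fun _ : σ => Set.Icc (-R) R) :=
    isCompact_univ_pi fun _ => isCompact_Icc
  obtain ⟨C, hC⟩ := hK.exists_bound_of_continuousOn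
    (f := fun t => MvPolynomial.eval t q) (MvPolynomial.continuous_eval q).continuousOn
  refine ⟨|C| + 1, by positivity, fun t ht => ?_⟩
  have := hC t fun i _ => ⟨(abs_lt.1 (ht i)).1.le, (abs_lt.1 (ht i)).2.le⟩
  rw [Real.norm_eq_abs] at this
  linarith [le_abs_self C]

namespace Definable

/-- Evaluation of polynomials. -/
lemma eval_eq {n : ℕ} (p : OrthoPair n) {σ : Type} [Fintype σ] (q : MvPolynomial σ ℝ) :
    ∀ {V : Type} [Fintype V] (v : σ → V) (z : V) {R : ℝ}, 0 < R →
    Definable {φ : V → Rn n | ∀ t : σ → ℝ, (∀ i, φ (v i) = t i • p.f) →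
        φ z = MvPolynomial.eval t q • p.f}
      {φ | ∃ t : σ → ℝ, (∀ i, |t i| < R) ∧ (∀ i, φ (v i) = t i • p.f) ∧
        φ z = MvPolynomial.eval t q • p.f} := by
  have coords : ∀ {V : Type} [Fintype V] (v : σ → V) (φ : V → Rn n) (t : σ → ℝ),
      (∀ i, φ (v i) = t i • p.f) → (fun i => ⟪p.f, φ (v i)⟫) = t := by
    intro V _ v φ t h
    funext i
    rw [h, p.inner_smul_f]
  have an : ∀ {V : Type} [Fintype V] (v : σ → V) (q : MvPolynomial σ ℝ) (φ : V → Rn n),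
      AnalyticAt ℝ (fun φ : V → Rn n =>
        MvPolynomial.eval (fun i => ⟪p.f, φ (v i)⟫) q • p.f) φ := by
    intro V _ v q φ
    refine AnalyticAt.fun_smul ?_ analyticAt_const
    have := AnalyticAt.aeval_mvPolynomial (𝕜 := ℝ) (A := ℝ) (B := ℝ)
      (f := fun (φ : V → Rn n) i => ⟪p.f, φ (v i)⟫) (fun i => analyticAt_coord p.f (v i) φ) q
    simpa [MvPolynomial.aeval_eq_eval] using this
  induction q using MvPolynomial.induction_on with
  | C a =>
    intro V _ v z R hR
    refine (eq_const z (a • p.f)).mono ?_ ?_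
    · intro φ h t _
      rw [MvPolynomial.eval_C]; exact h
    · rintro φ ⟨t, -, -, h⟩
      rwa [MvPolynomial.eval_C] at h
  | add q₁ q₂ ih₁ ih₂ =>
    intro V _ v z R hR
    obtain ⟨M₁, hM₁, hb₁⟩ := exists_bound_eval q₁ R
    obtain ⟨M₂, hM₂, hb₂⟩ := exists_bound_eval q₂ R
    have h := exists_fun (n := n) (V := V) (U := Fin 2)
      (X₁ := {φ | ∃ t : σ → ℝ, (∀ i, |t i| < R) ∧ (∀ i, φ (v i) = t i • p.f) ∧
        φ z = MvPolynomial.eval t (q₁ + q₂) • p.f})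
      (fun φ => ![MvPolynomial.eval (fun i => ⟪p.f, φ (v i)⟫) q₁ • p.f,
        MvPolynomial.eval (fun i => ⟪p.f, φ (v i)⟫) q₂ • p.f])
      ((ih₁ (fun i => .inl (v i)) (.inr 0) hR).and <|
        (ih₂ (fun i => .inl (v i)) (.inr 1) hR).and <|
        add_eq p (.inr 0) (.inr 1) (.inl z) (show 0 < M₁ + M₂ by positivity)) ?_ ?_ ?_
    · refine h.mono ?_ subset_rfl
      rintro φ ⟨u, h1, h2, h3⟩ t ht
      have e1 := h1 t ht
      have e2 := h2 t ht
      simp only [Set.mem_ofPred_eq, Sum.elim_inl, Sum.elim_inr] at e1 e2 h3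
      rw [h3, e1, e2, map_add, add_smul]
    · rintro φ ⟨t, hR, ht, hz⟩
      simp only [coords v φ t ht]
      refine ⟨⟨t, hR, ht, rfl⟩, ⟨t, hR, ht, rfl⟩, ?_, ?_, ?_⟩
      · change ‖MvPolynomial.eval t q₁ • p.f‖ < _
        rw [p.norm_smul_f]; linarith [hb₁ t hR]
      · change ‖MvPolynomial.eval t q₂ • p.f‖ < _
        rw [p.norm_smul_f]; linarith [hb₂ t hR]
      · change φ z = MvPolynomial.eval t q₁ • p.f + MvPolynomial.eval t q₂ • p.f
        rw [hz, map_add, add_smul]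
    · rintro φ ⟨t, hR, ht, hz⟩ u ⟨h1, h2, -⟩
      simp only [coords v φ t ht]
      funext i
      fin_cases i
      · exact h1 t ht
      · exact h2 t ht
    · rintro i φ -
      fin_cases i
      · exact an v q₁ φ
      · exact an v q₂ φ
  | mul_X q j ih =>
    intro V _ v z R hR
    obtain ⟨M, hM, hb⟩ := exists_bound_eval q R
    have h := exists_fun (n := n) (V := V) (U := Unit)
      (X₁ := {φ | ∃ t : σ → ℝ, (∀ i, |t i| < R) ∧ (∀ i, φ (v i) = t i • p.f) ∧
        φ z = MvPolynomial.eval t (q * MvPolynomial.X j) • p.f})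
      (fun φ _ => MvPolynomial.eval (fun i => ⟪p.f, φ (v i)⟫) q • p.f)
      ((ih (fun i => .inl (v i)) (.inr ()) hR).and <|
        mul_eq p (.inr ()) (.inl (v j)) (.inl z) (show 0 < M + R by positivity)) ?_ ?_ ?_
    · refine h.mono ?_ subset_rfl
      rintro φ ⟨u, h1, h2⟩ t ht
      have e1 := h2 _ _ (h1 t ht) (ht j)
      rwa [map_mul, MvPolynomial.eval_X]
    · rintro φ ⟨t, hR', ht, hz⟩
      simp only [coords v φ t ht]
      refine ⟨⟨t, hR', ht, rfl⟩, _, _, ?_, ?_, rfl, ht j, ?_⟩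
      · linarith [hb t hR']
      · linarith [hR' j]
      · rwa [map_mul, MvPolynomial.eval_X] at hz
    · rintro φ ⟨t, hR, ht, hz⟩ u ⟨h1, -⟩
      simp only [coords v φ t ht]
      funext i
      exact h1 t ht
    · rintro i φ -
      exact an v q φ

variable {n : ℕ} {V : Type} [Fintype V]

/-- An edge cannot have length zero, so equality is expressed as `a = b + 0`. -/
lemma eq_vertex (p : OrthoPair n) (a b : V) {R : ℝ} (hR : 0 < R) :
    Definable {φ : V → Rn n | φ a = φ b} {φ | ‖φ b‖ < R ∧ φ a = φ b} := by
  have h := exists_fun (n := n) (V := V) (U := Unit) (X₁ := {φ | ‖φ b‖ < R ∧ φ a = φ b})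
    (fun _ _ => 0) ((eq_const (.inr ()) 0).and (add_eq p (.inl b) (.inr ()) (.inl a) hR)) ?_ ?_ ?_
  · refine h.mono ?_ subset_rfl
    rintro φ ⟨u, h1, h2⟩
    simp only [Set.mem_ofPred_eq, Sum.elim_inl, Sum.elim_inr] at *
    rw [h2, h1, add_zero]
  · rintro φ ⟨h1, h2⟩
    refine ⟨rfl, h1, ?_, ?_⟩
    · change ‖(0 : Rn n)‖ < R
      rwa [norm_zero]
    · change φ a = φ b + 0
      rw [h2, add_zero]
  · rintro φ - u ⟨h1, -⟩
    funext i
    exact h1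
  · rintro i φ -
    exact analyticAt_const

/-- Finite sums. -/
lemma sum_eq (p : OrthoPair n) {ι : Type} (s : Finset ι) :
    ∀ {V : Type} [Fintype V] (v : ι → V) (z : V) {R : ℝ}, 0 < R →
    Definable {φ : V → Rn n | φ z = ∑ i ∈ s, φ (v i)}
      {φ | (∀ i ∈ s, ‖φ (v i)‖ < R) ∧ φ z = ∑ i ∈ s, φ (v i)} := by
  classical
  induction s using Finset.induction_on with
  | empty =>
    intro V _ v z R hR
    refine (eq_const z 0).mono ?_ ?_
    · intro φ h
      simpa using h
    · rintro φ ⟨-, h⟩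
      simpa using h
  | insert j s hj ih =>
    intro V _ v z R hR
    have h := exists_fun (n := n) (V := V) (U := Unit)
      (X₁ := {φ | (∀ i ∈ insert j s, ‖φ (v i)‖ < R) ∧ φ z = ∑ i ∈ insert j s, φ (v i)})
      (fun φ _ => ∑ i ∈ s, φ (v i))
      ((ih (fun i => .inl (v i)) (.inr ()) hR).and
        (add_eq p (.inl (v j)) (.inr ()) (.inl z) (show 0 < R + s.card * R by positivity))) ?_ ?_ ?_
    · refine h.mono ?_ subset_rfl
      rintro φ ⟨u, h1, h2⟩
      simp only [Set.mem_ofPred_eq, Sum.elim_inl, Sum.elim_inr] at *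
      rw [h2, h1, Finset.sum_insert hj]
    · rintro φ ⟨h1, h2⟩
      have h1' : ∀ i ∈ s, ‖φ (v i)‖ < R := fun i hi => h1 i (Finset.mem_insert_of_mem hi)
      have hj' := h1 j (Finset.mem_insert_self j s)
      have hsum : ‖∑ i ∈ s, φ (v i)‖ ≤ s.card * R := by
        refine (norm_sum_le _ _).trans ?_
        rw [← nsmul_eq_mul]
        exact Finset.sum_le_card_nsmul _ _ _ fun i hi => (h1' i hi).le
      refine ⟨⟨h1', rfl⟩, ?_, ?_, ?_⟩
      · change ‖φ (v j)‖ < _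
        have : 0 ≤ s.card * R := by positivity
        linarith
      · change ‖∑ i ∈ s, φ (v i)‖ < _
        linarith
      · change φ z = φ (v j) + ∑ i ∈ s, φ (v i)
        rw [h2, Finset.sum_insert hj]
    · rintro φ - u ⟨h1, -⟩
      funext i
      exact h1
    · rintro i φ -
      exact Finset.analyticAt_fun_sum _ fun i _ => analyticAt_eval (v i) φ

end Definable

/-- The pair formed by two distinct standard basis vectors. -/
noncomputable def stdPair {n : ℕ} (i j : Fin n) (h : i ≠ j) : OrthoPair n where
  e := stdVec i
  f := stdVec j
  e_unit := by rw [inner_stdVec]; simp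
  f_unit := by rw [inner_stdVec]; simp
  orth := by rw [inner_stdVec]; simp [h.symm]

/-- The pair formed by the normalized sum and difference of two standard basis vectors. -/
noncomputable def diagPair {n : ℕ} (i j : Fin n) (h : i ≠ j) : OrthoPair n where
  e := (√2)⁻¹ • (stdVec i + stdVec j)
  f := (√2)⁻¹ • (stdVec i - stdVec j)
  e_unit := by
    rw [inner_smul_left, inner_smul_right, inner_add_right, inner_stdVec, inner_stdVec]
    simp only [conj_trivial, ← mul_assoc, ← mul_inv, Real.mul_self_sqrt zero_le_two]
    simp [h, h.symm]; norm_num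
  f_unit := by
    rw [inner_smul_left, inner_smul_right, inner_sub_right, inner_stdVec, inner_stdVec]
    simp only [conj_trivial, ← mul_assoc, ← mul_inv, Real.mul_self_sqrt zero_le_two]
    simp [h, h.symm]; norm_num
  orth := by
    rw [inner_smul_left, inner_smul_right, inner_sub_right, inner_stdVec, inner_stdVec]
    simp [h, h.symm]

namespace Definable

variable {n : ℕ} {V : Type} [Fintype V]

/-- Equality of a coordinate on the `i`-th axis and a coordinate on the `j`-th axis. -/
lemma axes_eq (i j : Fin n) (hij : i ≠ j) (a b : V) {R : ℝ} (hR : 0 < R) :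
    Definable {φ : V → Rn n | ∃ t : ℝ, φ a = t • stdVec i ∧ φ b = t • stdVec j}
      {φ | ∃ t : ℝ, |t| < R ∧ φ a = t • stdVec i ∧ φ b = t • stdVec j} := by
  have key : ∀ (φ : V → Rn n) (t : ℝ), φ a = t • stdVec i → φ b = t • stdVec j →
      φ a - φ b = (√2 * t) • (diagPair i j hij).f := by
    intro φ t h1 h2
    rw [h1, h2, diagPair, smul_smul, mul_right_comm, mul_inv_cancel₀ (by positivity)]
    module
  have nb : ∀ (k : Fin n) (t : ℝ), ‖t • stdVec k‖ = |t| := by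
    intro k t
    rw [norm_smul]; simp
  have h2 : √2 < 2 := by
    rw [Real.sqrt_lt' two_pos]; norm_num
  -- The points lie on their two axes, and their difference is held on the line spanned by `e_i -
  -- e_j`, which forces equal coordinates.
  have h := exists_fun (n := n) (V := V) (U := Unit)
    (X₁ := {φ | ∃ t : ℝ, |t| < R ∧ φ a = t • stdVec i ∧ φ b = t • stdVec j})
    (fun φ _ => φ a - φ b)
    ((line (stdPair j i hij.symm) (.inl a) hR).and <| (line (stdPair i j hij) (.inl b) hR).and <|
      (line (diagPair i j hij) (.inr ()) (show 0 < 2 * R by positivity)).and <|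
      add_eq (stdPair i j hij) (.inr ()) (.inl b) (.inl a) (show 0 < 2 * R by positivity)) ?_ ?_ ?_
  · refine h.mono ?_ subset_rfl
    rintro φ ⟨u, ⟨s, h1⟩, ⟨t, h2⟩, ⟨r, h3⟩, h4⟩
    simp only [Set.mem_ofPred_eq, Sum.elim_inl, Sum.elim_inr] at *
    have h1 : φ a = s • stdVec i := h1
    have h2 : φ b = t • stdVec j := h2
    rw [h1, h2, h3] at h4
    have ei := congrArg (fun v : Rn n => v i) h4
    have ej := congrArg (fun v : Rn n => v j) h4
    simp [diagPair, hij, hij.symm] at ei ej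
    refine ⟨s, h1, ?_⟩
    rw [h2, show t = s by linarith]
  · rintro φ ⟨t, ht, h1, h3⟩
    refine ⟨⟨t, ht, h1⟩, ⟨t, ht, h3⟩, ⟨√2 * t, ?_, key φ t h1 h3⟩, ?_, ?_, ?_⟩
    · rw [abs_mul, abs_of_pos (by positivity)]
      exact mul_lt_mul'' h2 ht (by positivity) (abs_nonneg _)
    · change ‖φ a - φ b‖ < _
      refine (norm_sub_le _ _).trans_lt ?_
      rw [h1, h3, nb, nb]; linarith
    · change ‖φ b‖ < _
      rw [h3, nb]; linarith
    · change φ a = φ a - φ b + φ b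
      abel
  · rintro φ - u ⟨-, -, -, h1⟩
    funext x
    exact eq_sub_of_add_eq (Eq.symm h1)
  · rintro x φ -
    exact (analyticAt_eval a φ).fun_sub (analyticAt_eval b φ)

/-- Compact real algebraic sets are definable. -/
lemma of_isRealAlgebraic {k : ℕ} (hn : 2 ≤ n) {Z : Set (Fin k → Rn n)} (hc : IsCompact Z)
    (ha : IsRealAlgebraic Z) : Definable Z Z := by
  obtain ⟨S, hS⟩ := ha
  -- Hilbert's basis theorem: the system must be finite, so finitely many polynomials have to
  -- suffice.
  obtain ⟨T, hT⟩ := (inferInstance : IsNoetherianRing (MvPolynomial (Fin k × Fin n) ℝ)).noetherian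
    (Ideal.span S)
  have hZ : ∀ x : Fin k → Rn n, (∀ q ∈ T, MvPolynomial.eval (configCoord x) q = 0) → x ∈ Z := by
    intro x hx
    rw [hS]
    intro q hq
    have h1 : q ∈ Ideal.span (T : Set (MvPolynomial (Fin k × Fin n) ℝ)) := by
      rw [show Ideal.span (T : Set (MvPolynomial (Fin k × Fin n) ℝ)) = Ideal.span S from hT]
      exact Ideal.subset_span hq
    have h2 : Ideal.span (T : Set (MvPolynomial (Fin k × Fin n) ℝ)) ≤
        RingHom.ker (MvPolynomial.eval (configCoord x)) := Ideal.span_le.2 hx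
    exact h2 h1
  have hZ' : ∀ x ∈ Z, ∀ q ∈ T, MvPolynomial.eval (configCoord x) q = 0 := by
    intro x hx q hq
    rw [hS] at hx
    have h2 : Ideal.span S ≤ RingHom.ker (MvPolynomial.eval (configCoord x)) := Ideal.span_le.2 hx
    exact h2 (by rw [← hT]; exact Ideal.subset_span hq)
  obtain ⟨R, hR, hb⟩ : ∃ R, 0 < R ∧ ∀ x ∈ Z, ∀ j i, |x j i| < R := by
    obtain ⟨C, hC⟩ := hc.isBounded.exists_norm_le
    refine ⟨|C| + 1, by positivity, fun x hx j i => ?_⟩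
    have h1 := norm_le_pi_norm x j
    have h2 := EuclideanSpace.norm_eq (x j)
    have h3 : |x j i| ≤ ‖x j‖ := by
      rw [← inner_stdVec]
      simpa using abs_real_inner_le_norm (x j) (stdVec i)
    linarith [hC x hx, le_abs_self C]
  let i0 : Fin n := ⟨0, by omega⟩
  let i1 : Fin n := ⟨1, by omega⟩
  have h10 : i1 ≠ i0 := by simp [i0, i1]
  let p := stdPair i1 i0 h10
  have nb : ∀ (k : Fin n) (t : ℝ), ‖t • stdVec k‖ = |t| := by
    intro k t
    rw [norm_smul]; simp
  -- Each coordinate appears on its own axis and again on the axis of `i0`, where all arithmetic is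
  -- done. The last vertex, held at the origin, is the common output of the polynomials.
  let U := (Fin k × Fin n) ⊕ (Fin k × Fin n) ⊕ Unit
  let Y : (Fin k → Rn n) → U → Rn n := fun x =>
    Sum.elim (fun a => x a.1 a.2 • stdVec a.2) (Sum.elim (fun a => x a.1 a.2 • stdVec i0) fun _ => 0)
  have hY : ∀ a, AnalyticOnNhd ℝ (fun x => Y x a) Z := by
    have c : ∀ (j i) (x : Fin k → Rn n), AnalyticAt ℝ (fun x : Fin k → Rn n => x j i) x := by
      intro j i x
      have := analyticAt_coord (stdVec i) j x
      simpa only [real_inner_comm, inner_stdVec] using this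
    rintro (a | a | a) x -
    · exact (c _ _ x).fun_smul analyticAt_const
    · exact (c _ _ x).fun_smul analyticAt_const
    · exact analyticAt_const
  have axes : ∀ a : Fin k × Fin n, Definable
      {φ : Fin k ⊕ U → Rn n | ∃ t : ℝ, φ (.inr (.inl a)) = t • stdVec a.2 ∧
        φ (.inr (.inr (.inl a))) = t • stdVec i0}
      {φ | ∃ t : ℝ, |t| < R ∧ φ (.inr (.inl a)) = t • stdVec a.2 ∧
        φ (.inr (.inr (.inl a))) = t • stdVec i0} := by
    intro a
    -- `axes_eq` needs two different axes; on the axis of `i0` the copy is an equal vertex.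
    by_cases h : a.2 = i0
    · refine ((line p (.inr (.inl a)) hR).and
        (eq_vertex p (.inr (.inr (.inl a))) (.inr (.inl a)) hR)).mono ?_ ?_
      · rintro φ ⟨⟨t, h1⟩, h2⟩
        have h1 : φ (.inr (.inl a)) = t • stdVec i0 := h1
        exact ⟨t, by rwa [h], by rw [← h1]; exact h2⟩
      · rintro φ ⟨t, ht, h1, h2⟩
        rw [h] at h1
        refine ⟨⟨t, ht, h1⟩, ?_, ?_⟩
        · rwa [h1, nb]
        · rw [h1, h2]
    · exact axes_eq a.2 i0 h _ _ hR
  have hdef := exists_fun (n := n) (V := Fin k) (U := U) (X₁ := Z) Y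
    ((all axes).and <|
      (all fun j : Fin k => sum_eq p Finset.univ (fun i : Fin n => (.inr (.inl (j, i)))) (.inl j)
        hR).and <|
      (eq_const (.inr (.inr (.inr ()))) 0).and <|
      all fun q : T => eval_eq p q.1 (fun a => .inr (.inr (.inl a))) (.inr (.inr (.inr ()))) hR)
    ?_ ?_ hY
  · refine hdef.mono ?_ subset_rfl
    rintro φ ⟨u, h1, h2, h3, h4⟩
    choose t h5 h6 using h1
    have h7 : ∀ j i, φ j i = t (j, i) := by
      intro j i
      have := congrArg (fun v : Rn n => v i) (h2 j)
      simp only [Sum.elim_inl, h5] at this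
      rw [this]
      simp [Finset.sum_apply, Pi.single_apply]
    refine hZ φ fun q hq => ?_
    have h8 := h4 ⟨q, hq⟩ t h6
    simp only [Set.mem_ofPred_eq] at h3
    rw [h3] at h8
    have h9 : configCoord φ = t := funext fun a => h7 a.1 a.2
    rw [h9]
    exact ((smul_eq_zero.1 h8.symm).resolve_right p.f_ne_zero)
  · intro x hx
    refine ⟨fun a => ⟨x a.1 a.2, hb x hx _ _, rfl, rfl⟩, fun j => ⟨fun i _ => ?_, ?_⟩, rfl,
      fun q => ⟨configCoord x, fun a => hb x hx _ _, fun a => rfl, ?_⟩⟩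
    · change ‖x j i • stdVec i‖ < R
      rw [nb]
      exact hb x hx _ _
    · change x j = ∑ i, x j i • stdVec i
      ext i
      simp [Finset.sum_apply, Pi.single_apply]
    · rw [hZ' x hx q.1 q.2, zero_smul]
      rfl
  · rintro x hx u ⟨h1, h2, h3, h4⟩
    choose t h5 h6 using h1
    have h7 : ∀ j i, x j i = t (j, i) := by
      intro j i
      have := congrArg (fun v : Rn n => v i) (h2 j)
      simp only [Sum.elim_inl, h5] at this
      rw [this]
      simp [Finset.sum_apply, Pi.single_apply]
    funext a
    rcases a with a | a | a
    · change _ = x a.1 a.2 • stdVec a.2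
      rw [h7]; exact h5 a
    · change _ = x a.1 a.2 • stdVec i0
      rw [h7]; exact h6 a
    · exact h3

end Definable

/-! ### From definable sets to linkages. -/

/-- The linkage whose edges join the pairs related by `Adj` and distinct in the configuration
`φ₀`, with lengths and fixed points taken from `φ₀`. -/
noncomputable def linkageOf {n : ℕ} {V : Type} (φ₀ : V → Rn n) (Adj : V → V → Prop)
    (fixed : Set V) : ClassicalLinkage n V where
  graph :=
    -- Pairs that coincide in `φ₀` get no edge, since lengths must be positive; an application has
    -- to make sure that no needed edge is lost.
    { Adj := fun v w => (Adj v w ∨ Adj w v) ∧ φ₀ v ≠ φ₀ w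
      symm := ⟨fun _ _ h => ⟨h.1.symm, h.2.symm⟩⟩
      loopless := ⟨fun _ h => h.2 rfl⟩ }
  len e := Sym2.lift ⟨fun v w => ‖φ₀ v - φ₀ w‖, fun v w => norm_sub_rev _ _⟩ e.1
  len_pos := by
    rintro ⟨e, he⟩
    induction e using Sym2.ind with
    | _ v w => exact norm_pos_iff.2 (sub_ne_zero.2 he.2)
  fixed := fixed
  pos v := φ₀ v

lemma mem_config_linkageOf {n : ℕ} {V : Type} (φ₀ : V → Rn n) (Adj : V → V → Prop)
    (fixed : Set V) (φ : V → Rn n) : φ ∈ (linkageOf φ₀ Adj fixed).config ↔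
      (∀ v ∈ fixed, φ v = φ₀ v) ∧
        ∀ v w, Adj v w → φ₀ v ≠ φ₀ w → ‖φ v - φ w‖ = ‖φ₀ v - φ₀ w‖ := by
  constructor
  · rintro ⟨h1, h2⟩
    exact ⟨fun v hv => h1 ⟨v, hv⟩, fun v w h h' => h2 v w ⟨Or.inl h, h'⟩⟩
  · rintro ⟨h1, h2⟩
    refine ⟨fun v => h1 v.1 v.2, ?_⟩
    rintro v w ⟨h | h, h'⟩
    · exact h2 v w h h'
    · rw [norm_sub_rev, h2 w v h h'.symm, norm_sub_rev]
      rfl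

/-- A linkage with bounded nonempty configuration space is connected if its fixed vertices lie in
one component. -/
lemma connected_of_isBounded {n : ℕ} (hn : 0 < n) {V : Type} [Fintype V] (L : ClassicalLinkage n V)
    (hb : Bornology.IsBounded L.config) (hne : L.config.Nonempty) (a : V)
    (ha : ∀ v ∈ L.fixed, L.graph.Reachable a v) : L.graph.Connected := by
  classical
  rw [SimpleGraph.connected_iff_exists_forall_reachable]
  refine ⟨a, fun v => ?_⟩
  by_contra hv
  obtain ⟨φ, h1, h2⟩ := hne
  -- Vertices outside the component of `a` can be translated together by any vector, which
  -- contradicts boundedness.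
  have key : ∀ c : Rn n, (fun u => if L.graph.Reachable a u then φ u else φ u + c) ∈ L.config := by
    intro c
    refine ⟨fun u => ?_, fun u w h => ?_⟩
    · simp only [if_pos (ha u u.2)]
      exact h1 u
    · have : L.graph.Reachable a u ↔ L.graph.Reachable a w :=
        ⟨fun h' => h'.trans h.reachable, fun h' => h'.trans h.symm.reachable⟩
      rw [← h2 u w h]
      by_cases hu : L.graph.Reachable a u
      · simp only [if_pos hu, if_pos (this.1 hu)]
      · simp only [if_neg hu, if_neg (fun h' => hu (this.2 h')), add_sub_add_right_eq_sub]
  obtain ⟨C, hC⟩ := hb.exists_norm_le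
  have hC' : ∀ c : Rn n, ‖φ v + c‖ ≤ C := by
    intro c
    have := (norm_le_pi_norm _ v).trans (hC _ (key c))
    simpa only [if_neg hv] using this
  have := hC' (-φ v + (|C| + 1) • stdVec ⟨0, hn⟩)
  rw [add_neg_cancel_left, norm_smul, PiLp.norm_single] at this
  simp only [Real.norm_eq_abs, norm_one, mul_one] at this
  rw [abs_of_pos (by positivity)] at this
  linarith [le_abs_self C]

/-- The standard frame: the origin and the standard basis vectors. -/
noncomputable def stdFrame (n : ℕ) : Fin (n + 1) → Rn n := Fin.cases 0 stdVec

@[simp] lemma stdFrame_zero (n : ℕ) : stdFrame n 0 = 0 := rfl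

@[simp] lemma stdFrame_succ {n : ℕ} (i : Fin n) : stdFrame n i.succ = stdVec i := rfl

lemma inner_eq_of_dist {n : ℕ} {x y e : Rn n} (h0 : ‖x‖ = ‖y‖) (h : ‖x - e‖ = ‖y - e‖) :
    ⟪x, e⟫ = ⟪y, e⟫ := by
  have h1 := norm_sub_sq_real x e
  have h2 := norm_sub_sq_real y e
  rw [h, h0] at h1
  linarith

/-- The distances to the origin and to `e_i` determine the `i`-th coordinate. -/
lemma eq_of_dist_stdFrame {n : ℕ} {x y : Rn n}
    (h : ∀ i, ‖x - stdFrame n i‖ = ‖y - stdFrame n i‖) : x = y := by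
  have h0 : ‖x‖ = ‖y‖ := by simpa using h 0
  ext i
  have := inner_eq_of_dist h0 (h i.succ)
  rwa [stdFrame_succ, inner_stdVec, inner_stdVec] at this

lemma euc_dist {n : ℕ} (g : Euc n) (x y : Rn n) : ‖g x - g y‖ = ‖x - y‖ := by
  rw [← dist_eq_norm, ← dist_eq_norm, g.dist_map]

lemma euc_mul_apply {n : ℕ} (g h : Euc n) (x : Rn n) : (g * h) x = g (h x) := rfl

lemma euc_inv_apply_self {n : ℕ} (g : Euc n) (x : Rn n) : g⁻¹ (g x) = x := g.symm_apply_apply x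

lemma euc_apply_inv_self {n : ℕ} (g : Euc n) (x : Rn n) : g (g⁻¹ x) = x := g.apply_symm_apply x

lemma eq_of_dist_frame {n : ℕ} (β : Euc n) {x y : Rn n}
    (h : ∀ i, ‖x - β (stdFrame n i)‖ = ‖y - β (stdFrame n i)‖) : x = y := by
  have key : β⁻¹ x = β⁻¹ y := eq_of_dist_stdFrame fun i => by
    rw [← euc_dist β, euc_apply_inv_self, h, ← euc_dist β (β⁻¹ y), euc_apply_inv_self]
  rw [← euc_apply_inv_self β x, key, euc_apply_inv_self]

lemma euc_eq_of_frame {n : ℕ} (β : Euc n) {g h : Euc n}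
    (H : ∀ i, g (β (stdFrame n i)) = h (β (stdFrame n i))) : g = h := by
  ext1 x
  have key : h⁻¹ (g x) = x := eq_of_dist_frame β fun i => by
    rw [← euc_dist h, euc_apply_inv_self, ← H, euc_dist]
  rw [← euc_apply_inv_self h (g x), key]

lemma stdFrame_injective (n : ℕ) : Function.Injective (stdFrame n) := by
  have hne : ∀ i : Fin n, stdVec i ≠ (0 : Rn n) := fun i h => by
    simpa using congrArg (fun v : Rn n => v i) h
  intro i j h
  induction i using Fin.cases with
  | zero =>
    induction j using Fin.cases with
    | zero => rfl
    | succ j => exact absurd h.symm (hne j)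
  | succ i =>
    induction j using Fin.cases with
    | zero => exact absurd h (hne i)
    | succ j =>
      by_contra hij
      have hij' : i ≠ j := fun h' => hij (by rw [h'])
      have := congrArg (fun v : Rn n => v i) h
      simp [hij'] at this

/-- Two congruent frames differ by a Euclidean motion. -/
lemma exists_euc_of_congruent {n : ℕ} (Q : Fin (n + 1) → Rn n)
    (h : ∀ i j, ‖Q i - Q j‖ = ‖stdFrame n i - stdFrame n j‖) :
    ∃ g : Euc n, ∀ i, g (stdFrame n i) = Q i := by
  let u : Fin n → Rn n := fun i => Q i.succ - Q 0
  have hu1 : ∀ i, ‖u i‖ = 1 := fun i => by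
    have := h i.succ 0
    simpa [u] using this
  have hu : Orthonormal ℝ u := by
    refine ⟨hu1, fun i j hij => ?_⟩
    have h1 := h i.succ j.succ
    rw [stdFrame_succ, stdFrame_succ, show Q i.succ - Q j.succ = u i - u j by simp [u]] at h1
    have h2 := norm_sub_sq_real (u i) (u j)
    have h3 := norm_sub_sq_real (stdVec i) (stdVec j)
    rw [inner_stdVec] at h3
    rw [h1, hu1, hu1] at h2
    simp [hij.symm] at h3
    simp only [h3] at h2
    linarith
  have hsp : ⊤ ≤ Submodule.span ℝ (Set.range u) := by
    refine (hu.linearIndependent.span_eq_top_of_card_eq_finrank' ?_).ge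
    simp
  let b := OrthonormalBasis.mk hu hsp
  refine ⟨(b.repr.symm.toAffineIsometryEquiv).trans (AffineIsometryEquiv.constVAdd ℝ _ (Q 0)), ?_⟩
  intro i
  induction i using Fin.cases with
  | zero => simp
  | succ i =>
    change Q 0 + b.repr.symm (stdVec i) = Q i.succ
    rw [OrthonormalBasis.repr_symm_single, OrthonormalBasis.coe_mk]
    simp [u]

/-- The motions fixing the first `M` points of the frame `β (stdFrame n)`. -/
lemma mem_conj_orthSubgroup {n j : ℕ} (hj : j ≤ n) (β g : Euc n) :
    g ∈ (orthSubgroup n j).map (MulAut.conj β).toMonoidHom ↔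
      ∀ i : Fin (n + 1), (i : ℕ) < n + 1 - j → g (β (stdFrame n i)) = β (stdFrame n i) := by
  have h1 : g ∈ (orthSubgroup n j).map (MulAut.conj β).toMonoidHom ↔
      β⁻¹ * g * β ∈ orthSubgroup n j := by
    rw [Subgroup.mem_map]
    constructor
    · rintro ⟨h, hh, rfl⟩
      have : β⁻¹ * (MulAut.conj β).toMonoidHom h * β = h := by
        simp [mul_assoc]
      rwa [this]
    · intro h
      exact ⟨_, h, by simp [mul_assoc]⟩
  have h2 : ∀ x, (β⁻¹ * g * β) x = x ↔ g (β x) = β x := by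
    intro x
    rw [euc_mul_apply, euc_mul_apply]
    constructor
    · intro h
      rw [← euc_apply_inv_self β (g (β x)), h]
    · intro h
      rw [h, euc_inv_apply_self]
  rw [h1]
  constructor
  · rintro ⟨h3, h4⟩ i hi
    induction i using Fin.cases with
    | zero => exact (h2 _).1 h3
    | succ i => exact (h2 _).1 (h4 i (by rw [Fin.val_succ] at hi; omega))
  · intro h
    refine ⟨(h2 _).2 (h 0 (by simp; omega)), fun i hi => (h2 _).2 (h i.succ ?_)⟩
    rw [Fin.val_succ]; omega

/-- A definable set is realized by a linkage; freeing all but the first `M` points of a frame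
sweeps its configurations by the motions fixing these points. -/
lemma exists_linkage_of_definable {n k : ℕ} (hn : 0 < n) {Z : Set (Fin k → Rn n)}
    (hne : Z.Nonempty) (hd : Definable Z Z) (β : Euc n) (M : ℕ) :
    ∃ (m : ℕ) (L : ClassicalLinkage n (Fin k ⊕ Fin m)) (Φ : Type) (_ : Finite Φ) (_ : Nonempty Φ)
      (α : Φ → (Fin k → Rn n) → Fin m → Rn n) (idx : Fin (n + 1) → Fin m),
      Function.Injective idx ∧
      L.fixed = {v | ∃ i : Fin (n + 1), (i : ℕ) < M ∧ v = .inr (idx i)} ∧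
      (∀ (v : L.fixed) (i : Fin (n + 1)), v.1 = .inr (idx i) → L.pos v = β (stdFrame n i)) ∧
      (∀ f x i, α f x (idx i) = β (stdFrame n i)) ∧
      (∀ f a, AnalyticOnNhd ℝ (fun x => α f x a) Z) ∧
      (∀ x ∈ Z, Function.Injective fun f => α f x) ∧
      L.config = {φ | ∃ g : Euc n, (∀ i : Fin (n + 1), (i : ℕ) < M →
        g (β (stdFrame n i)) = β (stdFrame n i)) ∧
        ∃ x ∈ Z, ∃ f, φ = diagAct g (Sum.elim x (α f x))} ∧
      (Bornology.IsBounded L.config → L.graph.Connected) := by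
  classical
  obtain ⟨W, iW, S, Φ, iΦ, nΦ, w, h1, h2, h3, h4⟩ := hd
  have := S.finite
  obtain ⟨iK⟩ := nonempty_fintype S.K
  obtain ⟨x₀, hx₀⟩ := hne
  obtain ⟨f₀⟩ := nΦ
  -- Besides the auxiliary variables there are two vertices per constraint for its possible
  -- constants (an unused one sits at the origin), a translated frame `Q` and the frame `P`.
  let A := W ⊕ (S.K ⊕ S.K) ⊕ (Fin (n + 1) ⊕ Fin (n + 1))
  let cst : S.K ⊕ S.K → Rn n := Sum.elim (fun c => Sum.elim (fun _ => 0) id (S.src c))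
    (fun c => Sum.elim (fun _ => 0) id (S.dst c))
  let P : Fin (n + 1) → Rn n := fun i => β (stdFrame n i)
  have hPinj : Function.Injective P := β.injective.comp (stdFrame_injective n)
  -- A constant may coincide with a frame point, and their edge would be missing. The constants are
  -- therefore braced to a translate of the frame by a generic vector, and this translate is braced
  -- to the frame.
  obtain ⟨v₀, hv1, hv2⟩ : ∃ v₀ : Rn n, (∀ c i, cst c ≠ P i + v₀) ∧ ∀ i j, P i + v₀ ≠ P j := by
    have : Nonempty (Fin n) := ⟨⟨0, hn⟩⟩
    have hfin : (Set.range (fun q : (S.K ⊕ S.K) × Fin (n + 1) => cst q.1 - P q.2) ∪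
        Set.range (fun q : Fin (n + 1) × Fin (n + 1) => P q.1 - P q.2)).Finite :=
      (Set.finite_range _).union (Set.finite_range _)
    have : Infinite (Rn n) := Module.Free.infinite ℝ (Rn n)
    obtain ⟨v₀, hv⟩ := hfin.exists_notMem
    refine ⟨v₀, fun c i h => hv (Or.inl ⟨(c, i), ?_⟩), fun i j h => hv (Or.inr ⟨(j, i), ?_⟩)⟩
    · change cst c - P i = v₀
      rw [h]; abel
    · change P j - P i = v₀
      rw [← h]; abel
  let Q : Fin (n + 1) → Rn n := fun i => P i + v₀
  let full : Φ → (Fin k → Rn n) → A → Rn n := fun f x =>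
    Sum.elim (w f x) (Sum.elim cst (Sum.elim Q P))
  let vC : S.K ⊕ S.K → Fin k ⊕ A := fun c => .inr (.inr (.inl c))
  let vQ : Fin (n + 1) → Fin k ⊕ A := fun i => .inr (.inr (.inr (.inl i)))
  let vP : Fin (n + 1) → Fin k ⊕ A := fun i => .inr (.inr (.inr (.inr i)))
  let vs : S.K → Fin k ⊕ A := fun c => Sum.elim (Sum.map id Sum.inl) (fun _ => vC (.inl c)) (S.src c)
  let vd : S.K → Fin k ⊕ A := fun c => Sum.elim (Sum.map id Sum.inl) (fun _ => vC (.inr c)) (S.dst c)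
  let Adj : Fin k ⊕ A → Fin k ⊕ A → Prop := fun a b => (∃ c, a = vs c ∧ b = vd c) ∨
    (∃ c i, a = vC c ∧ b = vQ i) ∨ (∃ i j, a = vQ i ∧ b = vP j) ∨ (∃ i j, a = vP i ∧ b = vP j)
  have hvs : ∀ χ : Fin k ⊕ A → Rn n, (∀ c, χ (vC c) = cst c) → ∀ c,
      χ (vs c) = Sum.elim (χ ∘ Sum.map id Sum.inl) id (S.src c) ∧
      χ (vd c) = Sum.elim (χ ∘ Sum.map id Sum.inl) id (S.dst c) := by
    intro χ hχ c
    have e1 := hχ (.inl c)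
    have e2 := hχ (.inr c)
    simp only [cst, Sum.elim_inl, Sum.elim_inr] at e1 e2
    constructor
    · rcases hs : S.src c with a | a
      · simp only [vs, hs]; rfl
      · simp only [vs, hs, Sum.elim_inr] at e1 ⊢
        exact e1
    · rcases hs : S.dst c with a | a
      · simp only [vd, hs]; rfl
      · simp only [vd, hs, Sum.elim_inr] at e2 ⊢
        exact e2
  have hcomp : ∀ f x, (Sum.elim x (full f x) : Fin k ⊕ A → Rn n) ∘ Sum.map id Sum.inl =
      Sum.elim x (w f x) := by
    intro f x
    ext (a | a) : 1 <;> rfl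
  have hlen : ∀ f, ∀ x ∈ Z, ∀ c, ‖(Sum.elim x (full f x) : Fin k ⊕ A → Rn n) (vs c) -
      (Sum.elim x (full f x) : Fin k ⊕ A → Rn n) (vd c)‖ = S.len c := by
    intro f x hx c
    obtain ⟨e1, e2⟩ := hvs (Sum.elim x (full f x)) (fun c => rfl) c
    rw [e1, e2, hcomp]
    exact (h2 x hx _).2 ⟨f, rfl⟩ c
  let χ₀ : Fin k ⊕ A → Rn n := Sum.elim x₀ (full f₀ x₀)
  have main : ∀ χ : Fin k ⊕ A → Rn n, ((∀ i : Fin (n + 1), (i : ℕ) < M → χ (vP i) = P i) ∧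
      ∀ a b, Adj a b → χ₀ a ≠ χ₀ b → ‖χ a - χ b‖ = ‖χ₀ a - χ₀ b‖) ↔
      ∃ g : Euc n, (∀ i : Fin (n + 1), (i : ℕ) < M → g (P i) = P i) ∧
        ∃ x ∈ Z, ∃ f, χ = diagAct g (Sum.elim x (full f x)) := by
    intro χ
    constructor
    · rintro ⟨hfix, hdist⟩
      have hPP : ∀ i j, ‖χ (vP i) - χ (vP j)‖ = ‖P i - P j‖ := by
        intro i j
        by_cases hij : i = j
        · rw [hij]; simp
        · exact hdist _ _ (Or.inr (Or.inr (Or.inr ⟨i, j, rfl, rfl⟩))) (hPinj.ne hij)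
      -- The frame is rigid no matter how many of its points are fixed; undoing its motion reduces
      -- to a frame in standard position.
      obtain ⟨g₁, hg₁⟩ := exists_euc_of_congruent (fun i => χ (vP i)) (fun i j => by
        rw [hPP, euc_dist])
      obtain ⟨g, hg⟩ : ∃ g : Euc n, ∀ i, g (P i) = χ (vP i) :=
        ⟨g₁ * β⁻¹, fun i => by rw [euc_mul_apply, euc_inv_apply_self, hg₁]⟩
      let χ' : Fin k ⊕ A → Rn n := fun a => g⁻¹ (χ a)
      have hχ : ∀ a, g (χ' a) = χ a := fun a => euc_apply_inv_self g _
      have hd : ∀ a b, Adj a b → χ₀ a ≠ χ₀ b → ‖χ' a - χ' b‖ = ‖χ₀ a - χ₀ b‖ := by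
        intro a b hab hne
        rw [← hdist a b hab hne, ← euc_dist g, hχ, hχ]
      have hP' : ∀ i, χ' (vP i) = P i := fun i => by
        change g⁻¹ (χ (vP i)) = _
        rw [← hg, euc_inv_apply_self]
      have hQ' : ∀ i, χ' (vQ i) = Q i := fun i => eq_of_dist_frame β fun j => by
        have := hd (vQ i) (vP j) (Or.inr (Or.inr (Or.inl ⟨i, j, rfl, rfl⟩))) (hv2 i j)
        rw [hP'] at this
        exact this
      have hC' : ∀ c, χ' (vC c) = cst c := fun c => by
        refine sub_left_injective (b := v₀) (eq_of_dist_frame β fun j => ?_)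
        have := hd (vC c) (vQ j) (Or.inr (Or.inl ⟨c, j, rfl, rfl⟩)) (hv1 c j)
        rw [hQ'] at this
        change ‖χ' (vC c) - (P j + v₀)‖ = ‖cst c - (P j + v₀)‖ at this
        simp only [sub_sub, add_comm v₀]
        exact this
      have hsat : S.Sat (χ' ∘ Sum.map id Sum.inl) := by
        intro c
        obtain ⟨e1, e2⟩ := hvs χ' hC' c
        rw [← e1, ← e2, ← hlen f₀ x₀ hx₀ c]
        -- The edge of a constraint is present because its length is positive.
        refine hd _ _ (Or.inl ⟨c, rfl, rfl⟩) fun h => ?_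
        have := hlen f₀ x₀ hx₀ c
        change ‖χ₀ (vs c) - χ₀ (vd c)‖ = _ at this
        rw [h, sub_self, norm_zero] at this
        exact (S.len_pos c).ne this
      have hsat' : S.Sat (Sum.elim (χ' ∘ Sum.inl) (χ' ∘ Sum.inr ∘ Sum.inl)) := by
        convert hsat using 1
        ext (a | a) : 1 <;> rfl
      have hx := h1 _ _ hsat'
      obtain ⟨f, hf⟩ := (h2 _ hx _).1 hsat'
      refine ⟨g, fun i hi => by rw [hg, hfix i hi], _, hx, f, funext fun a => ?_⟩
      rw [← hχ a]
      congr 1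
      rcases a with a | a | c | i | i
      · rfl
      · exact congrFun hf a
      · exact hC' c
      · exact hQ' i
      · exact hP' i
    · rintro ⟨g, hg, x, hx, f, rfl⟩
      refine ⟨fun i hi => hg i hi, fun a b hab _ => ?_⟩
      change ‖g _ - g _‖ = _
      rw [euc_dist]
      rcases hab with ⟨c, rfl, rfl⟩ | ⟨c, i, rfl, rfl⟩ | ⟨i, j, rfl, rfl⟩ | ⟨i, j, rfl, rfl⟩
      · rw [hlen f x hx, hlen f₀ x₀ hx₀]
      · rfl
      · rfl
      · rfl
  let e : A ≃ Fin (Fintype.card A) := Fintype.equivFin A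
  let ee : Fin k ⊕ A ≃ Fin k ⊕ Fin (Fintype.card A) := Equiv.sumCongr (Equiv.refl _) e
  let idx : Fin (n + 1) → Fin (Fintype.card A) := fun i => e (.inr (.inr (.inr i)))
  let L := linkageOf (χ₀ ∘ ee.symm) (fun a b => Adj (ee.symm a) (ee.symm b))
    {v | ∃ i : Fin (n + 1), (i : ℕ) < M ∧ v = .inr (idx i)}
  let α : Φ → (Fin k → Rn n) → Fin (Fintype.card A) → Rn n := fun f x => full f x ∘ e.symm
  have hα : ∀ f x i, α f x (idx i) = P i := by
    intro f x i
    simp only [α, idx, Function.comp_apply, Equiv.symm_apply_apply]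
    rfl
  have hidx : Function.Injective idx := fun i j h => by
    exact Sum.inr.inj (Sum.inr.inj (Sum.inr.inj (e.injective h)))
  have heidx : ∀ i, ee.symm (.inr (idx i)) = vP i := fun i => by
    rw [Equiv.symm_apply_eq]; rfl
  have hcfg : L.config = {φ | ∃ g : Euc n, (∀ i : Fin (n + 1), (i : ℕ) < M → g (P i) = P i) ∧
        ∃ x ∈ Z, ∃ f, φ = diagAct g (Sum.elim x (α f x))} := by
    ext φ
    rw [mem_config_linkageOf, Set.mem_ofPred_eq]
    have hm := main (φ ∘ ee)
    have e1 : ((∀ v ∈ {v | ∃ i : Fin (n + 1), (i : ℕ) < M ∧ v = Sum.inr (idx i)},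
        φ v = (χ₀ ∘ ee.symm) v) ∧ ∀ v w, Adj (ee.symm v) (ee.symm w) →
        (χ₀ ∘ ee.symm) v ≠ (χ₀ ∘ ee.symm) w →
        ‖φ v - φ w‖ = ‖(χ₀ ∘ ee.symm) v - (χ₀ ∘ ee.symm) w‖) ↔
        ((∀ i : Fin (n + 1), (i : ℕ) < M → (φ ∘ ee) (vP i) = P i) ∧
        ∀ a b, Adj a b → χ₀ a ≠ χ₀ b → ‖(φ ∘ ee) a - (φ ∘ ee) b‖ = ‖χ₀ a - χ₀ b‖) := by
      refine and_congr ⟨fun h i hi => ?_, ?_⟩ ⟨fun h a b hab hne => ?_, fun h v w hvw hne => ?_⟩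
      · have := h (.inr (idx i)) ⟨i, hi, rfl⟩
        rw [Function.comp_apply, heidx] at this
        exact this
      · rintro h v ⟨i, hi, rfl⟩
        rw [Function.comp_apply, heidx]
        exact h i hi
      · have := h (ee a) (ee b)
        simp only [Function.comp_apply, Equiv.symm_apply_apply] at this
        exact this hab hne
      · have := h _ _ hvw hne
        simpa only [Function.comp_apply, Equiv.apply_symm_apply] using this
    rw [e1, hm]
    refine exists_congr fun g => and_congr Iff.rfl (exists_congr fun x => and_congr Iff.rfl
      (exists_congr fun f => ?_))
    have e2 : (Sum.elim x (α f x) : Fin k ⊕ Fin (Fintype.card A) → Rn n) =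
        (Sum.elim x (full f x)) ∘ ee.symm := by
      ext (a | a) : 1 <;> rfl
    rw [e2]
    constructor
    · intro h
      funext a
      have := congrFun h (ee.symm a)
      simp only [Function.comp_apply, Equiv.apply_symm_apply] at this
      exact this
    · rintro rfl
      funext a
      simp only [diagAct, Function.comp_apply, Equiv.symm_apply_apply]
  refine ⟨Fintype.card A, L, Φ, iΦ, ⟨f₀⟩, α, idx, hidx, rfl, ?_, hα, ?_, ?_, hcfg, ?_⟩
  · intro v i hv
    change χ₀ (ee.symm v.1) = P i
    rw [hv, heidx]
    rfl
  · intro f a x hx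
    change AnalyticAt ℝ (fun x => full f x (e.symm a)) x
    rcases e.symm a with a | a | a | a
    · exact h3 f a x hx
    · exact analyticAt_const
    · exact analyticAt_const
    · exact analyticAt_const
  · intro x hx f f' hff
    refine h4 x hx (funext fun a => ?_)
    have := congrFun hff (e (.inl a))
    simpa [α, full] using this
  · intro hb
    refine connected_of_isBounded hn L hb ?_ (.inr (idx 0)) ?_
    · rw [hcfg]
      exact ⟨_, 1, fun i _ => rfl, x₀, hx₀, f₀, rfl⟩
    · rintro v ⟨i, -, rfl⟩
      by_cases hi : i = 0
      · rw [hi]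
      · refine SimpleGraph.Adj.reachable ⟨Or.inl ?_, ?_⟩
        · simp only [heidx]
          exact Or.inr (Or.inr (Or.inr ⟨0, i, rfl, rfl⟩))
        · simp only [Function.comp_apply, heidx]
          exact hPinj.ne (Ne.symm hi)

/-! ### Finite families of sheets and slices. -/

/-- A finite family of pointwise distinct analytic sections, parametrized by a finite set of reals. -/
lemma exists_finset_param {n k m : ℕ} {Φ : Type} [Finite Φ] [Nonempty Φ] {Z : Set (Fin k → Rn n)}
    (hc : IsCompact Z) (hne : Z.Nonempty) (a : Φ → (Fin k → Rn n) → Fin m → Rn n)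
    (han : ∀ f i, AnalyticOnNhd ℝ (fun x => a f x i) Z)
    (hinj : ∀ x ∈ Z, Function.Injective fun f => a f x) :
    ∃ (F : Finset ℝ) (α : (Fin k → Rn n) × ℝ → Fin m → Rn n), F.Nonempty ∧
      AnalyticOnNhd ℝ α (Z ×ˢ (F : Set ℝ)) ∧
      {φ : Fin k ⊕ Fin m → Rn n | ∃ x ∈ Z, ∃ f, φ = Sum.elim x (a f x)} =
        {φ | ∃ x ∈ Z, ∃ f ∈ F, φ = Sum.elim x (α (x, f))} ∧
      IsAnalyticIso (fun p : (Fin k → Rn n) × ℝ => (Sum.elim p.1 (α p) : Fin k ⊕ Fin m → Rn n))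
        (Z ×ˢ (F : Set ℝ)) {φ | ∃ x ∈ Z, ∃ f, φ = Sum.elim x (a f x)} := by
  classical
  have := Fintype.ofFinite Φ
  let num : Φ → ℝ := fun f => ((Fintype.equivFin Φ f : ℕ) : ℝ)
  have hnum : ∀ f g, |num f - num g| < 1 → f = g := by
    intro f g h
    have h1 : |((Fintype.equivFin Φ f : ℕ) : ℤ) - ((Fintype.equivFin Φ g : ℕ) : ℤ)| < 1 := by
      rw [← Int.cast_lt (R := ℝ)]
      push_cast
      exact h
    rw [Int.abs_lt_one_iff, sub_eq_zero, Nat.cast_inj] at h1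
    exact (Fintype.equivFin Φ).injective (Fin.ext h1)
  have numinj : Function.Injective num := fun f g h => hnum f g (by rw [h]; simp)
  -- The labels are integers, so selecting the label within `1 / 2` is locally constant near `F`,
  -- which makes `α` analytic in its real variable as well.
  let sel : ℝ → Φ := fun s => if h : ∃ f, |s - num f| < 1 / 2 then h.choose else Classical.arbitrary Φ
  have hsel : ∀ s f, |s - num f| < 1 / 2 → sel s = f := by
    intro s f hf
    have hex : ∃ f, |s - num f| < 1 / 2 := ⟨f, hf⟩
    have h1 : sel s = hex.choose := dif_pos hex
    rw [h1]
    refine hnum _ _ ?_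
    have h2 := hex.choose_spec
    have h3 := abs_sub_le (num hex.choose) s (num f)
    rw [abs_sub_comm _ s] at h3
    linarith
  have hsel' : ∀ f, sel (num f) = f := fun f => hsel _ _ (by simp)
  let F : Finset ℝ := Finset.univ.image num
  have hF : ∀ s, s ∈ F ↔ ∃ f, num f = s := by intro s; simp [F]
  let α : (Fin k → Rn n) × ℝ → Fin m → Rn n := fun p => a (sel p.2) p.1
  have ha : ∀ f, AnalyticOnNhd ℝ (a f) Z := fun f x hx => AnalyticAt.pi fun i => han f i x hx
  have hα : AnalyticOnNhd ℝ α (Z ×ˢ (F : Set ℝ)) := by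
    rintro ⟨x, s⟩ ⟨hx, hs⟩
    obtain ⟨f, hf⟩ := (hF s).1 hs
    have h1 : AnalyticAt ℝ (fun p : (Fin k → Rn n) × ℝ => a f p.1) (x, s) :=
      (ha f x hx).fun_comp analyticAt_fst
    refine h1.congr ?_
    have h2 : ∀ᶠ p : (Fin k → Rn n) × ℝ in nhds (x, s), |p.2 - num f| < 1 / 2 := by
      have hcont : Continuous fun p : (Fin k → Rn n) × ℝ => |p.2 - num f| := by fun_prop
      exact hcont.continuousAt.eventually_lt continuousAt_const (by simp [← hf])
    filter_upwards [h2] with p hp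
    simp only [α, hsel _ _ hp]
  let sec : Φ → (Fin k → Rn n) → (Fin k ⊕ Fin m → Rn n) := fun f x => Sum.elim x (a f x)
  have hsec : ∀ f, AnalyticOnNhd ℝ (sec f) Z := by
    intro f x hx
    refine AnalyticAt.pi ?_
    rintro (v | v)
    · exact analyticAt_eval v x
    · exact han f v x hx
  let K : Φ → Set (Fin k ⊕ Fin m → Rn n) := fun f => sec f '' Z
  have hK : ∀ f, IsCompact (K f) := fun f => hc.image_of_continuousOn (hsec f).continuousOn
  have hKne : ∀ f, (K f).Nonempty := fun f => hne.image _
  have hdisj : ∀ f g, f ≠ g → ∀ φ ∈ K f, φ ∉ K g := by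
    rintro f g hfg φ ⟨x, hx, rfl⟩ ⟨y, hy, h⟩
    have e1 : y = x := by
      funext v
      exact congrFun h (.inl v)
    rw [e1] at h
    refine hfg (hinj x hx (funext fun v => ?_))
    exact (congrFun h (.inr v)).symm
  -- The sheets are disjoint compact sets, so the nearest one is locally constant around them;
  -- reading it off gives the analytic inverse.
  let near : Φ → (Fin k ⊕ Fin m → Rn n) → Prop := fun f φ =>
    ∀ g, g ≠ f → Metric.infDist φ (K f) < Metric.infDist φ (K g)
  let pick : (Fin k ⊕ Fin m → Rn n) → Φ := fun φ =>
    if h : ∃ f, near f φ then h.choose else Classical.arbitrary Φ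
  have hpick : ∀ f φ, near f φ → pick φ = f := by
    intro f φ hf
    have hex : ∃ f, near f φ := ⟨f, hf⟩
    have h1 : pick φ = hex.choose := dif_pos hex
    rw [h1]
    by_contra hne
    have h2 := hex.choose_spec f (Ne.symm hne)
    have h3 := hf _ hne
    exact lt_asymm h2 h3
  have hnear : ∀ f, ∀ φ ∈ K f, ∀ᶠ ψ in nhds φ, near f ψ := by
    intro f φ hφ
    rw [Filter.eventually_all]
    intro g
    by_cases hg : g = f
    · exact Filter.Eventually.of_forall fun ψ h => absurd hg h
    · have h1 : Metric.infDist φ (K f) < Metric.infDist φ (K g) := by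
        rw [Metric.infDist_zero_of_mem hφ]
        exact ((hK g).isClosed.notMem_iff_infDist_pos (hKne g)).1 (hdisj f g (Ne.symm hg) φ hφ)
      filter_upwards [(Metric.continuous_infDist_pt (K f)).continuousAt.eventually_lt
        (Metric.continuous_infDist_pt (K g)).continuousAt h1] with ψ hψ _
      exact hψ
  refine ⟨F, α, Finset.univ_nonempty.image num, hα, ?_, ⟨?_, ?_, ?_⟩, ?_, ?_, ?_⟩
  · ext φ
    refine exists_congr fun x => and_congr Iff.rfl ⟨?_, ?_⟩
    · rintro ⟨f, rfl⟩
      exact ⟨num f, (hF _).2 ⟨f, rfl⟩, by simp only [α, hsel']⟩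
    · rintro ⟨s, hs, rfl⟩
      exact ⟨sel s, rfl⟩
  · rintro ⟨x, s⟩ ⟨hx, -⟩
    exact ⟨x, hx, sel s, rfl⟩
  · rintro ⟨x, s⟩ ⟨hx, hs⟩ ⟨y, t⟩ ⟨hy, ht⟩ h
    obtain ⟨f, rfl⟩ := (hF s).1 hs
    obtain ⟨g, rfl⟩ := (hF t).1 ht
    have e1 : x = y := by
      funext v
      exact congrFun h (.inl v)
    subst e1
    have e2 : f = g := hinj x hx (funext fun v => by
      have := congrFun h (.inr v)
      simpa only [Sum.elim_inr, α, hsel'] using this)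
    rw [e2]
  · rintro φ ⟨x, hx, f, rfl⟩
    refine ⟨(x, num f), ⟨hx, (hF _).2 ⟨f, rfl⟩⟩, ?_⟩
    simp only [α, hsel']
  · rintro p hp
    refine AnalyticAt.pi ?_
    rintro (v | v)
    · exact (analyticAt_eval v p.1).fun_comp analyticAt_fst
    · exact (analyticAt_pi_iff.1 (hα p hp)) v
  · exact fun φ => (fun v => φ (.inl v), num (pick φ))
  · refine ⟨?_, ?_⟩
    · rintro φ ⟨x, hx, f, rfl⟩
      refine AnalyticAt.prod ?_ ?_
      · exact AnalyticAt.pi fun v => analyticAt_eval _ _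
      · refine (analyticAt_const (v := num f)).congr ?_
        filter_upwards [hnear f _ ⟨x, hx, rfl⟩] with ψ hψ
        rw [hpick f ψ hψ]
    · rintro ⟨x, s⟩ ⟨hx, hs⟩
      obtain ⟨f, rfl⟩ := (hF s).1 hs
      have h1 : pick (sec f x) = f := hpick f _ (hnear f _ ⟨x, hx, rfl⟩).self_of_nhds
      simp only [α, hsel']
      change (x, num (pick (sec f x))) = _
      rw [h1]

/-- `Z` times a finite set is analytically the configuration space of a connected linkage whose
fixed vertices are placed at the first `M` points of the frame `β (stdFrame n)`. -/
def Realizes {n k : ℕ} (Z : Set (Fin k → Rn n)) (β : Euc n) (M : ℕ) : Prop :=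
  ∃ (m : ℕ) (L : ClassicalLinkage n (Fin k ⊕ Fin m)) (F : Finset ℝ)
    (α : (Fin k → Rn n) × ℝ → (Fin m → Rn n)) (idx : Fin (n + 1) → Fin m),
    Function.Injective idx ∧
    L.fixed = {v | ∃ i : Fin (n + 1), (i : ℕ) < M ∧ v = .inr (idx i)} ∧
    (∀ (v : L.fixed) (i : Fin (n + 1)), v.1 = .inr (idx i) → L.pos v = β (stdFrame n i)) ∧
    L.graph.Connected ∧ F.Nonempty ∧
    AnalyticOnNhd ℝ α (Z ×ˢ (F : Set ℝ)) ∧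
    L.config = {φ | ∃ x ∈ Z, ∃ f ∈ F, φ = Sum.elim x (α (x, f))} ∧
    IsAnalyticIso
      (fun p : (Fin k → Rn n) × ℝ => (Sum.elim p.1 (α p) : Fin k ⊕ Fin m → Rn n))
      (Z ×ˢ (F : Set ℝ)) L.config

/-- A triangle with sides `3, 1, 1` has no configuration; the frame vertices are still present. -/
lemma realizes_empty {n k : ℕ} (β : Euc n) (M : ℕ) :
    Realizes (∅ : Set (Fin k → Rn n)) β M := by
  classical
  let a : Fin k ⊕ Fin (n + 3) := .inr ⟨n + 1, by omega⟩
  let b : Fin k ⊕ Fin (n + 3) := .inr ⟨n + 2, by omega⟩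
  let idx : Fin (n + 1) → Fin (n + 3) := fun i => ⟨i, by omega⟩
  let c : Fin k ⊕ Fin (n + 3) := .inr (idx 0)
  let P : Fin k ⊕ Fin (n + 3) → Rn n := Sum.elim (fun _ => 0)
    (fun i => if h : (i : ℕ) < n + 1 then β (stdFrame n ⟨i, h⟩) else 0)
  let L : ClassicalLinkage n (Fin k ⊕ Fin (n + 3)) :=
    { graph := ⊤
      len := fun e => if e.1 = s(a, b) then 3 else 1
      len_pos := fun e => by split_ifs <;> norm_num
      fixed := {v | ∃ i : Fin (n + 1), (i : ℕ) < M ∧ v = .inr (idx i)}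
      pos := fun v => P v.1 }
  have hcfg : L.config = ∅ := by
    rw [Set.eq_empty_iff_forall_notMem]
    rintro φ ⟨-, h⟩
    have hab : a ≠ b := by simp [a, b]
    have hac : a ≠ c := by simp [a, c, idx]
    have hbc : b ≠ c := by simp [b, c, idx]
    have h1 : ‖φ a - φ b‖ = 3 := (h a b hab).trans (if_pos rfl)
    have h2 : ‖φ a - φ c‖ = 1 := (h a c hac).trans (if_neg (by simp [hbc.symm, hab, hac.symm]))
    have h3 : ‖φ b - φ c‖ = 1 := (h b c hbc).trans (if_neg (by simp [hab.symm, hac.symm]))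
    have h4 := norm_sub_le_norm_sub_add_norm_sub (φ a) (φ c) (φ b)
    rw [h1, h2, norm_sub_rev, h3] at h4
    norm_num at h4
  have hne : Nonempty (Fin k ⊕ Fin (n + 3)) := ⟨a⟩
  refine ⟨n + 3, L, {0}, fun _ => 0, idx, ?_, rfl, ?_, SimpleGraph.connected_top, by simp, ?_, ?_, ?_⟩
  · intro i j h
    simpa [idx, Fin.ext_iff] using h
  · intro v i hv
    change P v.1 = _
    rw [hv]
    simp only [P, Sum.elim_inr, idx]
    rw [dif_pos i.2]
  · rw [Set.empty_prod]
    exact fun _ h => h.elim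
  · rw [hcfg]
    simp
  · rw [hcfg, Set.empty_prod]
    exact ⟨Set.bijOn_empty _, fun _ h => h.elim, fun _ => 0, fun _ h => h.elim, fun _ h => h.elim⟩

/-- The index `i` runs through the ways of writing `x` as `g y` with `y` in the slice `Z₀` and `g`
fixing the first `M` frame points; `Y i x` and `Γ i x` are these `y` and `g`. Sweeping the linkage
for `Z₀` thus gives sheets over `Z` indexed by `ι × Φ`; different motions are told apart by the
frame vertices. -/
lemma realizes_of_slices {n k : ℕ} (hn : 0 < n) {Z Z₀ : Set (Fin k → Rn n)} (hc : IsCompact Z)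
    (hne : Z.Nonempty) (hd : Definable Z₀ Z₀) (β : Euc n) (M : ℕ)
    {ι : Type} [Finite ι] [Nonempty ι] (Y : ι → (Fin k → Rn n) → (Fin k → Rn n))
    (Γ : ι → (Fin k → Rn n) → Rn n → Rn n)
    (h1 : ∀ i, ∀ x ∈ Z, ∃ g : Euc n, (∀ i : Fin (n + 1), (i : ℕ) < M →
        g (β (stdFrame n i)) = β (stdFrame n i)) ∧ Y i x ∈ Z₀ ∧ x = diagAct g (Y i x) ∧ Γ i x = g)
    (h2 : ∀ g : Euc n, (∀ i : Fin (n + 1), (i : ℕ) < M →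
        g (β (stdFrame n i)) = β (stdFrame n i)) → ∀ y ∈ Z₀, diagAct g y ∈ Z ∧
        ∃ i, Y i (diagAct g y) = y ∧ Γ i (diagAct g y) = g)
    (h3 : ∀ x ∈ Z, Function.Injective fun i => Γ i x)
    (h4 : ∀ i v, AnalyticOnNhd ℝ (fun x => Y i x v) Z)
    (h5 : ∀ i, ∀ x ∈ Z, ∀ v,
      AnalyticAt ℝ (fun q : (Fin k → Rn n) × Rn n => Γ i q.1 q.2) (x, v)) :
    Realizes Z β M := by
  have hne₀ : Z₀.Nonempty := by
    obtain ⟨x, hx⟩ := hne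
    obtain ⟨g, -, h, -⟩ := h1 (Classical.arbitrary ι) x hx
    exact ⟨_, h⟩
  obtain ⟨m, L, Φ, iΦ, nΦ, α, idx, k1, k2, k3, k4, k5, k6, k7, k8⟩ :=
    exists_linkage_of_definable hn hne₀ hd β M
  let a : ι × Φ → (Fin k → Rn n) → Fin m → Rn n := fun f x v => Γ f.1 x (α f.2 (Y f.1 x) v)
  have ha : ∀ f v, AnalyticOnNhd ℝ (fun x => a f x v) Z := by
    intro f v x hx
    obtain ⟨g, -, hY, -⟩ := h1 f.1 x hx
    have e1 : AnalyticAt ℝ (fun x => Y f.1 x) x := AnalyticAt.pi fun v => h4 f.1 v x hx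
    have e2 : AnalyticAt ℝ (fun x => α f.2 (Y f.1 x) v) x :=
      AnalyticAt.fun_comp (g := fun y => α f.2 y v) (f := fun x => Y f.1 x) (k5 f.2 v _ hY) e1
    exact AnalyticAt.fun_comp (g := fun q : (Fin k → Rn n) × Rn n => Γ f.1 q.1 q.2)
      (f := fun x => (x, α f.2 (Y f.1 x) v)) (h5 f.1 x hx _) (analyticAt_id.prod e2)
  have hinj : ∀ x ∈ Z, Function.Injective fun f => a f x := by
    rintro x hx ⟨i, f⟩ ⟨i', f'⟩ hff
    obtain ⟨g, hg, hY, hx1, hΓ⟩ := h1 i x hx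
    obtain ⟨g', hg', hY', hx', hΓ'⟩ := h1 i' x hx
    have e1 : g = g' := euc_eq_of_frame β fun l => by
      have := congrFun hff (idx l)
      simp only [a, k4, hΓ, hΓ'] at this
      exact this
    have e2 : i = i' := h3 x hx (by
      change Γ i x = Γ i' x
      rw [hΓ, hΓ', e1])
    subst e2
    have e3 : f = f' := k6 _ hY (funext fun v => by
      have := congrFun hff v
      simp only [a, hΓ] at this
      exact g.injective this)
    rw [e3]
  have hcfg : L.config = {φ : Fin k ⊕ Fin m → Rn n | ∃ x ∈ Z, ∃ f, φ = Sum.elim x (a f x)} := by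
    rw [k7]
    ext φ
    constructor
    · rintro ⟨g, hg, y, hy, f, rfl⟩
      obtain ⟨hZ, i, hi1, hi2⟩ := h2 g hg y hy
      refine ⟨_, hZ, (i, f), ?_⟩
      simp only [a, hi1, hi2]
      funext v
      rcases v with v | v <;> rfl
    · rintro ⟨x, hx, ⟨i, f⟩, rfl⟩
      obtain ⟨g, hg, hY, hx', hΓ⟩ := h1 i x hx
      refine ⟨g, hg, _, hY, f, ?_⟩
      simp only [a, hΓ]
      funext v
      rcases v with v | v
      · conv_lhs => rw [Sum.elim_inl, hx']
        rfl
      · rfl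
  obtain ⟨F, α', l1, l2, l3, l4⟩ := exists_finset_param hc hne a ha hinj
  refine ⟨m, L, F, α', idx, k1, k2, k3, k8 ?_, l1, l2, hcfg.trans l3, hcfg ▸ l4⟩
  -- The configuration space is a continuous image of the compact `Z × F`, hence bounded, as
  -- connectedness of the graph requires.
  have hcont : ContinuousOn (fun p : (Fin k → Rn n) × ℝ =>
      (Sum.elim p.1 (α' p) : Fin k ⊕ Fin m → Rn n)) (Z ×ˢ (F : Set ℝ)) := l4.2.1.continuousOn
  have := ((hc.prod F.finite_toSet.isCompact).image_of_continuousOn hcont).isBounded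
  rwa [l4.1.image_eq, ← hcfg] at this

/-! ### Slices for a subgroup of index two. -/

lemma euc_apply {n : ℕ} (g : Euc n) (v : Rn n) : g v = g.linear v + g 0 := by
  have := g.map_vadd 0 v
  simpa using this

lemma analyticAt_euc {n : ℕ} (g : Euc n) (v : Rn n) : AnalyticAt ℝ (g : Rn n → Rn n) v := by
  have h : (g : Rn n → Rn n) = fun v => g.linearIsometryEquiv.toContinuousLinearEquiv v + g 0 := by
    funext v
    exact euc_apply g v
  rw [h]
  exact (g.linearIsometryEquiv.toContinuousLinearEquiv.analyticAt v).fun_add analyticAt_const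

lemma analyticAt_diagAct {n k : ℕ} (g : Euc n) (x : Fin k → Rn n) :
    AnalyticAt ℝ (diagAct g : (Fin k → Rn n) → (Fin k → Rn n)) x :=
  AnalyticAt.pi fun v => AnalyticAt.fun_comp (g := (g : Rn n → Rn n))
    (f := fun x : Fin k → Rn n => x v) (analyticAt_euc g (x v)) (analyticAt_eval v x)

lemma diagAct_mul {n : ℕ} {V : Type*} (g h : Euc n) (x : V → Rn n) :
    diagAct (g * h) x = diagAct g (diagAct h x) := rfl

lemma diagAct_inv_self {n : ℕ} {V : Type*} (g : Euc n) (x : V → Rn n) :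
    diagAct g⁻¹ (diagAct g x) = x := funext fun v => euc_inv_apply_self g (x v)

lemma diagAct_self_inv {n : ℕ} {V : Type*} (g : Euc n) (x : V → Rn n) :
    diagAct g (diagAct g⁻¹ x) = x := funext fun v => euc_apply_inv_self g (x v)

/-- Realization of a set which is a product with a subgroup of index two of the group fixing the
first `M` points of a frame. -/
lemma realizes_of_index_two {n k : ℕ} (hn : 0 < n) {Z Z₀ : Set (Fin k → Rn n)} (hc : IsCompact Z)
    (hne : Z.Nonempty) (hd : Definable Z₀ Z₀) (β : Euc n) (M : ℕ) {G K : Subgroup (Euc n)}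
    (hG : ∀ g, g ∈ G ↔ ∀ i : Fin (n + 1), (i : ℕ) < M → g (β (stdFrame n i)) = β (stdFrame n i))
    (hK : K ≤ G) {ρ : Euc n} (hρ : ρ ∈ G) (hρK : ρ ∉ K) (hGK : ∀ g ∈ G, g ∈ K ∨ ρ⁻¹ * g ∈ K)
    (hZ : ∀ g ∈ G, ∀ z ∈ Z, diagAct g z ∈ Z)
    (Y : (Fin k → Rn n) → (Fin k → Rn n)) (Γ : (Fin k → Rn n) → Rn n → Rn n)
    (h1 : ∀ x ∈ Z, ∃ g ∈ K, Y x ∈ Z₀ ∧ x = diagAct g (Y x) ∧ Γ x = g)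
    (h2 : ∀ g ∈ K, ∀ y ∈ Z₀, diagAct g y ∈ Z ∧ Y (diagAct g y) = y ∧ Γ (diagAct g y) = g)
    (h4 : ∀ v x, AnalyticAt ℝ (fun x => Y x v) x)
    (h5 : ∀ x v, AnalyticAt ℝ (fun q : (Fin k → Rn n) × Rn n => Γ q.1 q.2) (x, v)) :
    Realizes Z β M := by
  have hinv : ∀ x ∈ Z, diagAct ρ⁻¹ x ∈ Z := hZ _ (inv_mem hρ)
  -- One decomposition has its motion in `K`. For the other coset `ρ⁻¹ x` is decomposed instead, and
  -- `ρ` is put back in front of the motion.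
  refine realizes_of_slices hn hc hne hd β M (ι := Bool)
    (fun b x => cond b (Y x) (Y (diagAct ρ⁻¹ x)))
    (fun b x v => cond b (Γ x v) (ρ (Γ (diagAct ρ⁻¹ x) v))) ?_ ?_ ?_ ?_ ?_
  · rintro (_ | _) x hx
    · obtain ⟨g, hg, hY, hx', hΓ⟩ := h1 _ (hinv x hx)
      refine ⟨ρ * g, (hG _).1 (mul_mem hρ (hK hg)), hY, ?_, ?_⟩
      · rw [diagAct_mul]
        change x = diagAct ρ (diagAct g (Y (diagAct ρ⁻¹ x)))
        rw [← hx', diagAct_self_inv]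
      · funext v
        change ρ (Γ (diagAct ρ⁻¹ x) v) = ρ (g v)
        rw [hΓ]
    · obtain ⟨g, hg, hY, hx', hΓ⟩ := h1 x hx
      exact ⟨g, (hG _).1 (hK hg), hY, hx', hΓ⟩
  · intro g hg y hy
    rw [← hG] at hg
    rcases hGK g hg with h | h
    · obtain ⟨a1, a2, a3⟩ := h2 g h y hy
      exact ⟨a1, true, a2, a3⟩
    · obtain ⟨a1, a2, a3⟩ := h2 _ h y hy
      have e : diagAct ρ⁻¹ (diagAct g y) = diagAct (ρ⁻¹ * g) y := rfl
      refine ⟨?_, false, ?_, ?_⟩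
      · have := hZ ρ hρ _ a1
        rwa [← diagAct_mul, mul_inv_cancel_left] at this
      · change Y (diagAct ρ⁻¹ (diagAct g y)) = y
        rw [e, a2]
      · funext v
        change ρ (Γ (diagAct ρ⁻¹ (diagAct g y)) v) = g v
        rw [e, a3, euc_mul_apply, euc_apply_inv_self]
  · intro x hx
    have key : (fun v => Γ x v) ≠ fun v => ρ (Γ (diagAct ρ⁻¹ x) v) := by
      intro h
      obtain ⟨g, hg, -, -, hΓ⟩ := h1 x hx
      obtain ⟨g', hg', -, -, hΓ'⟩ := h1 _ (hinv x hx)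
      simp only [hΓ, hΓ'] at h
      have e : g = ρ * g' := by
        ext1 v
        exact congrFun h v
      apply hρK
      rw [show ρ = g * g'⁻¹ by rw [e]; group]
      exact mul_mem hg (inv_mem hg')
    rintro (_ | _) (_ | _) h
    · rfl
    · exact absurd h.symm key
    · exact absurd h key
    · rfl
  · rintro (_ | _) v x -
    · exact AnalyticAt.fun_comp (g := fun x => Y x v) (h4 v _) (analyticAt_diagAct ρ⁻¹ x)
    · exact h4 v x
  · rintro (_ | _) x - v
    · refine (analyticAt_euc ρ _).fun_comp ?_
      exact AnalyticAt.fun_comp (g := fun q : (Fin k → Rn n) × Rn n => Γ q.1 q.2)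
        (f := fun q : (Fin k → Rn n) × Rn n => (diagAct ρ⁻¹ q.1, q.2)) (h5 _ _)
        (((analyticAt_diagAct ρ⁻¹ x).fun_comp analyticAt_fst).prod analyticAt_snd)
    · exact h5 x v

/-! ### The groups `O(1)` and `O(2)` and the three cases of the theorem. -/

/-- The determinant of the linear part of a motion. -/
noncomputable def eucDet {n : ℕ} (g : Euc n) : ℝ := LinearMap.det (g.linear : Rn n →ₗ[ℝ] Rn n)

lemma mem_eucPlus {n : ℕ} (g : Euc n) : g ∈ eucPlus n ↔ 0 < eucDet g := Iff.rfl

lemma eucDet_mul {n : ℕ} (g h : Euc n) : eucDet (g * h) = eucDet g * eucDet h :=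
  LinearMap.det_comp _ _

lemma eucDet_one {n : ℕ} : eucDet (1 : Euc n) = 1 := LinearMap.det_id

lemma eucDet_inv_mul {n : ℕ} (g : Euc n) : eucDet g⁻¹ * eucDet g = 1 := by
  rw [← eucDet_mul, inv_mul_cancel, eucDet_one]

lemma eucDet_conj {n : ℕ} (β g : Euc n) : eucDet (β * g * β⁻¹) = eucDet g := by
  rw [eucDet_mul, eucDet_mul, mul_comm (eucDet β), mul_assoc, mul_comm (eucDet β), eucDet_inv_mul,
    mul_one]

/-- The reflection in a coordinate hyperplane. -/
lemma exists_reflection {n : ℕ} (i : Fin n) : ∃ r : Euc n, eucDet r = -1 ∧ r 0 = 0 ∧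
    (∀ j, j ≠ i → r (stdVec j) = stdVec j) ∧ r (stdVec i) = -stdVec i := by
  let U : Submodule ℝ (Rn n) := (Submodule.span ℝ {(stdVec i : Rn n)})ᗮ
  have hne : (stdVec i : Rn n) ≠ 0 := fun h => by
    simpa using congrArg (fun v : Rn n => v i) h
  refine ⟨U.reflection.toAffineIsometryEquiv, ?_, ?_, ?_, ?_⟩
  · have h1 : eucDet (U.reflection.toAffineIsometryEquiv) =
      (-1) ^ Module.finrank ℝ Uᗮ := U.det_reflection
    rw [h1, Submodule.orthogonal_orthogonal, finrank_span_singleton hne, pow_one]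
  · simp
  · intro j hj
    rw [LinearIsometryEquiv.coe_toAffineIsometryEquiv]
    refine Submodule.reflection_mem_subspace_eq_self ?_
    rw [Submodule.mem_orthogonal_singleton_iff_inner_right, inner_stdVec]
    simp [hj]
  · rw [LinearIsometryEquiv.coe_toAffineIsometryEquiv]
    exact Submodule.reflection_orthogonalComplement_singleton_eq_neg _

/-- The group `O(1)` consists of the identity and a reflection. -/
lemma orthSubgroup_one {n : ℕ} (hn : 0 < n) : ∃ r : Euc n, r ∈ orthSubgroup n 1 ∧ eucDet r = -1 ∧
    ∀ g ∈ orthSubgroup n 1, g = 1 ∨ g = r := by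
  let l : Fin n := ⟨n - 1, by omega⟩
  have hl : ∀ i : Fin n, i ≠ l ↔ (i : ℕ) + 1 < n := by
    intro i
    rw [Ne, Fin.ext_iff]
    have := i.2
    simp only [l]
    omega
  obtain ⟨r, h1, h2, h3, h4⟩ := exists_reflection l
  refine ⟨r, ⟨h2, fun i hi => h3 i ((hl i).2 hi)⟩, h1, ?_⟩
  rintro g ⟨g1, g2⟩
  -- Distances to the fixed points make all coordinates of the image other than the last vanish, and
  -- the norm leaves only a sign.
  have e0 : ‖g (stdVec l)‖ = ‖(stdVec l : Rn n)‖ := by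
    have := euc_dist g (stdVec l) 0
    rwa [g1, sub_zero, sub_zero] at this
  have e1 : ∀ i, i ≠ l → (g (stdVec l)) i = 0 := by
    intro i hi
    have h5 := euc_dist g (stdVec l) (stdVec i)
    rw [g2 i ((hl i).1 hi)] at h5
    have := inner_eq_of_dist e0 h5
    rw [inner_stdVec, inner_stdVec] at this
    rw [this]
    simp [hi]
  have e2 : g (stdVec l) = (g (stdVec l)) l • stdVec l := by
    ext i
    by_cases hi : i = l
    · subst hi; simp
    · rw [e1 i hi]; simp [hi]
  have e3 : |(g (stdVec l)) l| = 1 := by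
    rw [e2, norm_smul] at e0
    simpa using e0
  have key : ∀ h : Euc n, h 0 = 0 → (∀ i, i ≠ l → h (stdVec i) = stdVec i) →
      g (stdVec l) = h (stdVec l) → g = h := by
    intro h h5 h6 h7
    refine euc_eq_of_frame 1 fun i => ?_
    change g (stdFrame n i) = h (stdFrame n i)
    induction i using Fin.cases with
    | zero => rw [stdFrame_zero, g1, h5]
    | succ i =>
      rw [stdFrame_succ]
      by_cases hi : i = l
      · rw [hi, h7]
      · rw [g2 i ((hl i).1 hi), h6 i hi]
  rcases (abs_eq zero_le_one).1 e3 with h | h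
  · left
    refine key 1 rfl (fun _ _ => rfl) ?_
    rw [e2, h, one_smul]; rfl
  · right
    refine key r h2 h3 ?_
    rw [e2, h, h4]; simp

lemma reflection_mem_orthSubgroup {n j : ℕ} {i : Fin n} (hi : n ≤ i + j) {r : Euc n} (h0 : r 0 = 0)
    (h : ∀ j, j ≠ i → r (stdVec j) = stdVec j) : r ∈ orthSubgroup n j :=
  ⟨h0, fun l hl => h l (by rintro rfl; omega)⟩

/-- Conjugates of `O(1)` and of `O(2)` are different. -/
lemma not_conj_both {n : ℕ} (hn : 2 ≤ n) {G : Subgroup (Euc n)}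
    (h1 : IsConjSubgroup G (orthSubgroup n 1)) (h2 : IsConjSubgroup G (orthSubgroup n 2)) : False := by
  obtain ⟨β, rfl⟩ := h1
  obtain ⟨γ, hγ⟩ := h2
  obtain ⟨r, -, hr, hr'⟩ := orthSubgroup_one (show 0 < n by omega)
  let i : Fin n := ⟨n - 1, by omega⟩
  let j : Fin n := ⟨n - 2, by omega⟩
  have hij : j ≠ i := by
    simp only [Ne, Fin.ext_iff, i, j]; omega
  obtain ⟨a, a1, a2, a3, a4⟩ := exists_reflection i
  obtain ⟨b, b1, b2, b3, b4⟩ := exists_reflection j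
  -- This half-turn has determinant `1` and is not the identity; no element of `O(1)` has both
  -- properties.
  have hab : a * b ∈ orthSubgroup n 2 :=
    mul_mem (reflection_mem_orthSubgroup (i := i) (by simp only [i]; omega) a2 a3)
      (reflection_mem_orthSubgroup (i := j) (by simp only [j]; omega) b2 b3)
  have hmem : γ * (a * b) * γ⁻¹ ∈ (orthSubgroup n 1).map (MulAut.conj β).toMonoidHom := by
    rw [hγ]
    exact ⟨a * b, hab, rfl⟩
  obtain ⟨g, hg, hge⟩ := hmem
  have hge : β * g * β⁻¹ = γ * (a * b) * γ⁻¹ := hge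
  rcases hr' g hg with rfl | rfl
  · have e : a * b = 1 := by
      have : γ * (a * b) * γ⁻¹ = 1 := by rw [← hge]; group
      calc a * b = γ⁻¹ * (γ * (a * b) * γ⁻¹) * γ := by group
        _ = 1 := by rw [this]; group
    have h3 : (a * b) (stdVec i) = -stdVec i := by
      rw [euc_mul_apply, b3 i hij.symm, a4]
    rw [e] at h3
    have := congrArg (fun v : Rn n => v i) h3
    have h4 : (1 : ℝ) = -1 := by simpa using this
    norm_num at h4
  · have := congrArg eucDet hge
    rw [eucDet_conj, eucDet_conj, eucDet_mul, a1, b1, hr] at this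
    norm_num at this

/-- Apart from the identity, only a reflection fixes the first `n` frame points, and it preserves
`Z`. So `Z` is its own slice, with `K` trivial. -/
lemma realizes_conj_one {n k : ℕ} (hn : 2 ≤ n) {Z : Set (Fin k → Rn n)} (hc : IsCompact Z)
    (ha : IsRealAlgebraic Z) {G : Subgroup (Euc n)} (hZ : ∀ g ∈ G, ∀ z ∈ Z, diagAct g z ∈ Z)
    {β : Euc n} (hβ : G = (orthSubgroup n 1).map (MulAut.conj β).toMonoidHom) :
    Realizes Z β (n + 1 - 1) := by
  rcases Z.eq_empty_or_nonempty with rfl | hne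
  · exact realizes_empty β _
  obtain ⟨r, h1, h2, h3⟩ := orthSubgroup_one (show 0 < n by omega)
  refine realizes_of_index_two (by omega) hc hne (.of_isRealAlgebraic hn hc ha) β (n + 1 - 1)
    (G := G) (K := ⊥) (fun g => by rw [hβ, mem_conj_orthSubgroup (by omega)]) bot_le
    (ρ := β * r * β⁻¹) ?_ ?_ ?_ hZ id (fun _ v => v) ?_ ?_ ?_ ?_
  · rw [hβ]
    exact ⟨r, h1, rfl⟩
  · intro h
    have := congrArg eucDet (Subgroup.mem_bot.1 h)
    rw [eucDet_conj, h2, eucDet_one] at this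
    norm_num at this
  · intro g hg
    rw [hβ] at hg
    obtain ⟨g', hg', rfl⟩ := hg
    rcases h3 g' hg' with rfl | rfl
    · left; simp
    · right
      rw [Subgroup.mem_bot]
      change (β * g' * β⁻¹)⁻¹ * (β * g' * β⁻¹) = 1
      group
  · intro x hx
    exact ⟨1, one_mem _, hx, rfl, rfl⟩
  · intro g hg y hy
    rw [Subgroup.mem_bot] at hg
    subst hg
    exact ⟨hy, rfl, rfl⟩
  · exact fun v x => analyticAt_eval v x
  · exact fun x v => analyticAt_snd

lemma realizes_trivial {n k : ℕ} (hn : 2 ≤ n) {Z : Set (Fin k → Rn n)} (hc : IsCompact Z)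
    (ha : IsRealAlgebraic Z) : Realizes Z 1 (n + 1) := by
  rcases Z.eq_empty_or_nonempty with rfl | hne
  · exact realizes_empty 1 _
  refine realizes_of_slices (by omega) hc hne (.of_isRealAlgebraic hn hc ha) 1 (n + 1) (ι := Unit)
    (fun _ x => x) (fun _ _ v => v) ?_ ?_ ?_ ?_ ?_
  · exact fun _ x hx => ⟨1, fun _ _ => rfl, hx, rfl, rfl⟩
  · intro g hg y hy
    have : g = 1 := euc_eq_of_frame 1 fun i => hg i i.2
    subst this
    exact ⟨hy, (), rfl, rfl⟩
  · exact fun x _ _ _ _ => rfl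
  · exact fun _ v x _ => analyticAt_eval v x
  · exact fun _ x _ v => analyticAt_snd

lemma analyticAt_entireRational {n k : ℕ} {τ : Type} {H : (Fin k × Fin n → ℝ) → τ → ℝ}
    (hH : IsEntireRational H) (t : τ) (x : Fin k → Rn n) :
    AnalyticAt ℝ (fun x : Fin k → Rn n => H (configCoord x) t) x := by
  obtain ⟨p, q, hpq⟩ := hH t
  have h1 : (fun x : Fin k → Rn n => H (configCoord x) t) = fun x =>
      MvPolynomial.eval (configCoord x) p / MvPolynomial.eval (configCoord x) q := by
    funext x
    exact (hpq _).2
  have h2 : ∀ a, AnalyticAt ℝ (fun x : Fin k → Rn n => configCoord x a) x := by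
    intro a
    have := analyticAt_coord (stdVec a.2) a.1 x
    simp only [real_inner_comm, inner_stdVec] at this
    exact this
  have h3 : ∀ p : MvPolynomial (Fin k × Fin n) ℝ,
      AnalyticAt ℝ (fun x : Fin k → Rn n => MvPolynomial.eval (configCoord x) p) x := by
    intro p
    have := AnalyticAt.aeval_mvPolynomial (𝕜 := ℝ) (A := ℝ) (B := ℝ)
      (f := fun (x : Fin k → Rn n) a => configCoord x a) h2 p
    simpa [MvPolynomial.aeval_eq_eval] using this
  rw [h1]
  exact (h3 p).fun_div (h3 q) (hpq _).1

lemma sum_smul_stdVec {n : ℕ} (v : Rn n) : ∑ i, v i • (stdVec i : Rn n) = v := by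
  ext i
  simp [Finset.sum_apply, Pi.single_apply]

/-- The rational inverse of `(z, g) ↦ g z` supplies the slice point `Y` and, from its matrix and
translation entries, the motion `Γ`; both are analytic everywhere because the denominators never
vanish. The first `n - 1` frame points are fixed exactly by `G`, in which `G⁺` has index two. -/
lemma realizes_rotational {n k : ℕ} (hn : 2 ≤ n) {Z : Set (Fin k → Rn n)} (hc : IsCompact Z)
    {G : Subgroup (Euc n)} (hZ : ∀ g ∈ G, ∀ z ∈ Z, diagAct g z ∈ Z)
    {β : Euc n} (hβ : G = (orthSubgroup n 2).map (MulAut.conj β).toMonoidHom)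
    {Z' : Set (Fin k → Rn n)} (ha' : IsRealAlgebraic Z') (hiso : ActionIsIso Z' (G ⊓ eucPlus n) Z) :
    Realizes Z β (n + 1 - 2) := by
  rcases Z.eq_empty_or_nonempty with rfl | hne
  · exact realizes_empty β _
  obtain ⟨hbij, -, H, hH, hHe⟩ := hiso
  let Y : (Fin k → Rn n) → (Fin k → Rn n) := fun x v =>
    ∑ i, H (configCoord x) (.inl (v, i)) • stdVec i
  let Γ : (Fin k → Rn n) → Rn n → Rn n := fun x u =>
    ∑ i, (∑ j, H (configCoord x) (.inr (.inl (i, j))) * u j + H (configCoord x) (.inr (.inr i))) •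
      stdVec i
  have h2 : ∀ g ∈ G ⊓ eucPlus n, ∀ y ∈ Z', diagAct g y ∈ Z ∧ Y (diagAct g y) = y ∧
      Γ (diagAct g y) = g := by
    intro g hg y hy
    have hmem : ((y, g) : (Fin k → Rn n) × Euc n) ∈ Z' ×ˢ ((G ⊓ eucPlus n : Subgroup (Euc n)) :
      Set (Euc n)) := ⟨hy, hg⟩
    have h3 := hHe _ hmem
    simp only at h3
    refine ⟨hbij.mapsTo hmem, ?_, ?_⟩
    · funext v
      simp only [Y, h3]
      exact sum_smul_stdVec (y v)
    · funext u
      simp only [Γ, h3]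
      rw [euc_apply g u, ← sum_smul_stdVec (g.linear u + g 0)]
      refine Finset.sum_congr rfl fun i _ => ?_
      congr 1
      change (∑ j, (g.linear (stdVec j)) i * u j) + (g 0) i = (g.linear u) i + (g 0) i
      congr 1
      conv_rhs => rw [← sum_smul_stdVec u, map_sum]
      simp [Finset.sum_apply, mul_comm]
  have h1 : ∀ x ∈ Z, ∃ g ∈ G ⊓ eucPlus n, Y x ∈ Z' ∧ x = diagAct g (Y x) ∧ Γ x = g := by
    intro x hx
    obtain ⟨⟨y, g⟩, ⟨hy, hg⟩, rfl⟩ := hbij.surjOn hx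
    obtain ⟨-, e1, e2⟩ := h2 g hg y hy
    exact ⟨g, hg, by simpa only [e1] using hy, by simp only [e1], e2⟩
  have hYan : ∀ v x, AnalyticAt ℝ (fun x => Y x v) x := by
    intro v x
    exact Finset.analyticAt_fun_sum _ fun i _ =>
      (analyticAt_entireRational hH _ x).fun_smul analyticAt_const
  -- `Z'` is only given as algebraic; it is compact as the image of `Z` under `Y`.
  have hc' : IsCompact Z' := by
    have : Z' = Y '' Z := by
      ext y
      constructor
      · intro hy
        obtain ⟨a1, a2, -⟩ := h2 1 (one_mem _) y hy
        exact ⟨_, a1, a2⟩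
      · rintro ⟨x, hx, rfl⟩
        obtain ⟨g, -, h, -⟩ := h1 x hx
        exact h
    rw [this]
    refine hc.image (continuous_pi fun v => continuous_iff_continuousAt.2 fun x =>
      (hYan v x).continuousAt)
  obtain ⟨r, hr1, hr2, hr3, -⟩ := exists_reflection (⟨n - 1, by omega⟩ : Fin n)
  have hdet : eucDet (β * r * β⁻¹) = -1 := by rw [eucDet_conj, hr1]
  have hρ : β * r * β⁻¹ ∈ G := by
    rw [hβ]
    exact ⟨r, reflection_mem_orthSubgroup (by simp only; omega) hr2 hr3, rfl⟩
  refine realizes_of_index_two (by omega) hc hne (.of_isRealAlgebraic hn hc' ha') β (n + 1 - 2)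
    (G := G) (K := G ⊓ eucPlus n) (fun g => by rw [hβ, mem_conj_orthSubgroup hn]) inf_le_left
    (ρ := β * r * β⁻¹) hρ ?_ ?_ hZ Y Γ h1 h2 hYan ?_
  · rintro ⟨-, h⟩
    have h : 0 < eucDet (β * r * β⁻¹) := h
    rw [hdet] at h
    norm_num at h
  · intro g hg
    by_cases h : 0 < eucDet g
    · exact Or.inl ⟨hg, h⟩
    · refine Or.inr (Subgroup.mem_inf.2 ⟨G.mul_mem (G.inv_mem hρ) hg, (mem_eucPlus _).2 ?_⟩)
      rw [eucDet_mul]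
      have e1 := eucDet_inv_mul g
      have e2 := eucDet_inv_mul (β * r * β⁻¹)
      rw [hdet] at e2
      have e3 : eucDet g ≠ 0 := fun h0 => by
        rw [h0, mul_zero] at e1
        exact zero_ne_one e1
      have e4 : eucDet g < 0 := lt_of_le_of_ne (not_lt.1 h) e3
      rw [show eucDet (β * r * β⁻¹)⁻¹ = -1 by linarith]
      linarith
  · intro x u
    refine Finset.analyticAt_fun_sum _ fun i _ => AnalyticAt.fun_smul ?_ analyticAt_const
    have ht : ∀ t, AnalyticAt ℝ (fun q : (Fin k → Rn n) × Rn n => H (configCoord q.1) t) (x, u) :=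
      fun t => AnalyticAt.fun_comp (g := fun x => H (configCoord x) t)
        (f := fun q : (Fin k → Rn n) × Rn n => q.1) (analyticAt_entireRational hH t x)
        analyticAt_fst
    refine AnalyticAt.fun_add (Finset.analyticAt_fun_sum _ fun j _ => (ht _).fun_mul ?_) (ht _)
    have := analyticAt_inner_const (stdVec j) (analyticAt_snd (𝕜 := ℝ) (p := (x, u)))
    simpa only [real_inner_comm, inner_stdVec] using this

lemma ncard_fixed {n k m M : ℕ} (hM : M ≤ n + 1) {idx : Fin (n + 1) → Fin m}
    (hidx : Function.Injective idx) :
    ({v : Fin k ⊕ Fin m | ∃ i : Fin (n + 1), (i : ℕ) < M ∧ v = .inr (idx i)}).ncard = M := by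
  have : {v : Fin k ⊕ Fin m | ∃ i : Fin (n + 1), (i : ℕ) < M ∧ v = .inr (idx i)} =
      Set.range fun i : Fin M => (.inr (idx (Fin.castLE hM i)) : Fin k ⊕ Fin m) := by
    ext v
    constructor
    · rintro ⟨i, hi, rfl⟩
      exact ⟨⟨i, hi⟩, rfl⟩
    · rintro ⟨i, rfl⟩
      exact ⟨Fin.castLE hM i, i.2, rfl⟩
  rw [this, ← Nat.card_coe_set_eq, Nat.card_range_of_injective, Nat.card_fin]
  intro i j h
  exact Fin.castLE_injective hM (hidx (Sum.inr_injective h))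

/-- The realization theorem. -/
theorem exists_linkage_of_isRealAlgebraic {n k : ℕ} (hn : 2 ≤ n) {Z : Set (Fin k → Rn n)}
    (hc : IsCompact Z) (ha : IsRealAlgebraic Z) {G : Subgroup (Euc n)}
    (hZ : ∀ g ∈ G, ∀ z ∈ Z, diagAct g z ∈ Z) :
    ∃ (m : ℕ) (L : ClassicalLinkage n (Fin k ⊕ Fin m)) (F : Finset ℝ)
        (α : (Fin k → Rn n) × ℝ → (Fin m → Rn n)),
        L.graph.Connected ∧ F.Nonempty ∧
        AnalyticOnNhd ℝ α (Z ×ˢ (F : Set ℝ)) ∧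
        L.config = {φ | ∃ x ∈ Z, ∃ f ∈ F, φ = Sum.elim x (α (x, f))} ∧
        IsAnalyticIso
          (fun p : (Fin k → Rn n) × ℝ => (Sum.elim p.1 (α p) : Fin k ⊕ Fin m → Rn n))
          (Z ×ˢ (F : Set ℝ)) L.config ∧
        (IsConjSubgroup G (orthSubgroup n 1) → L.fixed.ncard = n ∧ L.FixedWithin G) ∧
        (RotationalSlice G Z → L.fixed.ncard = n - 1 ∧ L.FixedWithin G) ∧
        (¬ IsConjSubgroup G (orthSubgroup n 1) → ¬ RotationalSlice G Z →
          L.fixed.ncard = n + 1 ∧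
          Set.range L.pos = insert 0 (Set.range fun i : Fin n => stdVec i)) := by
  have within : ∀ {m j : ℕ} (_ : j ≤ n) {L : ClassicalLinkage n (Fin k ⊕ Fin m)} {β : Euc n}
      {idx : Fin (n + 1) → Fin m}
      (_ : L.fixed = {v | ∃ i : Fin (n + 1), (i : ℕ) < n + 1 - j ∧ v = .inr (idx i)})
      (_ : ∀ (v : L.fixed) (i : Fin (n + 1)), v.1 = .inr (idx i) → L.pos v = β (stdFrame n i))
      (_ : G = (orthSubgroup n j).map (MulAut.conj β).toMonoidHom), L.FixedWithin G := by
    intro m j hj L β idx h1 h2 h3 v g hg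
    obtain ⟨i, hi, hv⟩ : ∃ i : Fin (n + 1), (i : ℕ) < n + 1 - j ∧ v.1 = .inr (idx i) :=
      (Set.ext_iff.1 h1 v.1).1 v.2
    rw [h3, mem_conj_orthSubgroup hj] at hg
    rw [h2 v i hv]
    exact hg i hi
  by_cases h1 : IsConjSubgroup G (orthSubgroup n 1)
  · have hβ := h1
    obtain ⟨β, hβ⟩ := hβ
    obtain ⟨m, L, F, α, idx, k1, k2, k3, k4, k5, k6, k7, k8⟩ := realizes_conj_one hn hc ha hZ hβ
    refine ⟨m, L, F, α, k4, k5, k6, k7, k8, fun _ => ⟨?_, within (by omega) k2 k3 hβ⟩,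
      fun h => (not_conj_both hn h1 h.1).elim, fun h => absurd h1 h⟩
    rw [k2, ncard_fixed (by omega) k1]; omega
  by_cases h2 : RotationalSlice G Z
  · obtain ⟨⟨β, hβ⟩, Z', hsub, hZ', hiso⟩ := h2
    obtain ⟨m, L, F, α, idx, k1, k2, k3, k4, k5, k6, k7, k8⟩ :=
      realizes_rotational hn hc hZ hβ hZ' hiso
    refine ⟨m, L, F, α, k4, k5, k6, k7, k8, fun h => absurd h h1,
      fun _ => ⟨?_, within hn k2 k3 hβ⟩, fun _ h => absurd ⟨⟨β, hβ⟩, Z', hsub, hZ', hiso⟩ h⟩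
    rw [k2, ncard_fixed (by omega) k1]; omega
  · obtain ⟨m, L, F, α, idx, k1, k2, k3, k4, k5, k6, k7, k8⟩ := realizes_trivial hn hc ha
    refine ⟨m, L, F, α, k4, k5, k6, k7, k8, fun h => absurd h h1, fun h => absurd h h2,
      fun _ _ => ⟨by rw [k2, ncard_fixed le_rfl k1], ?_⟩⟩
    have hmem : ∀ i, (.inr (idx i) : Fin k ⊕ Fin m) ∈ L.fixed := fun i => by
      rw [k2]
      exact ⟨i, i.2, rfl⟩
    have hpos : ∀ i, L.pos ⟨.inr (idx i), hmem i⟩ = stdFrame n i := fun i => k3 _ i rfl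
    ext v
    constructor
    · rintro ⟨u, rfl⟩
      obtain ⟨i, -, hu⟩ : ∃ i : Fin (n + 1), (i : ℕ) < n + 1 ∧ u.1 = .inr (idx i) :=
        (Set.ext_iff.1 k2 u.1).1 u.2
      rw [k3 u i hu]
      change stdFrame n i ∈ _
      induction i using Fin.cases with
      | zero => exact Or.inl rfl
      | succ i => exact Or.inr ⟨i, rfl⟩
    · rintro (rfl | ⟨i, rfl⟩)
      · exact ⟨_, hpos 0⟩
      · exact ⟨_, hpos i.succ⟩

/-! ### The converse in the plane. -/

/-- The linear map of the plane with matrix `!![a, -b; b, a]`. -/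
noncomputable def planeRot (a b : ℝ) : Rn 2 →ₗ[ℝ] Rn 2 where
  toFun v := !₂[a * v 0 - b * v 1, b * v 0 + a * v 1]
  map_add' v w := by
    ext i
    fin_cases i <;> simp <;> ring
  map_smul' c v := by
    ext i
    fin_cases i <;> simp <;> ring

@[simp] lemma planeRot_apply_zero (a b : ℝ) (v : Rn 2) : planeRot a b v 0 = a * v 0 - b * v 1 := rfl

@[simp] lemma planeRot_apply_one (a b : ℝ) (v : Rn 2) : planeRot a b v 1 = b * v 0 + a * v 1 := rfl

lemma rn_two_norm_sq (v : Rn 2) : ‖v‖ ^ 2 = v 0 ^ 2 + v 1 ^ 2 := by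
  rw [EuclideanSpace.real_norm_sq_eq, Fin.sum_univ_two]

lemma det_rn_two (f : Rn 2 →ₗ[ℝ] Rn 2) :
    LinearMap.det f = f (stdVec 0) 0 * f (stdVec 1) 1 - f (stdVec 1) 0 * f (stdVec 0) 1 := by
  rw [← LinearMap.det_toMatrix (EuclideanSpace.basisFun (Fin 2) ℝ).toBasis, Matrix.det_fin_two]
  simp [LinearMap.toMatrix_apply]

/-- The columns `(a, b)` and `(c, d)` are orthonormal, so the determinant is `1` or `-1`, hence `1`
by positivity. Then `(d - a)² + (c + b)² = 2 - 2 * 1 = 0`. -/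
lemma planeRot_entries {a b c d : ℝ} (h0 : a ^ 2 + b ^ 2 = 1) (h1 : c ^ 2 + d ^ 2 = 1)
    (h2 : (a + c) ^ 2 + (b + d) ^ 2 = 1 + 1) (h : c * b < a * d) : d = a ∧ c = -b := by
  have hac : a * c + b * d = 0 := by linear_combination (h2 - h0 - h1) / 2
  have hsq : (a * d - c * b - 1) * (a * d - c * b + 1) = 0 := by
    linear_combination h1 + (c ^ 2 + d ^ 2) * h0 - (a * c + b * d) * hac
  have hD : a * d - c * b - 1 = 0 :=
    (mul_eq_zero.1 hsq).resolve_right (by linarith)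
  have hsum : (d - a) ^ 2 + (c + b) ^ 2 = 0 := by linear_combination h0 + h1 - 2 * hD
  have e1 : (d - a) ^ 2 = 0 := le_antisymm (by linarith [sq_nonneg (c + b)]) (sq_nonneg _)
  have e2 : (c + b) ^ 2 = 0 := by linarith
  exact ⟨sub_eq_zero.1 (pow_eq_zero_iff two_ne_zero |>.1 e1),
    eq_neg_of_add_eq_zero_left (pow_eq_zero_iff two_ne_zero |>.1 e2)⟩

/-- An orientation preserving motion of the plane with a fixed point is a rotation. -/
lemma eq_planeRot {g : Euc 2} {p : Rn 2} (hp : g p = p) (hdet : 0 < eucDet g) :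
    ∃ a b : ℝ, a ^ 2 + b ^ 2 = 1 ∧ (∀ v, g.linear v = planeRot a b v) ∧
      ∀ v, g v = p + planeRot a b (v - p) := by
  have h0 := rn_two_norm_sq (g.linear (stdVec 0))
  have h1 := rn_two_norm_sq (g.linear (stdVec 1))
  have h2 := rn_two_norm_sq (g.linear (stdVec 0 + stdVec 1))
  have hn : ∀ v, ‖g.linear v‖ = ‖v‖ := fun v => g.linearIsometryEquiv.norm_map v
  rw [hn, rn_two_norm_sq] at h0 h1 h2
  have hd := det_rn_two (g.linear : Rn 2 →ₗ[ℝ] Rn 2)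
  rw [map_add] at h2
  have hdet' : 0 < LinearMap.det (g.linear : Rn 2 →ₗ[ℝ] Rn 2) := hdet
  rw [hd] at hdet'
  simp at h0 h1 h2 hdet'
  set a := (g.linearIsometryEquiv (stdVec 0)) 0
  set b := (g.linearIsometryEquiv (stdVec 0)) 1
  set c := (g.linearIsometryEquiv (stdVec 1)) 0
  set d := (g.linearIsometryEquiv (stdVec 1)) 1
  obtain ⟨hd', hc'⟩ := planeRot_entries h0.symm h1.symm h2.symm hdet'
  have hlin : ∀ v, g.linear v = planeRot a b v := by
    intro v
    conv_lhs => rw [← sum_smul_stdVec v, Fin.sum_univ_two, map_add, map_smul, map_smul]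
    ext i
    fin_cases i
    · change v 0 * a + v 1 * c = a * v 0 - b * v 1
      rw [hc']; ring
    · change v 0 * b + v 1 * d = b * v 0 + a * v 1
      rw [hd']; ring
  refine ⟨a, b, h0.symm, hlin, fun v => ?_⟩
  have e1 := euc_apply g v
  have e2 := euc_apply g p
  rw [← hlin, map_sub, e1]
  rw [hp] at e2
  nth_rw 1 [e2]
  abel

lemma exists_planeRot (p : Rn 2) {a b : ℝ} (h : a ^ 2 + b ^ 2 = 1) :
    ∃ g : Euc 2, g p = p ∧ 0 < eucDet g ∧ ∀ v, g v = p + planeRot a b (v - p) := by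
  let f : Rn 2 →ₗᵢ[ℝ] Rn 2 := ⟨planeRot a b, fun v => by
    rw [← sq_eq_sq₀ (norm_nonneg _) (norm_nonneg _), rn_two_norm_sq, rn_two_norm_sq]
    simp only [planeRot_apply_zero, planeRot_apply_one]
    linear_combination (v 0 ^ 2 + v 1 ^ 2) * h⟩
  let e : Euc 2 := (f.toLinearIsometryEquiv rfl).toAffineIsometryEquiv
  let τ : Euc 2 := AffineIsometryEquiv.constVAdd ℝ (Rn 2) p
  have hτ : ∀ v, τ⁻¹ v = v - p := fun v => by
    have : τ (v - p) = v := by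
      change p + (v - p) = v
      abel
    rw [← this, euc_inv_apply_self, this]
  have hg : ∀ v, (τ * e * τ⁻¹) v = p + planeRot a b (v - p) := fun v => by
    rw [euc_mul_apply, euc_mul_apply, hτ]
    rfl
  refine ⟨τ * e * τ⁻¹, ?_, ?_, hg⟩
  · rw [hg, sub_self, map_zero, add_zero]
  · have : eucDet e = LinearMap.det (planeRot a b) := rfl
    rw [eucDet_conj, this, det_rn_two]
    simp
    nlinarith

lemma isEntireRational_eval {σ τ : Type*} (P : τ → MvPolynomial σ ℝ) :
    IsEntireRational fun y t => MvPolynomial.eval y (P t) :=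
  fun t => ⟨P t, 1, fun y => by simp⟩

/-- The group of rotations about `p`. -/
lemma exists_rotationSubgroup (p : Rn 2) : ∃ K : Subgroup (Euc 2),
    IsConjSubgroup K (orthSubgroup 2 2 ⊓ eucPlus 2) ∧ ∀ g, g ∈ K ↔ g p = p ∧ 0 < eucDet g := by
  let τ : Euc 2 := AffineIsometryEquiv.constVAdd ℝ (Rn 2) p
  have hτ : τ 0 = p := add_zero p
  refine ⟨_, ⟨τ, rfl⟩, fun g => ?_⟩
  constructor
  · rintro ⟨h, ⟨hh, hd⟩, rfl⟩
    refine ⟨?_, ?_⟩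
    · change (τ * h * τ⁻¹) p = p
      rw [euc_mul_apply, euc_mul_apply]
      nth_rw 1 [← hτ]
      rw [euc_inv_apply_self, hh.1, hτ]
    · change 0 < eucDet (τ * h * τ⁻¹)
      rw [eucDet_conj]
      exact hd
  · rintro ⟨h1, h2⟩
    -- In the plane, `O(2)` only has to fix the origin; its condition on basis vectors is vacuous.
    refine ⟨τ⁻¹ * g * τ, ⟨⟨?_, fun i hi => absurd hi (by omega)⟩, ?_⟩, ?_⟩
    · rw [euc_mul_apply, euc_mul_apply, hτ, h1]
      nth_rw 1 [← hτ]
      rw [euc_inv_apply_self]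
    · change 0 < eucDet (τ⁻¹ * g * τ)
      have := eucDet_conj τ⁻¹ g
      rw [inv_inv] at this
      rwa [this]
    · change τ * (τ⁻¹ * g * τ) * τ⁻¹ = g
      group

/-- The slice of rotations: sets of configurations in the plane that are invariant under the
rotations about a point `p` and on which a vertex has constant positive distance from `p`. -/
lemma actionIsIso_rotation {V : Type*} {Z : Set (V → Rn 2)} {p : Rn 2} {K : Subgroup (Euc 2)}
    (hK : ∀ g, g ∈ K ↔ g p = p ∧ 0 < eucDet g) (hZ : ∀ g ∈ K, ∀ z ∈ Z, diagAct g z ∈ Z)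
    {w : V} {l : ℝ} (hl : 0 < l) (hw : ∀ z ∈ Z, ‖z w - p‖ = l) :
    ActionIsIso {z | z ∈ Z ∧ z w = p + l • stdVec 0} K Z := by
  have hrot : ∀ (a b : ℝ), p + planeRot a b (p + l • stdVec 0 - p) = p + l • !₂[a, b] := by
    intro a b
    ext i
    fin_cases i <;> simp
  -- A rotation carries `w` from its slice position to `p + l (a, b)`, so its entries are affine
  -- functions of the position of `w`.
  have key : ∀ z g, z w = p + l • stdVec 0 → g ∈ K → ∃ a b, a ^ 2 + b ^ 2 = 1 ∧
      (∀ v, g.linear v = planeRot a b v) ∧ (∀ v, g v = p + planeRot a b (v - p)) ∧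
      a = l⁻¹ * (diagAct g z w 0 - p 0) ∧ b = l⁻¹ * (diagAct g z w 1 - p 1) := by
    intro z g hz hg
    obtain ⟨h1, h2⟩ := (hK g).1 hg
    obtain ⟨a, b, h3, h4, h5⟩ := eq_planeRot h1 h2
    refine ⟨a, b, h3, h4, h5, ?_, ?_⟩
    all_goals
      change _ = l⁻¹ * (g (z w) _ - _)
      rw [h5, hz, hrot]
      simp [hl.ne']
  refine ⟨⟨?_, ?_, ?_⟩, ⟨_, isEntireRational_eval fun t => ∑ j, .X (.inr (.inl (t.2, j))) *
    .X (.inl (t.1, j)) + .X (.inr (.inr t.2)), ?_⟩, ?_⟩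
  · rintro ⟨z, g⟩ ⟨⟨hz, -⟩, hg⟩
    exact hZ g hg z hz
  · rintro ⟨z, g⟩ ⟨⟨hz, hzw⟩, hg⟩ ⟨z', g'⟩ ⟨⟨hz', hzw'⟩, hg'⟩ h
    simp only at h hzw hzw' hg hg'
    obtain ⟨a, b, -, -, h5, ha, hb⟩ := key z g hzw hg
    obtain ⟨a', b', -, -, h5', ha', hb'⟩ := key z' g' hzw' hg'
    rw [h, ← ha'] at ha
    rw [h, ← hb'] at hb
    have : g = g' := by
      ext1 v
      rw [h5, h5', ha, hb]
    subst this
    have h' := congrArg (diagAct g⁻¹) h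
    rw [diagAct_inv_self, diagAct_inv_self] at h'
    rw [h']
  · intro φ hφ
    have hn := rn_two_norm_sq (φ w - p)
    rw [hw φ hφ] at hn
    obtain ⟨g, h1, h2, h3⟩ := exists_planeRot p (a := l⁻¹ * (φ w - p) 0) (b := l⁻¹ * (φ w - p) 1) (by
      field_simp
      exact hn.symm)
    have hg : g ∈ K := (hK g).2 ⟨h1, h2⟩
    refine ⟨(diagAct g⁻¹ φ, g), ⟨⟨hZ _ (K.inv_mem hg) φ hφ, ?_⟩, hg⟩, diagAct_self_inv g φ⟩
    change g⁻¹ (φ w) = _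
    have : g (p + l • stdVec 0) = φ w := by
      rw [h3, hrot]
      ext i
      fin_cases i <;> simp [hl.ne']
    rw [← this, euc_inv_apply_self]
  · rintro ⟨z, g⟩ -
    funext ⟨v, i⟩
    simp only [map_add, map_sum, map_mul, MvPolynomial.eval_X]
    change ∑ j, (g.linear (stdVec j)) i * z v j + g 0 i = g (z v) i
    rw [euc_apply g (z v)]
    conv_rhs => rw [← sum_smul_stdVec (z v), map_sum]
    simp [mul_comm]
  -- The inverse is polynomial: `R` is the rotation matrix read off from `w`, its transpose rotates
  -- the configuration back about `p`, and the translation part is `p - R p`.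
  · let U : Fin 2 → MvPolynomial (V × Fin 2) ℝ := fun i => .C l⁻¹ * (.X (w, i) - .C (p i))
    let R : Fin 2 → Fin 2 → MvPolynomial (V × Fin 2) ℝ := ![![U 0, -U 1], ![U 1, U 0]]
    refine ⟨_, isEntireRational_eval (Sum.elim
      (fun t => .C (p t.2) + ∑ j, R j t.2 * (.X (t.1, j) - .C (p j)))
      (Sum.elim (fun t => R t.1 t.2) fun i => .C (p i) - ∑ j, R i j * .C (p j))), ?_⟩
    rintro ⟨z, g⟩ ⟨⟨hz, hzw⟩, hg⟩
    obtain ⟨a, b, h, h4, h5, ha, hb⟩ := key z g hzw hg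
    have hU0 : MvPolynomial.eval (configCoord (diagAct g z)) (U 0) = a := by
      simp only [U, map_mul, map_sub, MvPolynomial.eval_C, MvPolynomial.eval_X]
      exact ha.symm
    have hU1 : MvPolynomial.eval (configCoord (diagAct g z)) (U 1) = b := by
      simp only [U, map_mul, map_sub, MvPolynomial.eval_C, MvPolynomial.eval_X]
      exact hb.symm
    have hy : ∀ v i, configCoord (diagAct g z) (v, i) = p i + planeRot a b (z v - p) i :=
      fun v i => by
        change g (z v) i = _
        rw [h5]; rfl
    funext t
    rcases t with ⟨v, i⟩ | ⟨i, j⟩ | i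
    · simp only [Sum.elim_inl, map_add, map_mul, map_sub, MvPolynomial.eval_C,
        MvPolynomial.eval_X, Fin.sum_univ_two, hy, configEucCoord]
      change _ = z v i
      fin_cases i
      · simp [R, hU0, hU1]
        linear_combination (z v 0 - p 0) * h
      · simp [R, hU0, hU1]
        linear_combination (z v 1 - p 1) * h
    · change MvPolynomial.eval _ (R i j) = g.linear (stdVec j) i
      rw [h4]
      fin_cases i <;> fin_cases j <;> simp [R, hU0, hU1]
    · simp only [Sum.elim_inr, map_sub, MvPolynomial.eval_C, Fin.sum_univ_two,
        configEucCoord]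
      change _ = g 0 i
      rw [h5]
      fin_cases i
      · simp [R, hU0, hU1]; ring
      · simp [R, hU0, hU1]; ring

/-- Squared lengths are polynomial, and nothing is lost by squaring because lengths are positive. -/
lemma isRealAlgebraic_config {n : ℕ} {V : Type*} (L : ClassicalLinkage n V) :
    IsRealAlgebraic L.config := by
  refine ⟨{q | (∃ (v : L.fixed) (i : Fin n), q = .X (v.1, i) - .C (L.pos v i)) ∨
    ∃ (v w : V) (h : L.graph.Adj v w),
      q = ∑ i, (.X (v, i) - .X (w, i)) ^ 2 - .C (L.len ⟨s(v, w), h⟩ ^ 2)}, ?_⟩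
  ext φ
  constructor
  · rintro ⟨h1, h2⟩ q (⟨v, i, rfl⟩ | ⟨v, w, h, rfl⟩)
    · simp [configCoord, h1 v]
    · rw [← h2 v w h, EuclideanSpace.real_norm_sq_eq]
      simp [configCoord]
  · intro h
    refine ⟨fun v => ?_, fun v w hvw => ?_⟩
    · ext i
      have := h _ (Or.inl ⟨v, i, rfl⟩)
      simpa [configCoord, sub_eq_zero] using this
    · have := h _ (Or.inr ⟨v, w, hvw, rfl⟩)
      rw [← sq_eq_sq₀ (norm_nonneg _) (L.len_pos _).le, EuclideanSpace.real_norm_sq_eq]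
      simpa [configCoord, sub_eq_zero] using this

lemma isRealAlgebraic_and_eq {n : ℕ} {V : Type*} {Z : Set (V → Rn n)}
    (hZ : IsRealAlgebraic Z) (w : V) (c : Rn n) : IsRealAlgebraic {z | z ∈ Z ∧ z w = c} := by
  obtain ⟨S, rfl⟩ := hZ
  refine ⟨S ∪ Set.range fun i => .X (w, i) - .C (c i), ?_⟩
  ext z
  constructor
  · rintro ⟨h1, h2⟩ q (hq | ⟨i, rfl⟩)
    · exact h1 q hq
    · simp [configCoord, h2]
  · intro h
    refine ⟨fun q hq => h q (Or.inl hq), ?_⟩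
    ext i
    have := h _ (Or.inr ⟨i, rfl⟩)
    simpa [configCoord, sub_eq_zero] using this

/-- The configuration space of a connected planar linkage with a single fixed vertex splits off
the rotations about this vertex. -/
theorem exists_rotational_slice {V : Type*} (L : ClassicalLinkage 2 V) (hL : L.graph.Connected)
    (hfix : L.fixed.ncard = 1) (hv : ∃ v : V, v ∉ L.fixed) :
    ∃ (Z' : Set (V → Rn 2)) (K : Subgroup (Euc 2)),
      Z' ⊆ L.config ∧ IsRealAlgebraic Z' ∧
      IsConjSubgroup K (orthSubgroup 2 2 ⊓ eucPlus 2) ∧ ActionIsIso Z' K L.config := by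
  obtain ⟨v₀, hv₀⟩ := Set.ncard_eq_one.1 hfix
  have hmem : v₀ ∈ L.fixed := hv₀ ▸ rfl
  obtain ⟨v, hv⟩ := hv
  have hne : v₀ ≠ v := fun h => hv (h ▸ hmem)
  have : Nontrivial V := ⟨v₀, v, hne⟩
  obtain ⟨w, hw⟩ := hL.preconnected.exists_adj_of_nontrivial v₀
  have hpos : ∀ u : L.fixed, L.pos u = L.pos ⟨v₀, hmem⟩ := by
    intro u
    have : u = ⟨v₀, hmem⟩ := Subtype.ext ((Set.ext_iff.1 hv₀ u.1).1 u.2)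
    rw [this]
  obtain ⟨K, hK1, hK2⟩ := exists_rotationSubgroup (L.pos ⟨v₀, hmem⟩)
  refine ⟨_, K, fun z hz => hz.1, isRealAlgebraic_and_eq (isRealAlgebraic_config L) w _, hK1,
    actionIsIso_rotation hK2 ?_ (L.len_pos ⟨s(v₀, w), hw⟩) ?_⟩
  · rintro g hg z ⟨h1, h2⟩
    refine ⟨fun u => ?_, fun a b hab => ?_⟩
    · change g (z u) = _
      rw [h1, hpos u]
      exact ((hK2 g).1 hg).1
    · rw [← h2 a b hab]
      exact euc_dist g _ _
  · rintro z ⟨h1, h2⟩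
    rw [← h2 v₀ w hw, ← h1 ⟨v₀, hmem⟩, norm_sub_rev]

end LinkageUniversality

theorem mainTheorem7 :
    (∀ (n k : ℕ), 2 ≤ n → ∀ Z : Set (Fin k → Rn n), IsCompact Z → IsRealAlgebraic Z →
      ∀ G : Subgroup (Euc n), (∀ g ∈ G, ∀ z ∈ Z, diagAct g z ∈ Z) →
      ∃ (m : ℕ) (L : ClassicalLinkage n (Fin k ⊕ Fin m)) (F : Finset ℝ)
        (α : (Fin k → Rn n) × ℝ → (Fin m → Rn n)),
        L.graph.Connected ∧ F.Nonempty ∧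
        AnalyticOnNhd ℝ α (Z ×ˢ (F : Set ℝ)) ∧
        L.config = {φ | ∃ x ∈ Z, ∃ f ∈ F, φ = Sum.elim x (α (x, f))} ∧
        IsAnalyticIso
          (fun p : (Fin k → Rn n) × ℝ => (Sum.elim p.1 (α p) : Fin k ⊕ Fin m → Rn n))
          (Z ×ˢ (F : Set ℝ)) L.config ∧
        (IsConjSubgroup G (orthSubgroup n 1) → L.fixed.ncard = n ∧ L.FixedWithin G) ∧
        (RotationalSlice G Z → L.fixed.ncard = n - 1 ∧ L.FixedWithin G) ∧
        (¬ IsConjSubgroup G (orthSubgroup n 1) → ¬ RotationalSlice G Z →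
          L.fixed.ncard = n + 1 ∧
          Set.range L.pos = insert 0 (Set.range fun i : Fin n => stdVec i))) ∧
    (∀ (V : Type*) [Finite V] (L : ClassicalLinkage 2 V),
      L.graph.Connected → L.fixed.ncard = 1 → (∃ v : V, v ∉ L.fixed) →
      ∃ (Z' : Set (V → Rn 2)) (K : Subgroup (Euc 2)),
        Z' ⊆ L.config ∧ IsRealAlgebraic Z' ∧
        IsConjSubgroup K (orthSubgroup 2 2 ⊓ eucPlus 2) ∧
        ActionIsIso Z' K L.config) :=
  ⟨fun _ _ hn _ hc ha _ hG => LinkageUniversality.exists_linkage_of_isRealAlgebraic hn hc ha hG,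
    fun _ _ L h1 h2 h3 => LinkageUniversality.exists_rotational_slice L h1 h2 h3⟩
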